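/- A graph here is finite and has no loops or multiple edges, but may have half-edges, i.e. edges incident with exactly one vertex (several half-edges may be attached to the same vertex). It is cubic if every vertex is incident with exactly three edges, half-edges included. It is connected, triangle-free, or outerplanar if the simple graph formed by its vertices and its full edges is; outerplanar means that this graph has a drawing without crossings in the plane in which all vertices lie on the boundary of the unbounded face. The line graph $L(G)$ has all edges and half-edges of $G$ as its vertices, two distinct ones being adjacent if they have a common vertex. For a graph $X$, a $3$-coloring is a partition of $V(X)$ into three independent, possibly empty, sets, its color classes. The $3$-coloring complex $B(X)$ is the graph whose vertices are all color classes of all $3$-colorings of $X$, two distinct color classes being adjacent if they appear together in a $3$-coloring of $X$. A graph $G$ is edge-reflexive if $X=L(G)$ is $3$-colorable and the canonical map $$\phi_X : v\mapsto \{C\in V(B(X)) : v\in C\}\qquad (v\in V(X))$$ is a graph isomorphism from $X$ to $B(B(X))$. Theorem 3.1. Let $G$ be a connected cubic outerplanar graph, with half-edges allowed. Then $G$ is edge-reflexive if and only if $G$ is triangle-free. -/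

import Mathlib

/-! ### Coloring complexes and reflexive graphs -/

/-- The vertices of the `k`-coloring complex of `X`: the color classes of all `k`-colorings of `X`
(a `k`-coloring being a partition of the vertices into `k` independent, possibly empty, sets). -/
def ColorClass {V : Type*} (k : ℕ) (X : SimpleGraph V) : Type _ :=
  {S : Set V // ∃ (c : X.Coloring (Fin k)) (i : Fin k), S = c.colorClass i}

/-- The `k`-coloring complex `B(X)`: two distinct color classes are joined by an edge if they
appear together in a `k`-coloring of `X`. -/
def coloringComplex {V : Type*} (k : ℕ) (X : SimpleGraph V) : SimpleGraph (ColorClass k X) where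
  Adj S T := S ≠ T ∧ ∃ (c : X.Coloring (Fin k)) (i j : Fin k),
    S.1 = c.colorClass i ∧ T.1 = c.colorClass j
  symm := ⟨fun _ _ ⟨hne, c, i, j, hi, hj⟩ => ⟨hne.symm, c, j, i, hj, hi⟩⟩
  loopless := ⟨fun _ h => h.1 rfl⟩

/-- The value of the canonical map at `v`: the set of all color classes of `X` that contain `v`. -/
def canonicalClass {V : Type*} (k : ℕ) (X : SimpleGraph V) (v : V) : Set (ColorClass k X) :=
  {C | v ∈ C.1}

/-- A `3`-colorable graph `X` is reflexive (for `3`-colorings) if `v ↦ {C ∈ V(B(X)) | v ∈ C}` is a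
well-defined map from `V(X)` to `V(B(B(X)))` and is a graph isomorphism from `X` to `B(B(X))`. -/
def IsReflexive {V : Type*} (X : SimpleGraph V) : Prop :=
  X.Colorable 3 ∧
    ∃ φ : X ≃g coloringComplex 3 (coloringComplex 3 X), ∀ v : V, (φ v).1 = canonicalClass 3 X v

/-! ### Graphs with half-edges -/

/-- A graph with vertex set `V`, without loops and multiple edges, together with a family of
half-edges indexed by `H`, each of which is incident with exactly one vertex. -/
structure HalfEdgeGraph (V H : Type*) where
  /-- the vertices and the full edges -/
  graph : SimpleGraph V
  /-- the vertex that a half-edge is incident with -/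
  attach : H → V

namespace HalfEdgeGraph

variable {V H : Type*}

/-- The edges of `G`: full edges and half-edges. -/
abbrev Edge (G : HalfEdgeGraph V H) : Type _ := G.graph.edgeSet ⊕ H

/-- The vertices incident with an edge: two for a full edge, one for a half-edge. -/
def ends (G : HalfEdgeGraph V H) : G.Edge → Set V
  | Sum.inl e => {v | v ∈ (e : Sym2 V)}
  | Sum.inr h => {G.attach h}

/-- Every vertex is incident with exactly three edges, half-edges included. -/
def IsCubic (G : HalfEdgeGraph V H) : Prop :=
  ∀ v : V, {e : G.Edge | v ∈ G.ends e}.ncard = 3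

/-- The line graph `L(G)`: its vertices are all the edges of `G`, half-edges included, and two
of them are adjacent if they are distinct and have a common vertex. -/
def lineGraph (G : HalfEdgeGraph V H) : SimpleGraph G.Edge where
  Adj e f := e ≠ f ∧ ∃ v : V, v ∈ G.ends e ∧ v ∈ G.ends f
  symm := ⟨fun _ _ ⟨hne, v, he, hf⟩ => ⟨hne.symm, v, hf, he⟩⟩
  loopless := ⟨fun _ h => h.1 rfl⟩

/-- `G` is edge-reflexive if it is `3`-edge-colorable and `L(G)` is a reflexive graph
(`IsReflexive` contains the `3`-colorability of `L(G)`). -/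
def IsEdgeReflexive (G : HalfEdgeGraph V H) : Prop := IsReflexive G.lineGraph

end HalfEdgeGraph

/-! ### Plane drawings and outerplanar graphs -/

/-- A drawing of a simple graph in the Euclidean plane without crossings: distinct vertices are
distinct points, every edge is a simple arc joining its two ends, an arc contains no vertices other
than the ends of its edge, and two different arcs meet only in common ends. -/
structure PlaneDrawing {V : Type*} (G : SimpleGraph V) where
  /-- the point that represents a vertex -/
  point : V → EuclideanSpace ℝ (Fin 2)
  /-- the arc that represents an edge -/
  arc : G.edgeSet → Set (EuclideanSpace ℝ (Fin 2))
  point_injective : Function.Injective point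
  arc_simple : ∀ (u v : V) (h : G.Adj u v), ∃ γ : Path (point u) (point v),
    Function.Injective γ ∧ Set.range γ = arc ⟨s(u, v), h⟩
  vertex_mem_arc : ∀ (v : V) (e : G.edgeSet), point v ∈ arc e → v ∈ (e : Sym2 V)
  arc_inter : ∀ e f : G.edgeSet, e ≠ f → ∀ x ∈ arc e ∩ arc f,
    ∃ v : V, v ∈ (e : Sym2 V) ∧ v ∈ (f : Sym2 V) ∧ x = point v

namespace PlaneDrawing

variable {V : Type*} {G : SimpleGraph V}

/-- The set of all points of the drawing. -/
def support (D : PlaneDrawing G) : Set (EuclideanSpace ℝ (Fin 2)) :=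
  Set.range D.point ∪ ⋃ e : G.edgeSet, D.arc e

/-- The faces of a drawing are the connected components of its complement. -/
def IsFace (D : PlaneDrawing G) (F : Set (EuclideanSpace ℝ (Fin 2))) : Prop :=
  ∃ x ∈ D.supportᶜ, F = connectedComponentIn D.supportᶜ x

end PlaneDrawing

/-- A graph is outerplanar if it has a plane drawing in which all of its vertices lie on the
boundary of the unbounded face. -/
def IsOuterplanar {V : Type*} (G : SimpleGraph V) : Prop :=
  ∃ (D : PlaneDrawing G) (F : Set (EuclideanSpace ℝ (Fin 2))),
    D.IsFace F ∧ ¬ Bornology.IsBounded F ∧ ∀ v : V, D.point v ∈ frontier F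

/-! ### Nonplanarity of the complete bipartite graph on `3 + 3` vertices -/

/-! One direction is elementary. If `u`, `v`, `w` form a triangle, then in every 3-edge-colouring
the edge `uv` has the colour of the third edge at `w`. These two edges lie in the same colour
classes, so the canonical map is not injective (`IsStarGraph.cliqueFree`).

For the converse, note that a colour class of the line graph contains exactly one edge at every
vertex. Each vertex `w` therefore gives a 3-colouring of the colouring complex: colour a class by
its edge at `w`. The classes of this colouring are the canonical images of the three edges at `w`.
What has to be shown is that the complex has no other 3-colourings; then the canonical map is onto
and reflects adjacency. A 3-colouring of the complex is a system that assigns to every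
edge-colouring `c` a permutation `f c` of the colours, such that `f c s` depends only on the class
of the colour `s` in `c`. The core of the proof is an Arrow-type theorem: every system is dictated
by a vertex `w`, that is, `f c (c x)` depends only on `x` for the edges `x` at `w`
(`NoK23Minor.hasDictators`). Injectivity of the canonical map is `NoK23Minor.exists_separate`.

Outerplanarity enters only through the absence of a `K₂,₃` minor, which follows from the
nonplanarity of `K₃,₃`. A connected triangle-free graph without this minor is a vertex, an edge, a
union of two smaller connected graphs that share a vertex, or a smaller connected graph with a
chordless cycle of length at least four attached along an edge (`NoK23Minor.decompose`). The cycle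
can be chosen such that a prescribed root stays in the old part, which allows inductions that fix
the colours at the root.

The engine of the induction is `dichotomy`. If a system depends on two independent arguments, and if
each argument can be varied by steps that preserve a colour class subject to suitable restrictions,
then the system ignores one of the arguments. Two injective maps on three letters that agree on two
letters are equal, and this rigidity makes it work. At a cut vertex the arguments are the colourings
of the two sides, and the induction hypothesis for the relevant side supplies the dictator. The
steps exist because the colourings that agree at the root are connected under sharing a colour class
that avoids a given edge which has no end besides the root (`NoK23Minor.sharingConnected`).

For an attached cycle the arguments are a colouring of the old part and a cyclic word, formed by the
colours of the cycle edges; the words are treated in `IsWord.connected` and `IsWordSystem.dictated`.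
They interact through the type of the colouring: the two cycle edges next to the attaching edge have
equal or different colours. The dichotomy is applied to the equal type, where the colouring and the
word vary independently. Linked words, which can follow a change of type while the class of the
attaching edge is kept, carry the result over to the other type. -/

/-- A nonvanishing continuous function on a simply connected space has a continuous logarithm. -/
theorem exists_continuous_log {X : Type*} [TopologicalSpace X] [SimplyConnectedSpace X]
    [LocallyPathConnectedSpace X] (g : X → ℂ) (hg : Continuous g) (h0 : ∀ x, g x ≠ 0) :
    ∃ f : X → ℂ, Continuous f ∧ ∀ x, Complex.exp (f x) = g x := by
  obtain ⟨x₀⟩ : Nonempty X := inferInstance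
  obtain ⟨F, ⟨-, hF⟩, -⟩ := Complex.isCoveringMapOn_exp.existsUnique_continuousMap_lifts
    (⟨g, hg⟩ : C(X, ℂ)) (a₀ := x₀) (e₀ := Complex.log (g x₀)) (Complex.exp_log (h0 x₀))
    (fun x => h0 x)
  exact ⟨F, F.continuous, fun x => congrFun hF x⟩

/-- Two continuous functions on the line whose exponentials are proportional have the same
increments. -/
theorem increment_eq_of_exp_eq_mul {f g : ℝ → ℂ} (hf : Continuous f) (hg : Continuous g) (c : ℂ)
    (h : ∀ t, Complex.exp (f t) = c * Complex.exp (g t)) : f 1 - f 0 = g 1 - g 0 := by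
  have hc : c = Complex.exp (f 0 - g 0) := by
    rw [Complex.exp_sub, h 0, mul_div_cancel_right₀ _ (Complex.exp_ne_zero _)]
  have key : f = fun t => g t + (f 0 - g 0) := by
    refine Complex.isCoveringMap_exp.eq_of_comp_eq hf (by fun_prop) ?_ 0 (by ring)
    funext t
    simp only [Function.comp_apply, Subtype.mk.injEq]
    rw [h t, Complex.exp_add, ← hc, mul_comm]
  have := congrFun key 1
  rw [this]; ring

/-- The complete bipartite graph on `3 + 3` vertices cannot be drawn in the plane such that
any two edges without a common end are disjoint. -/
theorem not_exists_drawing_K33 (a b : Fin 3 → ℂ) (γ : Fin 3 → Fin 3 → ℝ → ℂ)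
    (hc : ∀ i j, Continuous (γ i j)) (h0 : ∀ i j, γ i j 0 = a i) (h1 : ∀ i j, γ i j 1 = b j)
    (hd : ∀ i i' j j', i ≠ i' → j ≠ j' → ∀ s t, γ i j s ≠ γ i' j' t) : False := by
  classical
  have haa : ∀ i k, i ≠ k → a i - a k ≠ 0 := by
    intro i k hik
    have := hd i k 0 1 hik (by decide) 0 0
    rw [h0, h0] at this
    exact sub_ne_zero.2 this
  have hbb : ∀ j k, j ≠ k → b j - b k ≠ 0 := by
    intro j k hjk
    have := hd 0 1 j k (by decide) hjk 1 1
    rw [h1, h1] at this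
    exact sub_ne_zero.2 this
  have hba : ∀ i j, b j - a i ≠ 0 := by
    intro i j
    have := hd (i + 1) i j (j + 1) (by simp) (by simp) 1 0
    rw [h0, h1] at this
    exact sub_ne_zero.2 this
  -- For `k ≠ i` the curve `γ i j` avoids `a k`, because `a k` lies on `γ k (j + 1)`, an edge
  -- without a common end. The same argument with the sides exchanged serves for `hB`.
  have hA : ∀ i j k, ∃ f : ℝ → ℂ, i ≠ k → Continuous f ∧ ∀ s, Complex.exp (f s) = γ i j s - a k := by
    intro i j k
    by_cases hik : i = k
    · exact ⟨0, fun h => absurd hik h⟩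
    obtain ⟨f, hf⟩ := exists_continuous_log (fun s => γ i j s - a k) ((hc i j).sub continuous_const)
      (fun s => by
        have := hd i k j (j + 1) hik (by simp) s 0
        rw [h0] at this
        exact sub_ne_zero.2 this)
    exact ⟨f, fun _ => hf⟩
  have hB : ∀ i j k, ∃ f : ℝ → ℂ, j ≠ k → Continuous f ∧ ∀ s, Complex.exp (f s) = γ i j s - b k := by
    intro i j k
    by_cases hjk : j = k
    · exact ⟨0, fun h => absurd hjk h⟩
    obtain ⟨f, hf⟩ := exists_continuous_log (fun s => γ i j s - b k) ((hc i j).sub continuous_const)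
      (fun s => by
        have := hd i (i + 1) j k (by simp) hjk s 1
        rw [h1] at this
        exact sub_ne_zero.2 this)
    exact ⟨f, fun _ => hf⟩
  choose fA hfA using hA
  choose fB hfB using hB
  -- The difference of two disjoint curves is a nonvanishing function of two parameters, so its
  -- logarithm has total increment zero around the unit square. On each side of the square one of
  -- the curves rests at a vertex; on two sides the difference is taken in the opposite order,
  -- whence the factor `-1`.
  have cell : ∀ i i' j j', i ≠ i' → j ≠ j' →
      (fA i j i' 1 - fA i j i' 0) + (fB i' j' j 1 - fB i' j' j 0)
        = (fA i' j' i 1 - fA i' j' i 0) + (fB i j j' 1 - fB i j j' 0) := by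
    intro i i' j j' hi hj
    obtain ⟨L, hL, hLe⟩ := exists_continuous_log (fun p : ℝ × ℝ => γ i j p.1 - γ i' j' p.2)
      (((hc i j).comp continuous_fst).sub ((hc i' j').comp continuous_snd))
      (fun p => sub_ne_zero.2 (hd i i' j j' hi hj p.1 p.2))
    have e1 := increment_eq_of_exp_eq_mul (f := fun s => L (s, 0)) (by fun_prop)
      (hfA i j i' hi).1 1 (fun s => by rw [hLe, (hfA i j i' hi).2]; simp [h0])
    have e2 := increment_eq_of_exp_eq_mul (f := fun s => L (s, 1)) (by fun_prop)
      (hfB i j j' hj).1 1 (fun s => by rw [hLe, (hfB i j j' hj).2]; simp [h1])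
    have e3 := increment_eq_of_exp_eq_mul (f := fun s => L (0, s)) (by fun_prop)
      (hfA i' j' i hi.symm).1 (-1) (fun s => by rw [hLe, (hfA i' j' i hi.symm).2]; simp [h0])
    have e4 := increment_eq_of_exp_eq_mul (f := fun s => L (1, s)) (by fun_prop)
      (hfB i' j' j hj.symm).1 (-1) (fun s => by rw [hLe, (hfB i' j' j hj.symm).2]; simp [h1])
    linear_combination -e1 + e2 + e3 - e4
  -- logarithms of the differences of the vertices, chosen antisymmetrically up to `π i`
  let u : Fin 3 → Fin 3 → ℂ := fun i j => Complex.log (b j - a i)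
  let v : Fin 3 → Fin 3 → ℂ := fun i k =>
    if i < k then Complex.log (a i - a k) else Complex.log (a k - a i) + Real.pi * Complex.I
  let w : Fin 3 → Fin 3 → ℂ := fun i k =>
    if i < k then Complex.log (b i - b k) else Complex.log (b k - b i) + Real.pi * Complex.I
  have hu : ∀ i j, Complex.exp (u i j) = b j - a i := fun i j => Complex.exp_log (hba i j)
  have hv : ∀ i k, i ≠ k → Complex.exp (v i k) = a i - a k := by
    intro i k hik
    by_cases h : i < k
    · simp only [v, if_pos h]; exact Complex.exp_log (haa i k hik)
    · simp only [v, if_neg h]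
      rw [Complex.exp_add, Complex.exp_log (haa k i hik.symm), Complex.exp_pi_mul_I]; ring
  have hw : ∀ i k, i ≠ k → Complex.exp (w i k) = b i - b k := by
    intro i k hik
    by_cases h : i < k
    · simp only [w, if_pos h]; exact Complex.exp_log (hbb i k hik)
    · simp only [w, if_neg h]
      rw [Complex.exp_add, Complex.exp_log (hbb k i hik.symm), Complex.exp_pi_mul_I]; ring
  have hn : ∀ k i j, ∃ n : ℤ, i ≠ k →
      fA i j k 1 - fA i j k 0 = u k j - v i k + n * (2 * Real.pi * Complex.I) := by
    intro k i j
    by_cases hik : i = k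
    · exact ⟨0, fun h => absurd hik h⟩
    obtain ⟨n, hn⟩ := Complex.exp_eq_exp_iff_exists_int.1
      (show Complex.exp (fA i j k 1 - fA i j k 0) = Complex.exp (u k j - v i k) by
        rw [Complex.exp_sub, Complex.exp_sub, (hfA i j k hik).2, (hfA i j k hik).2, hu, hv i k hik,
          h0, h1])
    exact ⟨n, fun _ => hn⟩
  have hm : ∀ k i j, ∃ n : ℤ, j ≠ k →
      fB i j k 1 - fB i j k 0 = w j k - u i k - Real.pi * Complex.I
        + n * (2 * Real.pi * Complex.I) := by
    intro k i j
    by_cases hik : j = k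
    · exact ⟨0, fun h => absurd hik h⟩
    obtain ⟨n, hn⟩ := Complex.exp_eq_exp_iff_exists_int.1
      (show Complex.exp (fB i j k 1 - fB i j k 0)
          = Complex.exp (w j k - u i k - Real.pi * Complex.I) by
        rw [Complex.exp_sub, Complex.exp_sub, Complex.exp_sub, (hfB i j k hik).2,
          (hfB i j k hik).2, hu, hw j k hik, h0, h1, Complex.exp_pi_mul_I, div_div]
        congr 1; ring)
    exact ⟨n, fun _ => hn⟩
  choose n hn using hn
  choose m hm using hm
  have hpi : (2 * Real.pi * Complex.I : ℂ) ≠ 0 := by simp [Real.pi_ne_zero, Complex.I_ne_zero]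
  -- All chosen logarithms cancel except for the half turns by which `v` and `w` fail to be
  -- symmetric. The two half turns add up to a full turn or cancel, according to the order of `j`
  -- and `j'`.
  have key : ∀ i i' j j', i < i' → j ≠ j' →
      n i' i j + m j i' j' - n i i' j' - m j' i j = if j < j' then -1 else 0 := by
    intro i i' j j' hi hj
    have hc := cell i i' j j' hi.ne hj
    rw [hn i' i j hi.ne, hm j i' j' hj.symm, hn i i' j' hi.ne', hm j' i j hj] at hc
    have hv' : v i' i = v i i' + Real.pi * Complex.I := by
      simp only [v, if_pos hi, if_neg hi.asymm]
    rw [hv'] at hc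
    have : ((n i' i j + m j i' j' - n i i' j' - m j' i j : ℤ) : ℂ)
        = ((if j < j' then -1 else 0 : ℤ) : ℂ) := by
      apply mul_right_cancel₀ hpi
      rcases lt_or_gt_of_ne hj with h | h
      · have hw' : w j' j = w j j' + Real.pi * Complex.I := by
          simp only [w, if_pos h, if_neg h.asymm]
        rw [hw'] at hc
        rw [if_pos h]
        push_cast
        linear_combination hc
      · have hw' : w j j' = w j' j + Real.pi * Complex.I := by
          simp only [w, if_pos h, if_neg h.asymm]
        rw [hw'] at hc
        rw [if_neg h.asymm]
        push_cast
        linear_combination hc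
    exact_mod_cast this
  -- The 18 pairs of edges without a common end give an inconsistent system already modulo 2: every
  -- integer `n k i j` or `m k i j` occurs in exactly two equations, with coefficient `1` or `-1`,
  -- while the right sides sum to `-9`.
  have e1 := key 0 1 0 1 (by decide) (by decide)
  have e2 := key 0 1 0 2 (by decide) (by decide)
  have e3 := key 0 1 1 2 (by decide) (by decide)
  have e4 := key 0 1 1 0 (by decide) (by decide)
  have e5 := key 0 1 2 0 (by decide) (by decide)
  have e6 := key 0 1 2 1 (by decide) (by decide)
  have f1 := key 0 2 0 1 (by decide) (by decide)
  have f2 := key 0 2 0 2 (by decide) (by decide)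
  have f3 := key 0 2 1 2 (by decide) (by decide)
  have f4 := key 0 2 1 0 (by decide) (by decide)
  have f5 := key 0 2 2 0 (by decide) (by decide)
  have f6 := key 0 2 2 1 (by decide) (by decide)
  have g1 := key 1 2 0 1 (by decide) (by decide)
  have g2 := key 1 2 0 2 (by decide) (by decide)
  have g3 := key 1 2 1 2 (by decide) (by decide)
  have g4 := key 1 2 1 0 (by decide) (by decide)
  have g5 := key 1 2 2 0 (by decide) (by decide)
  have g6 := key 1 2 2 1 (by decide) (by decide)
  simp only [show ((0 : Fin 3) < 1) = True by decide, show ((0 : Fin 3) < 2) = True by decide,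
    show ((1 : Fin 3) < 2) = True by decide, show ((1 : Fin 3) < 0) = False by decide,
    show ((2 : Fin 3) < 0) = False by decide, show ((2 : Fin 3) < 1) = False by decide,
    if_true, if_false] at e1 e2 e3 e4 e5 e6 f1 f2 f3 f4 f5 f6 g1 g2 g3 g4 g5 g6
  clear hn hm key hv hw hu cell hfA hfB
  omega

/-! ### Outerplanar graphs have no minor `K₂,₃` -/

section Reach

variable {V : Type*}

/-- Two vertices are joined by a walk inside the set `S`. -/
def ReachIn (G : SimpleGraph V) (S : Set V) : V → V → Prop :=
  Relation.ReflTransGen fun a b => G.Adj a b ∧ a ∈ S ∧ b ∈ S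

/-- The set `S` induces a connected (or empty) subgraph. -/
def ConnIn (G : SimpleGraph V) (S : Set V) : Prop :=
  ∀ a ∈ S, ∀ b ∈ S, ReachIn G S a b

variable {G : SimpleGraph V} {S T : Set V} {a b c : V}

theorem ReachIn.symm (h : ReachIn G S a b) : ReachIn G S b a :=
  haveI : Std.Symm fun a b => G.Adj a b ∧ a ∈ S ∧ b ∈ S :=
    ⟨fun _ _ h => ⟨h.1.symm, h.2.2, h.2.1⟩⟩
  Std.Symm.symm (r := Relation.ReflTransGen fun a b => G.Adj a b ∧ a ∈ S ∧ b ∈ S) _ _ h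

theorem ReachIn.trans (h : ReachIn G S a b) (h' : ReachIn G S b c) : ReachIn G S a c :=
  Relation.ReflTransGen.trans h h'

theorem ReachIn.mono (hST : S ⊆ T) (h : ReachIn G S a b) : ReachIn G T a b :=
  Relation.ReflTransGen.mono (fun _ _ h => ⟨h.1, hST h.2.1, hST h.2.2⟩) _ _ h

theorem ReachIn.of_adj (h : G.Adj a b) (ha : a ∈ S) (hb : b ∈ S) : ReachIn G S a b :=
  Relation.ReflTransGen.single ⟨h, ha, hb⟩

theorem ReachIn.mem (h : ReachIn G S a b) (ha : a ∈ S) : b ∈ S := by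
  rcases Relation.ReflTransGen.cases_tail h with rfl | ⟨c, -, hc⟩
  · exact ha
  · exact hc.2.2

/-- A walk that starts in a set which is closed under adjacency inside `S` stays in it. -/
theorem ReachIn.mem_of_closed (h : ReachIn G S a b) (ha : a ∈ T)
    (hT : ∀ x ∈ T, ∀ y ∈ S, G.Adj x y → y ∈ T) : b ∈ T := by
  induction h with
  | refl => exact ha
  | tail _ hs ih => exact hT _ ih _ hs.2.2 hs.1

/-- A walk that starts in a set which is closed under adjacency inside `S` is a walk in that set. -/
theorem ReachIn.inter_of_closed (h : ReachIn G S a b) (ha : a ∈ T)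
    (hT : ∀ x ∈ T, ∀ y ∈ S, G.Adj x y → y ∈ T) : ReachIn G T a b := by
  induction h with
  | refl => exact .refl
  | @tail p q hp hs ih =>
    have hpT := ReachIn.mem_of_closed hp ha hT
    exact ih.tail ⟨hs.1, hpT, hT _ hpT _ hs.2.2 hs.1⟩

theorem ConnIn.of_root (r : V) (h : ∀ a ∈ S, ReachIn G S r a) : ConnIn G S :=
  fun a ha b hb => (h a ha).symm.trans (h b hb)

end Reach

/-! ### Regions of a drawing spanned by sets of vertices -/

namespace PlaneDrawing

variable {V : Type*} {G : SimpleGraph V} (D : PlaneDrawing G)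

/-- The part of a drawing spanned by a set of vertices. -/
def region (S : Set V) : Set (EuclideanSpace ℝ (Fin 2)) :=
  D.point '' S ∪ {x | ∃ e : G.edgeSet, (∀ v ∈ (e : Sym2 V), v ∈ S) ∧ x ∈ D.arc e}

theorem region_subset_support (S : Set V) : D.region S ⊆ D.support := by
  rintro x (⟨v, -, rfl⟩ | ⟨e, -, hx⟩)
  · exact Or.inl ⟨v, rfl⟩
  · exact Or.inr (Set.mem_iUnion.2 ⟨e, hx⟩)

theorem point_mem_region {S : Set V} {v : V} (h : D.point v ∈ D.region S) : v ∈ S := by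
  rcases h with ⟨w, hw, hwv⟩ | ⟨e, he, hx⟩
  · exact D.point_injective hwv ▸ hw
  · exact he v (D.vertex_mem_arc v e hx)

/-- Different arcs meet only in common ends, and an arc contains no vertices besides its ends. So a
common point would yield a vertex in both sets. -/
theorem disjoint_region {S T : Set V} (h : Disjoint S T) : Disjoint (D.region S) (D.region T) := by
  rw [Set.disjoint_left]
  rintro x (⟨v, hv, rfl⟩ | ⟨e, he, hx⟩) hT
  · exact Set.disjoint_left.1 h hv (D.point_mem_region hT)
  · rcases hT with ⟨w, hw, rfl⟩ | ⟨f, hf, hxf⟩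
    · exact Set.disjoint_left.1 h (he w (D.vertex_mem_arc w e hx)) hw
    · have hef : e ≠ f := by
        rintro rfl
        obtain ⟨s, hs⟩ := e
        induction s with
        | _ p q => exact Set.disjoint_left.1 h (he p (by simp)) (hf p (by simp))
      obtain ⟨v, hve, hvf, -⟩ := D.arc_inter e f hef x ⟨hx, hxf⟩
      exact Set.disjoint_left.1 h (he v hve) (hf v hvf)

theorem exists_path_of_reachIn {S : Set V} {a b : V} (h : ReachIn G S a b) (ha : a ∈ S) :
    ∃ γ : Path (D.point a) (D.point b), ∀ t, γ t ∈ D.region S := by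
  induction h with
  | refl => exact ⟨Path.refl _, fun t => Or.inl ⟨a, ha, rfl⟩⟩
  | @tail p q _ hs ih =>
    obtain ⟨γ, hγ⟩ := ih
    obtain ⟨δ, -, hδ⟩ := D.arc_simple p q hs.1
    refine ⟨γ.trans δ, fun t => ?_⟩
    have : (γ.trans δ) t ∈ Set.range (γ.trans δ) := ⟨t, rfl⟩
    rw [Path.trans_range] at this
    rcases this with ⟨s, hs'⟩ | hs'
    · exact hs' ▸ hγ s
    · refine Or.inr ⟨⟨s(p, q), hs.1⟩, fun v hv => ?_, hδ ▸ hs'⟩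
      rcases Sym2.mem_iff.1 hv with rfl | rfl
      exacts [hs.2.1, hs.2.2]

theorem isClosed_support [Finite V] : IsClosed D.support := by
  refine IsClosed.union (Set.finite_range _).isClosed (isClosed_iUnion_of_finite fun e => ?_)
  obtain ⟨e, he⟩ := e
  induction e with
  | _ p q =>
    obtain ⟨γ, -, hγ⟩ := D.arc_simple p q he
    rw [← hγ]
    exact (isCompact_range γ.continuous).isClosed

end PlaneDrawing

/-- A graph has no minor `K₂,₃` (the latter with parts `A, B` and `X 0, X 1, X 2`). -/
def NoK23Minor {V : Type*} (G : SimpleGraph V) : Prop :=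
  ∀ (A B : Set V) (X : Fin 3 → Set V), ConnIn G A → ConnIn G B → (∀ i, ConnIn G (X i)) →
    Disjoint A B → (∀ i, Disjoint A (X i)) → (∀ i, Disjoint B (X i)) →
    (∀ i j, i ≠ j → Disjoint (X i) (X j)) → (∀ i, ∃ a ∈ A, ∃ x ∈ X i, G.Adj a x) →
    (∀ i, ∃ b ∈ B, ∃ x ∈ X i, G.Adj b x) → False

/-- A point `z` of the face that touches all vertices serves as a third vertex opposite to `X 0, X
1, X 2`, and the minor becomes a drawing of `K₃,₃`. The curves need not be simple and curves with a
common end may cross, since `not_exists_drawing_K33` only looks at edges without a common end. -/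
theorem IsOuterplanar.noK23Minor {V : Type*} [Finite V] {G : SimpleGraph V}
    (h : IsOuterplanar G) : NoK23Minor G := by
  obtain ⟨D, F, ⟨z, hz, rfl⟩, -, hF⟩ := h
  intro A B X hA hB hX hAB hAX hBX hXX hAadj hBadj
  choose aa haa x hx hax using hAadj
  choose bb hbb x' hx' hbx using hBadj
  set F := connectedComponentIn D.supportᶜ z with hFdef
  have hFsub : F ⊆ D.supportᶜ := connectedComponentIn_subset _ _
  have hFopen : IsOpen F := D.isClosed_support.isOpen_compl.connectedComponentIn
  have hFpath : IsPathConnected F :=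
    hFopen.isConnected_iff_isPathConnected.1 (isConnected_connectedComponentIn_iff.2 hz)
  have hzF : z ∈ F := mem_connectedComponentIn hz
  have hα : ∀ i, ∃ γ : Path (D.point (aa 0)) (D.point (x i)), ∀ t, γ t ∈ D.region (A ∪ X i) := by
    intro i
    refine D.exists_path_of_reachIn ?_ (Or.inl (haa 0))
    refine ((hA _ (haa 0) _ (haa i)).mono Set.subset_union_left).trans ?_
    exact .of_adj (hax i) (Or.inl (haa i)) (Or.inr (hx i))
  have hβ : ∀ i, ∃ γ : Path (D.point (bb 0)) (D.point (x i)), ∀ t, γ t ∈ D.region (B ∪ X i) := by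
    intro i
    refine D.exists_path_of_reachIn ?_ (Or.inl (hbb 0))
    refine ((hB _ (hbb 0) _ (hbb i)).mono Set.subset_union_left).trans ?_
    refine ReachIn.trans (.of_adj (hbx i) (Or.inl (hbb i)) (Or.inr (hx' i))) ?_
    exact (hX i _ (hx' i) _ (hx i)).mono Set.subset_union_right
  choose α hα using hα
  choose β hβ using hβ
  have hdAB : ∀ i j, i ≠ j → ∀ s t, α i s ≠ β j t := by
    intro i j hij s t hst
    refine Set.disjoint_left.1 (D.disjoint_region (S := A ∪ X i) (T := B ∪ X j) ?_) (hα i s)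
      (hst ▸ hβ j t)
    rw [Set.disjoint_union_left, Set.disjoint_union_right, Set.disjoint_union_right]
    exact ⟨⟨hAB, hAX j⟩, (hBX i).symm, hXX i j hij⟩
  have hxα : ∀ i j, i ≠ j → D.point (x i) ∉ Set.range (α j) ∪ Set.range (β j) := by
    rintro i j hij (⟨t, ht⟩ | ⟨t, ht⟩)
    · rcases D.point_mem_region (ht ▸ hα j t) with h | h
      · exact Set.disjoint_left.1 (hAX i) h (hx i)
      · exact Set.disjoint_left.1 (hXX i j hij) (hx i) h
    · rcases D.point_mem_region (ht ▸ hβ j t) with h | h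
      · exact Set.disjoint_left.1 (hBX i) h (hx i)
      · exact Set.disjoint_left.1 (hXX i j hij) (hx i) h
  have hball : ∀ i, ∃ ε > 0, ∀ j, i ≠ j → Disjoint (Metric.ball (D.point (x i)) ε)
      (Set.range (α j) ∪ Set.range (β j)) := by
    intro i
    have hcl : IsClosed (⋃ j : {j // i ≠ j}, (Set.range (α j) ∪ Set.range (β j))) :=
      isClosed_iUnion_of_finite fun j => ((isCompact_range (α j).continuous).isClosed).union
        ((isCompact_range (β j).continuous).isClosed)
    obtain ⟨ε, hε, hb⟩ := Metric.isOpen_iff.1 hcl.isOpen_compl (D.point (x i)) (by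
      simp only [Set.mem_compl_iff, Set.mem_iUnion, not_exists]
      exact fun j => hxα i j j.2)
    refine ⟨ε, hε, fun j hij => Set.disjoint_left.2 fun p hp hq => hb hp ?_⟩
    exact Set.mem_iUnion.2 ⟨⟨j, hij⟩, hq⟩
  choose ε hε hball using hball
  -- It is not needed that `x i` is accessible from the face by an arc. The path stays in the face
  -- until it is close to `x i` and finishes in a disc, where it may cross only curves that lead to
  -- the same target.
  have hη : ∀ i, ∃ γ : Path z (D.point (x i)),
      ∀ t, γ t ∈ F ∪ Metric.ball (D.point (x i)) (ε i) := by
    intro i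
    obtain ⟨y, hyF, hy⟩ := Metric.mem_closure_iff.1 (frontier_subset_closure (hF (x i))) _ (hε i)
    obtain ⟨γ, hγ⟩ := hFpath.joinedIn z hzF y hyF
    obtain ⟨δ, hδ⟩ := ((convex_ball (D.point (x i)) (ε i)).isPathConnected
      ⟨_, Metric.mem_ball_self (hε i)⟩).joinedIn y (by rwa [Metric.mem_ball, dist_comm])
        (D.point (x i)) (Metric.mem_ball_self (hε i))
    refine ⟨γ.trans δ, fun t => ?_⟩
    have : (γ.trans δ) t ∈ Set.range (γ.trans δ) := ⟨t, rfl⟩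
    rw [Path.trans_range] at this
    rcases this with ⟨s, hs'⟩ | ⟨s, hs'⟩
    · exact Or.inl (hs' ▸ hγ s)
    · exact Or.inr (hs' ▸ hδ s)
  choose η hη using hη
  have hdη : ∀ i j, i ≠ j → ∀ s t, η i s ≠ α j t ∧ η i s ≠ β j t := by
    intro i j hij s t
    rcases hη i s with h | h
    · exact ⟨fun h' => hFsub h (D.region_subset_support _ (h' ▸ hα j t)),
        fun h' => hFsub h (D.region_subset_support _ (h' ▸ hβ j t))⟩
    · exact ⟨fun h' => Set.disjoint_left.1 (hball i j hij) h (Or.inl ⟨t, h'.symm⟩),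
        fun h' => Set.disjoint_left.1 (hball i j hij) h (Or.inr ⟨t, h'.symm⟩)⟩
  let Φ : EuclideanSpace ℝ (Fin 2) → ℂ := Complex.orthonormalBasisOneI.repr.symm
  have hΦc : Continuous Φ := LinearIsometryEquiv.continuous _
  have hΦi : Function.Injective Φ := LinearIsometryEquiv.injective _
  let c : Fin 3 → Fin 3 → ℝ → EuclideanSpace ℝ (Fin 2) :=
    ![fun j => (α j).extend, fun j => (β j).extend, fun j => (η j).extend]
  have hmem : ∀ {p q : EuclideanSpace ℝ (Fin 2)} (γ : Path p q) (s : ℝ), ∃ t, γ.extend s = γ t := by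
    intro p q γ s
    have : γ.extend s ∈ Set.range γ := by rw [← Path.extend_range]; exact ⟨s, rfl⟩
    obtain ⟨t, ht⟩ := this
    exact ⟨t, ht.symm⟩
  refine not_exists_drawing_K33 (Φ ∘ ![D.point (aa 0), D.point (bb 0), z])
    (fun i => Φ (D.point (x i))) (fun i j => Φ ∘ c i j) ?_ ?_ ?_ ?_
  · intro i j
    refine hΦc.comp ?_
    fin_cases i
    exacts [(α j).continuous_extend, (β j).continuous_extend, (η j).continuous_extend]
  · intro i j
    fin_cases i <;> simp [c]
  · intro i j
    fin_cases i <;> simp [c]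
  · intro i i' j j' hi hj s t hst
    replace hst := hΦi hst
    obtain ⟨a1, h1⟩ := hmem (α j) s
    obtain ⟨b1, h2⟩ := hmem (β j) s
    obtain ⟨c1, h3⟩ := hmem (η j) s
    obtain ⟨a2, h4⟩ := hmem (α j') t
    obtain ⟨b2, h5⟩ := hmem (β j') t
    obtain ⟨c2, h6⟩ := hmem (η j') t
    have hst' : c i j s = c i' j' t := hst
    fin_cases i <;> fin_cases i' <;> first | exact absurd rfl hi | skip
    all_goals simp only [c, Fin.zero_eta, Fin.mk_one, Fin.reduceFinMk, Matrix.cons_val] at hst'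
    · exact hdAB j j' hj _ _ (h1.symm.trans (hst'.trans h5))
    · exact (hdη j' j hj.symm _ _).1 (h6.symm.trans (hst'.symm.trans h1))
    · exact hdAB j' j hj.symm _ _ (h4.symm.trans (hst'.symm.trans h2))
    · exact (hdη j' j hj.symm _ _).2 (h6.symm.trans (hst'.symm.trans h2))
    · exact (hdη j j' hj _ _).1 (h3.symm.trans (hst'.trans h4))
    · exact (hdη j j' hj _ _).2 (h3.symm.trans (hst'.trans h5))

/-! ### Decomposition of triangle-free graphs without minor `K₂,₃` -/

section Decomposition

variable {V : Type*}

/-- The set `W` is the union of `Wa` and `Wb`, which share exactly the vertex `u` and have no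
edges in between. -/
structure VertexAmalgam (G : SimpleGraph V) (W Wa Wb : Set V) (u : V) : Prop where
  union : W = Wa ∪ Wb
  inter : Wa ∩ Wb = {u}
  conn_left : ConnIn G Wa
  conn_right : ConnIn G Wb
  no_cross : ∀ x ∈ Wa, ∀ y ∈ Wb, G.Adj x y → x = u ∨ y = u
  adj_left : ∃ a ∈ Wa, G.Adj u a
  adj_right : ∃ b ∈ Wb, G.Adj u b

/-- The vertices `q 0, …, q (m + 1)` form a chordless cycle, of length at least four. -/
structure ChordlessCycle (G : SimpleGraph V) (m : ℕ) (q : ℕ → V) : Prop where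
  two_le : 2 ≤ m
  injOn : Set.InjOn q (Set.Iic (m + 1))
  adj : ∀ i ≤ m, G.Adj (q i) (q (i + 1))
  adj_last : G.Adj (q 0) (q (m + 1))
  chordless : ∀ i ≤ m + 1, ∀ j ≤ m + 1, G.Adj (q i) (q j) →
    j = i + 1 ∨ i = j + 1 ∨ (i = 0 ∧ j = m + 1) ∨ (j = 0 ∧ i = m + 1)

/-- The set `W` is the union of `W₀` and of a chordless cycle, which share exactly two adjacent
vertices and have no other edges in between. -/
structure EarAmalgam (G : SimpleGraph V) (W W₀ : Set V) (m : ℕ) (q : ℕ → V) : Prop where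
  cycle : ChordlessCycle G m q
  union : W = W₀ ∪ q '' Set.Iic (m + 1)
  inter : W₀ ∩ q '' Set.Iic (m + 1) = {q 0, q (m + 1)}
  conn : ConnIn G W₀
  no_cross : ∀ x ∈ W₀, ∀ y ∈ q '' Set.Iic (m + 1), G.Adj x y →
    x ∈ ({q 0, q (m + 1)} : Set V) ∨ y ∈ ({q 0, q (m + 1)} : Set V)

variable {G : SimpleGraph V} {W : Set V}

theorem ReachIn.exists_walk {S : Set V} {a b : V} (h : ReachIn G S a b) (ha : a ∈ S) :
    ∃ p : G.Walk a b, ∀ v ∈ p.support, v ∈ S := by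
  induction h with
  | refl => exact ⟨.nil, by simpa using ha⟩
  | tail _ hs ih =>
    obtain ⟨p, hp⟩ := ih
    refine ⟨p.concat hs.1, fun v hv => ?_⟩
    rw [SimpleGraph.Walk.support_concat, List.mem_append] at hv
    rcases hv with hv | hv
    · exact hp v hv
    · rw [List.mem_singleton.1 hv]; exact hs.2.2

/-- Otherwise the vertices reached from `x` without `u` would be closed under adjacency in `W`, and
`u` could not be reached. -/
theorem ConnIn.exists_reach_adj {u x : V} (hW : ConnIn G W) (hu : u ∈ W) (hx : x ∈ W)
    (hxu : x ≠ u) : ∃ k, ReachIn G (W \ {u}) x k ∧ k ∈ W \ {u} ∧ G.Adj k u := by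
  by_contra hcon
  push Not at hcon
  have hmem : ∀ y, ReachIn G (W \ {u}) x y → y ∈ W \ {u} := fun y h => h.mem ⟨hx, hxu⟩
  have : u ∈ {y | ReachIn G (W \ {u}) x y} := by
    refine (hW x hx u hu).mem_of_closed (T := {y | ReachIn G (W \ {u}) x y}) .refl ?_
    intro y hy z hz hyz
    have hzu : z ≠ u := by
      rintro rfl
      exact hcon y hy (hmem y hy) hyz
    exact ReachIn.trans hy (.of_adj hyz (hmem y hy) ⟨hz, hzu⟩)
  exact (hmem u this).2 rfl

/-- Let `K` be one component of what remains without `u`. The parts are `K` together with `u`, and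
the complement of `K`, which contains `u`. They are connected because every component has a
neighbour of `u`. -/
theorem exists_vertexAmalgam {u : V} (hW : ConnIn G W) (hu : u ∈ W)
    (hcut : ¬ ConnIn G (W \ {u})) : ∃ Wa Wb, VertexAmalgam G W Wa Wb u := by
  unfold ConnIn at hcut
  push Not at hcut
  obtain ⟨a, ha, b, hb, hab⟩ := hcut
  have hmem : ∀ y, ReachIn G (W \ {u}) a y → y ∈ W \ {u} := fun y h => h.mem ha
  set K : Set V := {y | ReachIn G (W \ {u}) a y} with hK
  have hKsub : K ⊆ W \ {u} := hmem
  have hclosed : ∀ x ∈ K, ∀ y ∈ W \ {u}, G.Adj x y → y ∈ K :=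
    fun x hx y hy h => ReachIn.trans hx (.of_adj h (hmem x hx) hy)
  have hreachK : ∀ x ∈ K, ∀ y, ReachIn G (W \ {u}) x y → ReachIn G K x y :=
    fun x hx y h => h.inter_of_closed hx hclosed
  refine ⟨insert u K, W \ K, ?_, ?_, ?_, ?_, ?_, ?_, ?_⟩
  · ext x
    simp only [Set.mem_union, Set.mem_insert_iff, Set.mem_sdiff]
    constructor
    · intro hx
      by_cases hxK : x ∈ K
      · exact Or.inl (Or.inr hxK)
      · exact Or.inr ⟨hx, hxK⟩
    · rintro ((rfl | hx) | hx)
      exacts [hu, (hKsub hx).1, hx.1]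
  · ext x
    simp only [Set.mem_inter_iff, Set.mem_insert_iff, Set.mem_sdiff, Set.mem_singleton_iff]
    constructor
    · rintro ⟨rfl | h, h'⟩
      · rfl
      · exact absurd h h'.2
    · rintro rfl
      exact ⟨Or.inl rfl, hu, fun h => (hKsub h).2 rfl⟩
  · refine ConnIn.of_root u ?_
    rintro x (rfl | hx)
    · exact .refl
    · obtain ⟨k, hk, hkW, hku⟩ := hW.exists_reach_adj hu (hKsub hx).1 (hKsub hx).2
      have hkK : k ∈ K := ReachIn.trans hx hk
      exact ReachIn.symm (((hreachK x hx k hk).mono (Set.subset_insert _ _)).trans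
        (.of_adj hku (Or.inr hkK) (Or.inl rfl)))
  · refine ConnIn.of_root u ?_
    rintro x ⟨hxW, hxK⟩
    by_cases hxu : x = u
    · subst hxu; exact .refl
    · obtain ⟨k, hk, hkW, hku⟩ := hW.exists_reach_adj hu hxW hxu
      have hcl : ∀ p ∈ (W \ {u}) \ K, ∀ q ∈ W \ {u}, G.Adj p q → q ∈ (W \ {u}) \ K :=
        fun p hp q hq h => ⟨hq, fun hqK => hp.2 (hclosed q hqK p hp.1 h.symm)⟩
      have h1 := hk.inter_of_closed (T := (W \ {u}) \ K) ⟨⟨hxW, hxu⟩, hxK⟩ hcl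
      have h2 := hk.mem_of_closed (T := (W \ {u}) \ K) ⟨⟨hxW, hxu⟩, hxK⟩ hcl
      have h3 : ReachIn G (W \ K) x k := h1.mono fun y hy => ⟨hy.1.1, hy.2⟩
      exact ReachIn.symm (h3.trans
        (.of_adj hku ⟨hkW.1, h2.2⟩ ⟨hu, fun h => (hKsub h).2 rfl⟩))
  · rintro x (rfl | hx) y hy h
    · exact Or.inl rfl
    · by_contra hcon
      push Not at hcon
      exact hy.2 (hclosed x hx y ⟨hy.1, hcon.2⟩ h)
  · obtain ⟨k, hk, hkW, hku⟩ := hW.exists_reach_adj hu ha.1 ha.2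
    exact ⟨k, Or.inr hk, hku.symm⟩
  · obtain ⟨k, hk, hkW, hku⟩ := hW.exists_reach_adj hu hb.1 hb.2
    exact ⟨k, ⟨hkW.1, fun hkK => hab (ReachIn.trans hkK hk.symm)⟩, hku.symm⟩

/-- The interior `C \ {r, r'}` of `C` is separated by the edge `r r'` from the rest of `W`. -/
structure EdgePocket (G : SimpleGraph V) (W R C : Set V) (r r' : V) : Prop where
  subset : C ⊆ W
  left_mem : r ∈ C
  right_mem : r' ∈ C
  adj : G.Adj r r'
  nonempty : (C \ {r, r'}).Nonempty
  closed : ∀ x ∈ C \ {r, r'}, ∀ y ∈ W, G.Adj x y → y ∈ C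
  disjoint : ∀ x ∈ C \ {r, r'}, x ∉ R

namespace EdgePocket

variable {R C : Set V} {r r' : V}

/-- A component of the interior, together with `r` and `r'`, is again a pocket, so by minimality it
is everything. -/
theorem reachIn_of_minimal (h : EdgePocket G W R C r r')
    (hmin : ∀ C' p p', EdgePocket G W R C' p p' → C' ⊆ C → C' = C) : ConnIn G (C \ {r, r'}) := by
  intro x hx y hy
  have hmem : ∀ z, ReachIn G (C \ {r, r'}) x z → z ∈ C \ {r, r'} := fun z hz => hz.mem hx
  have hne : ∀ z, ReachIn G (C \ {r, r'}) x z → z ∉ ({r, r'} : Set V) := fun z hz => (hmem z hz).2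
  have hdiff : ({z | ReachIn G (C \ {r, r'}) x z} ∪ {r, r'}) \ {r, r'}
      = {z | ReachIn G (C \ {r, r'}) x z} := by
    ext z
    simp only [Set.mem_sdiff, Set.mem_union, Set.mem_ofPred_eq]
    exact ⟨fun hz => hz.1.resolve_right hz.2, fun hz => ⟨Or.inl hz, hne z hz⟩⟩
  have hsub : {z | ReachIn G (C \ {r, r'}) x z} ∪ {r, r'} ⊆ C := by
    rintro z (hz | rfl | rfl)
    exacts [(hmem z hz).1, h.left_mem, h.right_mem]
  have := hmin ({z | ReachIn G (C \ {r, r'}) x z} ∪ {r, r'}) r r'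
    { subset := hsub.trans h.subset
      left_mem := Or.inr (by simp)
      right_mem := Or.inr (by simp)
      adj := h.adj
      nonempty := by rw [hdiff]; exact ⟨x, .refl⟩
      closed := by
        rw [hdiff]
        intro z hz w hw hzw
        by_cases hwr : w ∈ ({r, r'} : Set V)
        · exact Or.inr hwr
        · exact Or.inl (ReachIn.trans hz
            (.of_adj hzw (hmem z hz) ⟨h.closed z (hmem z hz) w hw hzw, hwr⟩))
      disjoint := by
        rw [hdiff]
        exact fun z hz => h.disjoint z (hmem z hz) } hsub
  have hy' : y ∈ {z | ReachIn G (C \ {r, r'}) x z} ∪ {r, r'} := by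
    rw [this]; exact hy.1
  exact hy'.resolve_right hy.2

/-- In a minimal pocket no edge `w a` separates two further neighbours of `w`. -/
theorem reachIn_neighbors_of_minimal (h : EdgePocket G W R C r r')
    (hmin : ∀ C' p p', EdgePocket G W R C' p p' → C' ⊆ C → C' = C)
    {w a b c : V} (hw : w ∈ C) (ha : a ∈ C) (hb : b ∈ C) (hc : c ∈ C) (hwa : G.Adj w a)
    (hwb : G.Adj w b) (hwc : G.Adj w c) (hab : a ≠ b) (hac : a ≠ c) :
    ReachIn G (W \ {w, a}) b c := by
  by_contra hcon
  -- If the component of `b` contains neither `r` nor `r'`, it stays in the interior of the pocket.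
  -- With `w` and `a` added it is a pocket inside `C` that misses `c`, contrary to minimality.
  have aux : ∀ b c, b ∈ C → c ∈ C → G.Adj w b → G.Adj w c → a ≠ b → a ≠ c →
      ¬ ReachIn G (W \ {w, a}) b c → ¬ ReachIn G (W \ {w, a}) b r →
      ¬ ReachIn G (W \ {w, a}) b r' → False := by
    intro b c hb hc hwb hwc hab hac hbc hbr hbr'
    have hbW : b ∈ W \ {w, a} := ⟨h.subset hb, by
      rintro (rfl | rfl)
      exacts [hwb.ne rfl, hab rfl]⟩
    have hmem : ∀ z, ReachIn G (W \ {w, a}) b z → z ∈ W \ {w, a} := fun z hz => hz.mem hbW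
    have hnr : ∀ z, ReachIn G (W \ {w, a}) b z → z ∉ ({r, r'} : Set V) := by
      rintro z hz (rfl | rfl)
      exacts [hbr hz, hbr' hz]
    have hX : ∀ z, ReachIn G (W \ {w, a}) b z → z ∈ C \ {r, r'} := by
      intro z hz
      induction hz with
      | refl => exact ⟨hb, hnr b .refl⟩
      | @tail p q hp hs ih =>
        exact ⟨h.closed p ih q hs.2.2.1 hs.1, hnr q (hp.tail hs)⟩
    have hdiff : ({z | ReachIn G (W \ {w, a}) b z} ∪ {w, a}) \ {w, a}
        = {z | ReachIn G (W \ {w, a}) b z} := by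
      ext z
      simp only [Set.mem_sdiff, Set.mem_union, Set.mem_ofPred_eq]
      exact ⟨fun hz => hz.1.resolve_right hz.2, fun hz => ⟨Or.inl hz, (hmem z hz).2⟩⟩
    have hsub : {z | ReachIn G (W \ {w, a}) b z} ∪ {w, a} ⊆ C := by
      rintro z (hz | rfl | rfl)
      exacts [(hX z hz).1, hw, ha]
    have := hmin ({z | ReachIn G (W \ {w, a}) b z} ∪ {w, a}) w a
      { subset := hsub.trans h.subset
        left_mem := Or.inr (by simp)
        right_mem := Or.inr (by simp)
        adj := hwa
        nonempty := by rw [hdiff]; exact ⟨b, .refl⟩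
        closed := by
          rw [hdiff]
          intro z hz x hx hzx
          by_cases hxr : x ∈ ({w, a} : Set V)
          · exact Or.inr hxr
          · exact Or.inl (ReachIn.trans hz (.of_adj hzx (hmem z hz) ⟨hx, hxr⟩))
        disjoint := by
          rw [hdiff]
          exact fun z hz => h.disjoint z (hX z hz) } hsub
    have hc' : c ∈ {z | ReachIn G (W \ {w, a}) b z} ∪ {w, a} := by
      rw [this]; exact hc
    rcases hc' with hc' | rfl | rfl
    exacts [hbc hc', hwc.ne rfl, hac rfl]
  have hcon' : ¬ ReachIn G (W \ {w, a}) c b := fun h' => hcon h'.symm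
  -- As `r` and `r'` are adjacent, they cannot lie on different sides. So the component of `b` or
  -- that of `c` avoids both.
  have hrr : ∀ x, x ∈ W \ {w, a} → ReachIn G (W \ {w, a}) x r → ReachIn G (W \ {w, a}) c r' →
      c ∈ W \ {w, a} → ReachIn G (W \ {w, a}) x c := fun x hx h1 h2 hc =>
    h1.trans (ReachIn.trans (.of_adj h.adj (h1.mem hx) (h2.mem hc)) h2.symm)
  have hrr' : ∀ x, x ∈ W \ {w, a} → ReachIn G (W \ {w, a}) x r' → ReachIn G (W \ {w, a}) c r →
      c ∈ W \ {w, a} → ReachIn G (W \ {w, a}) x c := fun x hx h1 h2 hc =>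
    h1.trans (ReachIn.trans (.of_adj h.adj.symm (h1.mem hx) (h2.mem hc)) h2.symm)
  have hbW : b ∈ W \ {w, a} := ⟨h.subset hb, by
    rintro (rfl | rfl)
    exacts [hwb.ne rfl, hab rfl]⟩
  have hcW : c ∈ W \ {w, a} := ⟨h.subset hc, by
    rintro (rfl | rfl)
    exacts [hwc.ne rfl, hac rfl]⟩
  by_cases h1 : ReachIn G (W \ {w, a}) b r
  · exact aux c b hc hb hwc hwb hac hab hcon' (fun h' => hcon (h1.trans h'.symm))
      (fun h' => hcon (hrr b hbW h1 h' hcW))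
  · by_cases h2 : ReachIn G (W \ {w, a}) b r'
    · exact aux c b hc hb hwc hwb hac hab hcon' (fun h' => hcon (hrr' b hbW h2 h' hcW))
        (fun h' => hcon (h2.trans h'.symm))
    · exact aux b c hb hc hwb hwc hab hac hcon h1 h2

end EdgePocket

/-- Two nonadjacent vertices that are joined in `S` are both adjacent to one connected component of
what remains of `S` without a set `T` that contains them and is avoided otherwise. -/
theorem ReachIn.exists_component {S : Set V} {b c : V} (h : ReachIn G S b c) (hb : b ∈ S)
    (hbc : b ≠ c) (hnadj : ¬ G.Adj b c) :
    ∃ x ∈ S \ {b, c}, ∃ y, ReachIn G (S \ {b, c}) x y ∧ G.Adj b x ∧ G.Adj y c := by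
  by_contra hcon
  push Not at hcon
  have : c ∈ {z | z = b ∨ ∃ x ∈ S \ {b, c}, G.Adj b x ∧ ReachIn G (S \ {b, c}) x z} := by
    refine h.mem_of_closed (Or.inl rfl) ?_
    rintro p (rfl | ⟨x, hx, hbx, hxp⟩) q hq hpq
    · refine Or.inr ⟨q, ⟨hq, ?_⟩, hpq, .refl⟩
      rintro (rfl | rfl)
      exacts [hpq.ne rfl, hnadj hpq]
    · by_cases hqb : q = b
      · exact Or.inl hqb
      · have hqc : q ≠ c := by
          rintro rfl
          exact hcon x hx p hxp hbx hpq
        refine Or.inr ⟨x, hx, hbx, hxp.trans (.of_adj hpq (hxp.mem hx) ⟨hq, ?_⟩)⟩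
        rintro (rfl | rfl)
        exacts [hqb rfl, hqc rfl]
  rcases this with rfl | ⟨x, hx, -, hxc⟩
  · exact hbc rfl
  · exact (hxc.mem hx).2 (Or.inr rfl)

theorem connIn_component {S : Set V} (x : V) (hx : x ∈ S) : ConnIn G {z | ReachIn G S x z} := by
  refine ConnIn.of_root x fun y hy => ?_
  exact ReachIn.inter_of_closed hy .refl
    fun p hp q hq hpq => ReachIn.trans hp (.of_adj hpq (ReachIn.mem hp hx) hq)

theorem connIn_singleton (x : V) : ConnIn G {x} := by
  rintro a rfl b rfl
  exact .refl

/-- Three neighbours of a vertex `w` such that any two are joined without `w` and the third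
yield a triangle or a minor `K₂,₃`. -/
theorem NoK23Minor.false_of_three_neighbors (hG : NoK23Minor G) (hT : G.CliqueFree 3)
    {w a b c : V} (hwa : G.Adj w a) (hwb : G.Adj w b) (hwc : G.Adj w c)
    (haW : a ∈ W) (hbW : b ∈ W) (hcW : c ∈ W) (hab : a ≠ b) (hac : a ≠ c) (hbc : b ≠ c)
    (h1 : ReachIn G (W \ {w, a}) b c) (h2 : ReachIn G (W \ {w, b}) a c)
    (h3 : ReachIn G (W \ {w, c}) a b) : False := by
  have tri : ∀ x y, G.Adj w x → G.Adj w y → ¬ G.Adj x y := by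
    intro x y hx hy hxy
    classical
    exact hT {w, x, y} (SimpleGraph.is3Clique_triple_iff.2 ⟨hx, hy, hxy⟩)
  -- Without triangles `a`, `b`, `c` are pairwise nonadjacent, so each two of them are joined
  -- through a component of `H`. Either one component is adjacent to all three, or three different
  -- components serve one pair each; both cases give the minor.
  set H : Set V := W \ {w, a, b, c} with hH
  have e1 : (W \ {w, a}) \ {b, c} = H := by
    ext x; simp only [hH, Set.mem_sdiff, Set.mem_insert_iff, Set.mem_singleton_iff]; tauto
  have e2 : (W \ {w, b}) \ {a, c} = H := by
    ext x; simp only [hH, Set.mem_sdiff, Set.mem_insert_iff, Set.mem_singleton_iff]; tauto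
  have e3 : (W \ {w, c}) \ {a, b} = H := by
    ext x; simp only [hH, Set.mem_sdiff, Set.mem_insert_iff, Set.mem_singleton_iff]; tauto
  obtain ⟨x1, hx1, y1, hxy1, hbx1, hyc1⟩ := h1.exists_component
    ⟨hbW, by rintro (rfl | rfl); exacts [hwb.ne rfl, hab rfl]⟩ hbc (tri b c hwb hwc)
  obtain ⟨x2, hx2, y2, hxy2, hax2, hyc2⟩ := h2.exists_component
    ⟨haW, by rintro (rfl | rfl); exacts [hwa.ne rfl, hab rfl]⟩ hac (tri a c hwa hwc)
  obtain ⟨x3, hx3, y3, hxy3, hax3, hyb3⟩ := h3.exists_component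
    ⟨haW, by rintro (rfl | rfl); exacts [hwa.ne rfl, hac rfl]⟩ hab (tri a b hwa hwb)
  rw [e1] at hx1 hxy1
  rw [e2] at hx2 hxy2
  rw [e3] at hx3 hxy3
  have hwH : w ∉ H := fun h => h.2 (by simp)
  have haH : a ∉ H := fun h => h.2 (by simp)
  have hbH : b ∉ H := fun h => h.2 (by simp)
  have hcH : c ∉ H := fun h => h.2 (by simp)
  -- a component adjacent to all three neighbours
  have all : ∀ x ∈ H, (∃ y, ReachIn G H x y ∧ G.Adj a y) → (∃ y, ReachIn G H x y ∧ G.Adj b y) →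
      (∃ y, ReachIn G H x y ∧ G.Adj c y) → False := by
    rintro x hx ⟨p, hp, hap⟩ ⟨q, hq, hbq⟩ ⟨s, hs, hcs⟩
    have hsub : ∀ z ∈ {z | ReachIn G H x z}, z ∈ H := fun z hz => ReachIn.mem hz hx
    refine hG {w} {z | ReachIn G H x z} ![{a}, {b}, {c}] (connIn_singleton w)
      (connIn_component x hx) ?_ ?_ ?_ ?_ ?_ ?_ ?_
    · intro i; fin_cases i <;> exact connIn_singleton _
    · exact Set.disjoint_singleton_left.2 fun h => hwH (hsub w h)
    · intro i
      fin_cases i <;> simp only [Fin.zero_eta, Fin.mk_one, Fin.reduceFinMk, Matrix.cons_val,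
        Set.disjoint_singleton]
      exacts [hwa.ne, hwb.ne, hwc.ne]
    · intro i
      fin_cases i <;> simp only [Fin.zero_eta, Fin.mk_one, Fin.reduceFinMk, Matrix.cons_val,
        Set.disjoint_singleton_right]
      exacts [fun h => haH (hsub _ h), fun h => hbH (hsub _ h), fun h => hcH (hsub _ h)]
    · intro i j hij
      fin_cases i <;> fin_cases j <;> simp_all [eq_comm]
    · intro i
      fin_cases i
      exacts [⟨w, rfl, a, rfl, hwa⟩, ⟨w, rfl, b, rfl, hwb⟩, ⟨w, rfl, c, rfl, hwc⟩]
    · intro i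
      fin_cases i
      exacts [⟨p, hp, a, rfl, hap.symm⟩, ⟨q, hq, b, rfl, hbq.symm⟩, ⟨s, hs, c, rfl, hcs.symm⟩]
  have n12 : ¬ ReachIn G H x1 x2 := fun h => all x1 hx1 ⟨x2, h, hax2⟩ ⟨x1, .refl, hbx1⟩
    ⟨y1, hxy1, hyc1.symm⟩
  have n13 : ¬ ReachIn G H x1 x3 := fun h => all x1 hx1 ⟨x3, h, hax3⟩ ⟨x1, .refl, hbx1⟩
    ⟨y1, hxy1, hyc1.symm⟩
  have n23 : ¬ ReachIn G H x2 x3 := fun h => all x2 hx2 ⟨x2, .refl, hax2⟩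
    ⟨y3, h.trans hxy3, hyb3.symm⟩ ⟨y2, hxy2, hyc2.symm⟩
  have hdisj : ∀ x y, ¬ ReachIn G H x y → ∀ z, ReachIn G H x z → ¬ ReachIn G H y z :=
    fun x y h z hx hy => h (hx.trans hy.symm)
  have hm1 : ∀ z, ReachIn G H x1 z → z ∈ H := fun z hz => hz.mem hx1
  have hm2 : ∀ z, ReachIn G H x2 z → z ∈ H := fun z hz => hz.mem hx2
  have hm3 : ∀ z, ReachIn G H x3 z → z ∈ H := fun z hz => hz.mem hx3
  have hconn : ConnIn G ({z | ReachIn G H x2 z} ∪ {c} ∪ {z | ReachIn G H x1 z}) := by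
    refine ConnIn.of_root c ?_
    rintro z ((hz | rfl) | hz)
    · refine ReachIn.symm (ReachIn.trans
        (((connIn_component (G := G) x2 hx2) z hz y2 hxy2).mono ?_)
        (.of_adj hyc2 (Or.inl (Or.inl hxy2)) (Or.inl (Or.inr rfl))))
      exact fun t ht => Or.inl (Or.inl ht)
    · exact .refl
    · refine ReachIn.symm (ReachIn.trans
        (((connIn_component (G := G) x1 hx1) z hz y1 hxy1).mono ?_)
        (.of_adj hyc1 (Or.inr hxy1) (Or.inl (Or.inr rfl))))
      exact fun t ht => Or.inr ht
  -- The three links between `a` and `b` are `w`, the component of `x3`, and `c` with the two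
  -- components that connect it to `a` and to `b`.
  refine hG {a} {b} ![{w}, {z | ReachIn G H x3 z},
    {z | ReachIn G H x2 z} ∪ {c} ∪ {z | ReachIn G H x1 z}] (connIn_singleton _)
    (connIn_singleton _) ?_ ?_ ?_ ?_ ?_ ?_ ?_
  · intro i
    fin_cases i
    exacts [connIn_singleton _, connIn_component x3 hx3, hconn]
  · exact Set.disjoint_singleton.2 hab
  · intro i
    fin_cases i <;> simp only [Fin.zero_eta, Fin.mk_one, Fin.reduceFinMk, Matrix.cons_val,
        Set.disjoint_singleton_left]
    · exact hwa.ne'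
    · exact fun h => haH (hm3 _ h)
    · rintro ((h | h) | h)
      exacts [haH (hm2 _ h), hac h, haH (hm1 _ h)]
  · intro i
    fin_cases i <;> simp only [Fin.zero_eta, Fin.mk_one, Fin.reduceFinMk, Matrix.cons_val,
        Set.disjoint_singleton_left]
    · exact hwb.ne'
    · exact fun h => hbH (hm3 _ h)
    · rintro ((h | h) | h)
      exacts [hbH (hm2 _ h), hbc h, hbH (hm1 _ h)]
  · have d01 : Disjoint ({w} : Set V) {z | ReachIn G H x3 z} :=
      Set.disjoint_singleton_left.2 fun h => hwH (hm3 _ h)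
    have d02 : Disjoint ({w} : Set V)
        ({z | ReachIn G H x2 z} ∪ {c} ∪ {z | ReachIn G H x1 z}) := by
      refine Set.disjoint_singleton_left.2 ?_
      rintro ((h | h) | h)
      exacts [hwH (hm2 _ h), hwc.ne h, hwH (hm1 _ h)]
    have d12 : Disjoint {z | ReachIn G H x3 z}
        ({z | ReachIn G H x2 z} ∪ {c} ∪ {z | ReachIn G H x1 z}) := by
      rw [Set.disjoint_left]
      rintro z hz ((h | h) | h)
      exacts [hdisj _ _ n23 z h hz, hcH (h ▸ hm3 z hz), hdisj _ _ n13 z h hz]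
    intro i j hij
    fin_cases i <;> fin_cases j <;> first | exact absurd rfl hij | skip
    exacts [d01, d02, d01.symm, d12, d02.symm, d12.symm]
  · intro i
    fin_cases i
    exacts [⟨a, rfl, w, rfl, hwa.symm⟩, ⟨a, rfl, x3, ReachIn.mono le_rfl .refl, hax3⟩,
      ⟨a, rfl, x2, Or.inl (Or.inl .refl), hax2⟩]
  · intro i
    fin_cases i
    exacts [⟨b, rfl, w, rfl, hwb.symm⟩, ⟨b, rfl, y3, hxy3, hyb3.symm⟩,
      ⟨b, rfl, x1, Or.inr .refl, hbx1⟩]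

end Decomposition

/-! ### Minimal pockets are chordless cycles -/

section Decomposition

variable {V : Type*} {G : SimpleGraph V} {W : Set V}

/-- A graph in which no vertex of `C` has three neighbours in `C`, such that `C \ {r, r'}` is
connected and both `r` and `r'` have neighbours there, is a chordless cycle. -/
theorem exists_chordlessCycle (hT : G.CliqueFree 3) {C : Set V} {r r' : V} (hr : r ∈ C)
    (hr' : r' ∈ C) (hrr : G.Adj r r') (hX : ConnIn G (C \ {r, r'}))
    (hdeg : ∀ w ∈ C, ∀ a ∈ C, ∀ b ∈ C, ∀ c ∈ C, G.Adj w a → G.Adj w b → G.Adj w c →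
      a ≠ b → a ≠ c → b ≠ c → False)
    (h1 : ∃ x ∈ C \ {r, r'}, G.Adj r x) (h2 : ∃ x ∈ C \ {r, r'}, G.Adj r' x) :
    ∃ m q, ChordlessCycle G m q ∧ q 0 = r ∧ q (m + 1) = r' ∧ q '' Set.Iic (m + 1) = C := by
  classical
  obtain ⟨x0, hx0, hrx0⟩ := h1
  obtain ⟨x1, hx1, hrx1⟩ := h2
  obtain ⟨p0, hp0⟩ := (hX x0 hx0 x1 hx1).exists_walk hx0
  set p := p0.bypass with hp
  have hpp : p.IsPath := p0.bypass_isPath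
  have hpX : ∀ v ∈ p.support, v ∈ C \ {r, r'} := fun v hv => hp0 v (p0.support_bypass_subset_support hv)
  have hrp : r ∉ p.support := fun h => (hpX r h).2 (by simp)
  have hrp' : r' ∉ p.support := fun h => (hpX r' h).2 (by simp)
  -- A path through the interior, closed by the edge `r r'`, is a cycle. Since no vertex has a third
  -- neighbour in `C`, it has no chords, and by connectedness of the interior it exhausts `C`.
  set P : G.Walk r r' := .cons hrx0 (p.concat hrx1.symm) with hP
  have hPp : P.IsPath := by
    rw [hP, SimpleGraph.Walk.cons_isPath_iff]
    refine ⟨hpp.concat hrp' hrx1.symm, ?_⟩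
    rw [SimpleGraph.Walk.support_concat]
    simp [hrp, hrr.ne]
  have hlen : P.length = p.length + 2 := by simp [hP]
  set m := p.length + 1 with hm
  have hlen' : P.length = m + 1 := by omega
  set q := P.getVert with hq
  have hq0 : q 0 = r := P.getVert_zero
  have hqm : q (m + 1) = r' := by rw [hq, ← hlen']; exact P.getVert_length
  have hinj : Set.InjOn q (Set.Iic (m + 1)) := by
    intro i hi j hj hij
    exact hPp.getVert_injOn (by simpa [hlen'] using hi) (by simpa [hlen'] using hj) hij
  have hne : ∀ i j, i ≤ m + 1 → j ≤ m + 1 → i ≠ j → q i ≠ q j :=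
    fun i j hi hj hij h => hij (hinj hi hj h)
  have hadj : ∀ i ≤ m, G.Adj (q i) (q (i + 1)) := fun i hi =>
    P.adj_getVert_succ (by omega)
  have hmemX : ∀ i, 1 ≤ i → i ≤ m → q i ∈ C \ {r, r'} := by
    intro i h1 h2
    have hi : q i ∈ P.support := P.getVert_mem_support i
    rw [hP, SimpleGraph.Walk.support_cons, SimpleGraph.Walk.support_concat, List.mem_cons,
      List.mem_append, List.mem_singleton] at hi
    rcases hi with hi | hi | hi
    · exact absurd (hi.trans hq0.symm) (hne i 0 (by omega) (by omega) (by omega))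
    · exact hpX _ hi
    · exact absurd (hi.trans hqm.symm) (hne i (m + 1) (by omega) (by omega) (by omega))
  have hmemC : ∀ i ≤ m + 1, q i ∈ C := by
    intro i hi
    rcases Nat.eq_zero_or_pos i with rfl | h0
    · rw [hq0]; exact hr
    · rcases Nat.lt_or_ge m i with h | h
      · obtain rfl : i = m + 1 := by omega
        rw [hqm]; exact hr'
      · exact (hmemX i h0 h).1
  have hlast : G.Adj (q 0) (q (m + 1)) := by rw [hq0, hqm]; exact hrr
  have nbr : ∀ i, 1 ≤ i → i ≤ m → ∀ y ∈ C, G.Adj (q i) y → y = q (i + 1) ∨ y = q (i - 1) := by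
    intro i h1 h2 y hy h
    by_contra hcon
    push Not at hcon
    have h3 := hadj (i - 1) (by omega)
    rw [show i - 1 + 1 = i by omega] at h3
    exact hdeg (q i) (hmemC i (by omega)) y hy (q (i + 1)) (hmemC _ (by omega)) (q (i - 1))
      (hmemC _ (by omega)) h (hadj i h2) h3.symm hcon.1 hcon.2
      (hne _ _ (by omega) (by omega) (by omega))
  have hm1 : 1 ≤ m := by omega
  have nbr0 : ∀ y ∈ C, G.Adj (q 0) y → y = q 1 ∨ y = q (m + 1) := by
    intro y hy h
    by_contra hcon
    push Not at hcon
    exact hdeg (q 0) (hmemC 0 (by omega)) y hy (q 1) (hmemC _ (by omega)) (q (m + 1))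
      (hmemC _ (by omega)) h (hadj 0 (by omega)) hlast hcon.1 hcon.2
      (hne _ _ (by omega) (by omega) (by omega))
  have nbrm : ∀ y ∈ C, G.Adj (q (m + 1)) y → y = q m ∨ y = q 0 := by
    intro y hy h
    by_contra hcon
    push Not at hcon
    exact hdeg (q (m + 1)) (hmemC _ le_rfl) y hy (q m) (hmemC _ (by omega)) (q 0)
      (hmemC _ (by omega)) h (hadj m le_rfl).symm hlast.symm hcon.1 hcon.2
      (hne _ _ (by omega) (by omega) (by omega))
  refine ⟨m, q, ⟨?_, hinj, hadj, hlast, ?_⟩, hq0, hqm, ?_⟩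
  -- For `m = 1` the cycle would be a triangle.
  · by_contra hm2
    have hm' : m = 1 := by omega
    have a1 := hadj 0 (by omega)
    have a2 := hadj 1 (by omega)
    rw [hm'] at hlast
    exact hT {q 0, q 1, q 2} (SimpleGraph.is3Clique_triple_iff.2 ⟨a1, hlast, a2⟩)
  · intro i hi j hj h
    rcases Nat.eq_zero_or_pos i with rfl | h0
    · rcases nbr0 _ (hmemC j hj) h with h' | h'
      · have := hinj hj (show (1 : ℕ) ≤ m + 1 by omega) h'; omega
      · have := hinj hj (show m + 1 ≤ m + 1 by omega) h'; omega
    · rcases Nat.lt_or_ge m i with hmi | hmi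
      · obtain rfl : i = m + 1 := by omega
        rcases nbrm _ (hmemC j hj) h with h' | h'
        · have := hinj hj (show m ≤ m + 1 by omega) h'; omega
        · have := hinj hj (show 0 ≤ m + 1 by omega) h'; omega
      · rcases nbr i h0 hmi _ (hmemC j hj) h with h' | h'
        · have := hinj hj (show i + 1 ≤ m + 1 by omega) h'; omega
        · have := hinj hj (show i - 1 ≤ m + 1 by omega) h'; omega
  · ext y
    constructor
    · rintro ⟨i, hi, rfl⟩
      exact hmemC i hi
    · intro hy
      by_cases hyr : y ∈ ({r, r'} : Set V)
      · rcases hyr with rfl | rfl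
        · exact ⟨0, Nat.zero_le _, hq0⟩
        · exact ⟨m + 1, Set.mem_Iic.2 le_rfl, hqm⟩
      · have := (hX _ (hmemX 1 le_rfl hm1) y ⟨hy, hyr⟩).mem_of_closed (T := q '' Set.Icc 1 m)
          ⟨1, ⟨le_rfl, hm1⟩, rfl⟩ (by
            rintro _ ⟨i, ⟨h1, h2⟩, rfl⟩ z hz hiz
            have hz0 : z ≠ q 0 := fun h => hz.2 (by simp [h, hq0])
            have hzm : z ≠ q (m + 1) := fun h => hz.2 (by simp [h, hqm])
            rcases nbr i h1 h2 z hz.1 hiz with rfl | rfl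
            · refine ⟨i + 1, ⟨by omega, ?_⟩, rfl⟩
              by_contra hcon
              exact hzm (by rw [show i = m by omega])
            · refine ⟨i - 1, ⟨?_, by omega⟩, rfl⟩
              by_contra hcon
              exact hz0 (by rw [show i - 1 = 0 by omega]))
        obtain ⟨i, hi, rfl⟩ := this
        exact ⟨i, by have := hi.2; simp only [Set.mem_Iic]; omega, rfl⟩

/-- A connected set of vertices in a triangle-free graph without minor `K₂,₃` is a vertex, an edge,
or it is obtained by amalgamation over a vertex or by adding an ear over an edge. In the last case
the ear can be chosen such that it avoids a given vertex or a given edge `r₀ r₀'`. -/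
theorem NoK23Minor.decompose [Finite V] (hG : NoK23Minor G) (hT : G.CliqueFree 3)
    (hW : ConnIn G W) {r₀ r₀' : V} (hr₀ : r₀ ∈ W) (hr₀' : r₀' ∈ W) (h₀ : r₀ = r₀' ∨ G.Adj r₀ r₀') :
    (W = {r₀}) ∨ (∃ v, G.Adj r₀ v ∧ W = {r₀, v}) ∨
      (∃ Wa Wb u, VertexAmalgam G W Wa Wb u) ∨
      (∃ W₀ m q, EarAmalgam G W W₀ m q ∧ r₀ ∈ W₀ ∧ r₀' ∈ W₀) := by
  by_cases hcut : ∃ u ∈ W, ¬ ConnIn G (W \ {u})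
  · obtain ⟨u, hu, hcut⟩ := hcut
    obtain ⟨Wa, Wb, h⟩ := exists_vertexAmalgam hW hu hcut
    exact Or.inr (Or.inr (Or.inl ⟨Wa, Wb, u, h⟩))
  push Not at hcut
  by_cases hone : W = {r₀}
  · exact Or.inl hone
  have hnbr : ∃ v ∈ W, G.Adj r₀ v ∧ (r₀' = r₀ ∨ r₀' = v) := by
    rcases h₀ with rfl | h
    · obtain ⟨y, hy, hyr⟩ : ∃ y ∈ W, y ≠ r₀ := by
        by_contra hcon
        push Not at hcon
        exact hone (Set.eq_singleton_iff_unique_mem.2 ⟨hr₀, hcon⟩)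
      obtain ⟨k, -, hk, hkr⟩ := hW.exists_reach_adj hr₀ hy hyr
      exact ⟨k, hk.1, hkr.symm, Or.inl rfl⟩
    · exact ⟨r₀', hr₀', h, Or.inr rfl⟩
  obtain ⟨v, hv, hadj, hr₀v⟩ := hnbr
  by_cases htwo : W = {r₀, v}
  · exact Or.inr (Or.inl ⟨v, hadj, htwo⟩)
  -- The whole of `W` is a pocket over an edge whose ends include the root. So pockets whose
  -- interior avoids the root exist, and a minimal one can be chosen.
  have hstart : EdgePocket G W {r₀, r₀'} W r₀ v :=
    { subset := le_rfl
      left_mem := hr₀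
      right_mem := hv
      adj := hadj
      nonempty := by
        by_contra hcon
        rw [Set.not_nonempty_iff_eq_empty, Set.sdiff_eq_empty] at hcon
        exact htwo (hcon.antisymm (by rintro x (rfl | rfl); exacts [hr₀, hv]))
      closed := fun _ _ y hy _ => hy
      disjoint := by
        rintro x hx (rfl | rfl)
        · exact hx.2 (Or.inl rfl)
        · rcases hr₀v with h | h
          · exact hx.2 (Or.inl h)
          · exact hx.2 (Or.inr h) }
  obtain ⟨C, ⟨r, r', hC⟩, hmin⟩ : ∃ C, (∃ r r', EdgePocket G W {r₀, r₀'} C r r') ∧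
      ∀ C', (∃ r r', EdgePocket G W {r₀, r₀'} C' r r') → C' ⊆ C → C' = C := by
    obtain ⟨C, hC⟩ := (Set.toFinite {C | ∃ r r', EdgePocket G W {r₀, r₀'} C r r'}).exists_minimal
      ⟨W, r₀, v, hstart⟩
    exact ⟨C, hC.1, fun C' hC' hsub => hsub.antisymm (hC.2 hC' hsub)⟩
  have hmin' : ∀ C' p p', EdgePocket G W {r₀, r₀'} C' p p' → C' ⊆ C → C' = C :=
    fun C' p p' h => hmin C' ⟨p, p', h⟩
  have hdeg : ∀ w ∈ C, ∀ a ∈ C, ∀ b ∈ C, ∀ c ∈ C, G.Adj w a → G.Adj w b → G.Adj w c →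
      a ≠ b → a ≠ c → b ≠ c → False := by
    intro w hw a ha b hb c hc hwa hwb hwc hab hac hbc
    exact hG.false_of_three_neighbors hT hwa hwb hwc (hC.subset ha) (hC.subset hb) (hC.subset hc)
      hab hac hbc
      (hC.reachIn_neighbors_of_minimal hmin' hw ha hb hc hwa hwb hwc hab hac)
      (hC.reachIn_neighbors_of_minimal hmin' hw hb ha hc hwb hwa hwc hab.symm hbc)
      (hC.reachIn_neighbors_of_minimal hmin' hw hc ha hb hwc hwa hwb hac.symm hbc.symm)
  obtain ⟨x, hx⟩ := hC.nonempty
  -- If `p` had no neighbour in the interior, then `p'` would separate it from the interior; but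
  -- there are no cut vertices left.
  have hend : ∀ p p', ({p, p'} : Set V) = {r, r'} → G.Adj p p' → p ∈ C →
      ∃ y ∈ C \ {r, r'}, G.Adj p y := by
    intro p p' hpp hpadj hpC
    by_contra hcon
    push Not at hcon
    have hp' : p' ∈ W := hC.subset (by
      have : p' ∈ ({r, r'} : Set V) := hpp ▸ Or.inr rfl
      rcases this with h | h
      · rw [h]; exact hC.left_mem
      · rw [h]; exact hC.right_mem)
    have hxp : x ≠ p' := by
      rintro rfl
      exact hx.2 (hpp ▸ Or.inr rfl)
    have := (hcut p' hp' x ⟨hC.subset hx.1, hxp⟩ p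
      ⟨hC.subset hpC, hpadj.ne⟩).mem_of_closed (T := C \ {r, r'}) hx (by
        intro y hy z hz hyz
        refine ⟨hC.closed y hy z hz.1 hyz, fun hzr => ?_⟩
        rw [← hpp] at hzr
        rcases hzr with rfl | rfl
        · exact hcon y hy hyz.symm
        · exact hz.2 rfl)
    exact this.2 (hpp ▸ Or.inl rfl)
  obtain ⟨m, q, hq, hq0, hqm, hqC⟩ := exists_chordlessCycle hT hC.left_mem hC.right_mem hC.adj
    (hC.reachIn_of_minimal hmin') hdeg (hend r r' rfl hC.adj hC.left_mem)
    (hend r' r (Set.pair_comm _ _) hC.adj.symm hC.right_mem)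
  refine Or.inr (Or.inr (Or.inr ⟨(W \ C) ∪ {r, r'}, m, q, ⟨hq, ?_, ?_, ?_, ?_⟩, ?_, ?_⟩))
  · rw [hqC]
    ext y
    simp only [Set.mem_union, Set.mem_sdiff, Set.mem_insert_iff, Set.mem_singleton_iff]
    constructor
    · intro hy
      by_cases h : y ∈ C
      exacts [Or.inr h, Or.inl (Or.inl ⟨hy, h⟩)]
    · rintro ((h | rfl | rfl) | h)
      exacts [h.1, hC.subset hC.left_mem, hC.subset hC.right_mem, hC.subset h]
  · rw [hqC, hq0, hqm]
    ext y
    simp only [Set.mem_inter_iff, Set.mem_union, Set.mem_sdiff, Set.mem_insert_iff,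
      Set.mem_singleton_iff]
    constructor
    · rintro ⟨h | h, h'⟩
      exacts [absurd h' h.2, h]
    · rintro (rfl | rfl)
      exacts [⟨Or.inr (Or.inl rfl), hC.left_mem⟩, ⟨Or.inr (Or.inr rfl), hC.right_mem⟩]
  · refine ConnIn.of_root r ?_
    have hr'r : ReachIn G ((W \ C) ∪ {r, r'}) r r' :=
      .of_adj hC.adj (Or.inr (Or.inl rfl)) (Or.inr (Or.inr rfl))
    rintro y (hy | rfl | rfl)
    · by_contra hcon
      have : r ∈ {z | z ∈ W \ C ∧ ReachIn G ((W \ C) ∪ {r, r'}) y z} := by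
        refine (hW y hy.1 r (hC.subset hC.left_mem)).mem_of_closed
          (T := {z | z ∈ W \ C ∧ ReachIn G ((W \ C) ∪ {r, r'}) y z}) ⟨hy, .refl⟩ ?_
        rintro z ⟨hz, hyz⟩ w hw hzw
        have hwC : w ∉ C := by
          intro hwC
          by_cases hwr : w ∈ ({r, r'} : Set V)
          · have hyw := hyz.trans (.of_adj hzw (Or.inl hz) (Or.inr hwr))
            rcases hwr with rfl | rfl
            · exact hcon hyw.symm
            · exact hcon (hr'r.trans hyw.symm)
          · exact hz.2 (hC.closed w ⟨hwC, hwr⟩ z hz.1 hzw.symm)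
        exact ⟨⟨hw, hwC⟩, hyz.trans (.of_adj hzw (Or.inl hz) (Or.inl ⟨hw, hwC⟩))⟩
      exact this.1.2 hC.left_mem
    · exact .refl
    · exact hr'r
  · rw [hqC, hq0, hqm]
    rintro y (hy | hy) z hz hyz
    · by_contra hcon
      push Not at hcon
      exact hy.2 (hC.closed z ⟨hz, hcon.2⟩ y hy.1 hyz.symm)
    · exact Or.inl hy
  · by_contra hcon
    simp only [Set.mem_union, Set.mem_sdiff, hr₀, true_and, not_or, not_not] at hcon
    exact hC.disjoint r₀ hcon (Or.inl rfl)
  · by_contra hcon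
    simp only [Set.mem_union, Set.mem_sdiff, hr₀', true_and, not_or, not_not] at hcon
    exact hC.disjoint r₀' hcon (Or.inr rfl)

end Decomposition

/-! ### Colourings of stars -/

section Stars

variable {V E : Type*}

/-- The third letter. -/
def thd (a b : Fin 3) : Fin 3 := -(a + b)

theorem thd_comm (a b : Fin 3) : thd a b = thd b a := by revert a b; decide

theorem thd_ne_left {a b : Fin 3} (h : a ≠ b) : thd a b ≠ a := by revert a b; decide

theorem thd_ne_right {a b : Fin 3} (h : a ≠ b) : thd a b ≠ b := by revert a b; decide

theorem eq_thd {a b x : Fin 3} (h : a ≠ b) (ha : x ≠ a) (hb : x ≠ b) : x = thd a b := by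
  revert a b x; decide

theorem thd_thd {a b : Fin 3} (h : a ≠ b) : thd a (thd a b) = b := by revert a b; decide

theorem eq_or_eq_or_eq_thd {a b : Fin 3} (h : a ≠ b) (x : Fin 3) :
    x = a ∨ x = b ∨ x = thd a b := by revert a b x; decide

theorem thd_perm (σ : Equiv.Perm (Fin 3)) {a b : Fin 3} (h : a ≠ b) :
    thd (σ a) (σ b) = σ (thd a b) :=
  (eq_thd (σ.injective.ne h) (σ.injective.ne (thd_ne_left h))
    (σ.injective.ne (thd_ne_right h))).symm

/-- Two injective maps on three letters that agree on two letters are equal. -/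
theorem eq_of_agree_two {g g' : Fin 3 → Fin 3} (hg : g.Injective) (hg' : g'.Injective)
    {s t : Fin 3} (hst : s ≠ t) (hs : g s = g' s) (ht : g t = g' t) : g = g' := by
  funext x
  rcases eq_or_eq_or_eq_thd hst x with rfl | rfl | rfl
  · exact hs
  · exact ht
  · rw [eq_thd (hg.ne hst) (hg.ne (thd_ne_left hst)) (hg.ne (thd_ne_right hst)),
      eq_thd (hg'.ne hst) (hg'.ne (thd_ne_left hst)) (hg'.ne (thd_ne_right hst)), hs, ht]

theorem exists_perm_of_ne {a b a' b' : Fin 3} (h : a ≠ b) (h' : a' ≠ b') :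
    ∃ σ : Equiv.Perm (Fin 3), σ a = a' ∧ σ b = b' := by
  revert a b a' b'; decide

theorem perm_eq_of_ne {σ τ : Equiv.Perm (Fin 3)} {a b : Fin 3} (h : a ≠ b) (ha : σ a = τ a)
    (hb : σ b = τ b) : σ = τ :=
  Equiv.ext fun x => congrFun (eq_of_agree_two σ.injective τ.injective h ha hb) x

/-- The stars of the vertices of a cubic graph without multiple edges, as sets of edges and
half-edges. -/
structure IsCubicStar (G : SimpleGraph V) (st : V → Set E) : Prop where
  card : ∀ v, (st v).ncard = 3
  adj_iff : ∀ v w, v ≠ w → ((∃ e, e ∈ st v ∧ e ∈ st w) ↔ G.Adj v w)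
  unique : ∀ v w, v ≠ w → ∀ e f, e ∈ st v → e ∈ st w → f ∈ st v → f ∈ st w → e = f
  two : ∀ e u v w, e ∈ st u → e ∈ st v → e ∈ st w → u = v ∨ v = w ∨ u = w

/-- The edges incident with a set of vertices. -/
def edgesOf (st : V → Set E) (W : Set V) : Set E := {e | ∃ v ∈ W, e ∈ st v}

/-- Proper colourings of the edges at the vertices in `W`. -/
def Proper (st : V → Set E) (W : Set V) (c : E → Fin 3) : Prop := ∀ v ∈ W, Set.InjOn c (st v)

/-- Two colourings have the same colour class `s` on a set of edges. -/
def Share (D : Set E) (s : Fin 3) (c c' : E → Fin 3) : Prop := ∀ x ∈ D, c x = s ↔ c' x = s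

variable {G : SimpleGraph V} {st : V → Set E} {W W' : Set V} {c c' c'' : E → Fin 3}
  {D D' : Set E} {s : Fin 3} {v : V} {e f g : E}

theorem mem_edgesOf (hv : v ∈ W) (he : e ∈ st v) : e ∈ edgesOf st W := ⟨v, hv, he⟩

theorem edgesOf_union : edgesOf st (W ∪ W') = edgesOf st W ∪ edgesOf st W' := by
  ext e
  constructor
  · rintro ⟨v, hv | hv, he⟩
    · exact Or.inl ⟨v, hv, he⟩
    · exact Or.inr ⟨v, hv, he⟩
  · rintro (⟨v, hv, he⟩ | ⟨v, hv, he⟩)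
    · exact ⟨v, Or.inl hv, he⟩
    · exact ⟨v, Or.inr hv, he⟩

theorem Share.refl (D : Set E) (s : Fin 3) (c : E → Fin 3) : Share D s c c := fun _ _ => Iff.rfl

theorem Share.symm (h : Share D s c c') : Share D s c' c := fun x hx => (h x hx).symm

theorem Share.trans (h : Share D s c c') (h' : Share D s c' c'') : Share D s c c'' :=
  fun x hx => (h x hx).trans (h' x hx)

theorem Share.mono (hD : D ⊆ D') (h : Share D' s c c') : Share D s c c' :=
  fun x hx => h x (hD hx)

theorem Share.of_eqOn (h : Set.EqOn c c' D) : Share D s c c' := fun x hx => by rw [h hx]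

theorem Share.union (h : Share D s c c') (h' : Share D' s c c') : Share (D ∪ D') s c c' :=
  fun x hx => hx.elim (h x) (h' x)

theorem Proper.mono (h : W ⊆ W') (hc : Proper st W' c) : Proper st W c := fun v hv => hc v (h hv)

theorem Proper.congr (h : Set.EqOn c c' (edgesOf st W)) (hc : Proper st W c) :
    Proper st W c' :=
  fun v hv => (hc v hv).congr (h.mono fun _ he => mem_edgesOf hv he)

theorem Proper.union (h : Proper st W c) (h' : Proper st W' c) : Proper st (W ∪ W') c :=
  fun v hv => hv.elim (h v) (h' v)

theorem Proper.perm (hc : Proper st W c) (σ : Equiv.Perm (Fin 3)) : Proper st W (σ ∘ c) :=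
  fun v hv _ hx _ hy hxy => hc v hv hx hy (σ.injective hxy)

theorem share_comp_perm (σ : Equiv.Perm (Fin 3)) (hσ : σ s = s) : Share D s c (σ ∘ c) := by
  intro x _
  constructor
  · intro h
    simp [h, hσ]
  · intro h
    exact σ.injective (h.trans hσ.symm)

theorem Proper.ne (hc : Proper st W c) (hv : v ∈ W) (he : e ∈ st v) (hf : f ∈ st v) (h : e ≠ f) :
    c e ≠ c f := fun h' => h (hc v hv he hf h')

namespace IsCubicStar

variable (hs : IsCubicStar G st)
include hs

theorem exists_third (he : e ∈ st v) (hf : f ∈ st v) (hef : e ≠ f) :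
    ∃ g, g ∈ st v ∧ g ≠ e ∧ g ≠ f ∧ st v = {e, f, g} := by
  obtain ⟨a, b, d, hab, had, hbd, h⟩ := Set.ncard_eq_three.1 (hs.card v)
  rw [h] at he hf ⊢
  simp only [Set.mem_insert_iff, Set.mem_singleton_iff] at he hf
  rcases he with rfl | rfl | rfl <;> rcases hf with rfl | rfl | rfl <;>
    first
    | exact absurd rfl hef
    | exact ⟨a, by simp, ‹_›, ‹_›, by grind⟩
    | exact ⟨b, by simp, by grind, by grind, by grind⟩
    | exact ⟨d, by simp, by grind, by grind, by grind⟩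

theorem exists_enum (he : e ∈ st v) :
    ∃ f g, e ≠ f ∧ e ≠ g ∧ f ≠ g ∧ st v = {e, f, g} := by
  obtain ⟨f, hf, hfe⟩ := Set.exists_ne_of_one_lt_ncard (s := st v) (by rw [hs.card]; norm_num) e
  obtain ⟨g, -, h1, h2, h3⟩ := hs.exists_third he hf hfe.symm
  exact ⟨f, g, hfe.symm, h1.symm, h2.symm, h3⟩

theorem nonempty (v : V) : ∃ e, e ∈ st v := by
  have := Set.nonempty_of_ncard_ne_zero (s := st v) (by rw [hs.card]; norm_num)
  exact this

theorem exists_color (hc : Set.InjOn c (st v)) (i : Fin 3) : ∃ e ∈ st v, c e = i := by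
  obtain ⟨a, b, d, hab, had, hbd, h⟩ := Set.ncard_eq_three.1 (hs.card v)
  rw [h] at hc ⊢
  have h1 : c a ≠ c b := fun h => hab (hc (by simp) (by simp) h)
  have h2 : c a ≠ c d := fun h => had (hc (by simp) (by simp) h)
  have h3 : c b ≠ c d := fun h => hbd (hc (by simp) (by simp) h)
  rcases eq_or_eq_or_eq_thd h1 i with rfl | rfl | rfl
  · exact ⟨a, by simp, rfl⟩
  · exact ⟨b, by simp, rfl⟩
  · exact ⟨d, by simp, eq_thd h1 h2.symm h3.symm⟩

theorem exists_perm (hc : Set.InjOn c (st v)) (hc' : Set.InjOn c' (st v)) :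
    ∃ σ : Equiv.Perm (Fin 3), ∀ e ∈ st v, σ (c e) = c' e := by
  obtain ⟨a, b, d, hab, had, hbd, h⟩ := Set.ncard_eq_three.1 (hs.card v)
  rw [h] at hc hc' ⊢
  have h1 : c a ≠ c b := fun h => hab (hc (by simp) (by simp) h)
  have h2 : c d ≠ c a := fun h => had (hc (by simp) (by simp) h.symm)
  have h3 : c d ≠ c b := fun h => hbd (hc (by simp) (by simp) h.symm)
  have h1' : c' a ≠ c' b := fun h => hab (hc' (by simp) (by simp) h)
  have h2' : c' d ≠ c' a := fun h => had (hc' (by simp) (by simp) h.symm)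
  have h3' : c' d ≠ c' b := fun h => hbd (hc' (by simp) (by simp) h.symm)
  obtain ⟨σ, ha, hb⟩ := exists_perm_of_ne h1 h1'
  refine ⟨σ, fun e he => ?_⟩
  rcases he with rfl | rfl | rfl
  · exact ha
  · exact hb
  · rw [eq_thd h1 h2 h3, ← thd_perm σ h1, ha, hb, ← eq_thd h1' h2' h3']

/-- Colourings that share a colour class and agree on one more edge at `v` agree at `v`. -/
theorem eqOn_of_share (hc : Set.InjOn c (st v)) (hc' : Set.InjOn c' (st v))
    (h : Share (st v) s c c') (he : e ∈ st v) (hes : c e ≠ s) (hee : c e = c' e) :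
    Set.EqOn c c' (st v) := by
  obtain ⟨σ, hσ⟩ := hs.exists_perm hc hc'
  obtain ⟨f, hf, rfl⟩ := hs.exists_color hc s
  have h1 : σ = 1 := perm_eq_of_ne hes (by rw [hσ e he, ← hee]; rfl)
    (by rw [hσ f hf]; simpa using (h f hf).1 rfl)
  intro x hx
  rw [← hσ x hx, h1]; rfl

end IsCubicStar

end Stars

/-! ### Words on three letters -/

section Words

theorem reflTransGen_symm {α : Type*} {r : α → α → Prop} (hr : ∀ a b, r a b → r b a) {a b : α}
    (h : Relation.ReflTransGen r a b) : Relation.ReflTransGen r b a := by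
  induction h with
  | refl => exact .refl
  | tail _ h ih => exact .head (hr _ _ h) ih

/-- Words with letters `w 0, …, w L`, with given ends, without equal consecutive letters. -/
def IsLinearWord (L : ℕ) (a b : Fin 3) (w : ℕ → Fin 3) : Prop :=
  w 0 = a ∧ w L = b ∧ ∀ i < L, w i ≠ w (i + 1)

/-- Two words have the positions of some letter other than `ε` in common. -/
def LinearStep (L : ℕ) (a b ε : Fin 3) (w w' : ℕ → Fin 3) : Prop :=
  IsLinearWord L a b w ∧ IsLinearWord L a b w' ∧ ∃ s, s ≠ ε ∧ ∀ i ≤ L, w i = s ↔ w' i = s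

variable {L : ℕ} {a b ε : Fin 3} {w w' : ℕ → Fin 3}

theorem LinearStep.symm (h : LinearStep L a b ε w w') : LinearStep L a b ε w' w :=
  ⟨h.2.1, h.1, h.2.2.imp fun _ hs => ⟨hs.1, fun i hi => (hs.2 i hi).symm⟩⟩

/-- The letters other than `a` are exchanged up to a recurrence of `a`. The exchange fixes `a`, so
nothing clashes at the border and the positions of `a` are kept. -/
theorem IsLinearWord.exists_prefix_swap (hw : IsLinearWord L a b w) (ha : a ≠ ε)
    (h1 : w 1 = ε) {k : ℕ} (hk : 1 ≤ k) (hkL : k ≤ L) (hwk : w k = a) :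
    ∃ w', LinearStep L a b ε w w' ∧ w' 1 = thd a ε := by
  have hta := thd_ne_left ha
  have hσ : Equiv.swap ε (thd a ε) a = a := Equiv.swap_apply_of_ne_of_ne ha hta.symm
  refine ⟨fun i => if i ≤ k then Equiv.swap ε (thd a ε) (w i) else w i, ⟨hw, ⟨?_, ?_, ?_⟩, ?_⟩, ?_⟩
  · simp [hw.1, hσ]
  · by_cases hL : L ≤ k
    · have : k = L := le_antisymm hkL hL
      subst this
      simp only [le_refl, if_true, hwk, hσ]
      rw [← hwk, hw.2.1]
    · simp [hL, hw.2.1]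
  · intro i hi
    rcases lt_trichotomy i k with h | rfl | h
    · beta_reduce
      rw [if_pos h.le, if_pos (by omega)]
      exact (Equiv.injective _).ne (hw.2.2 i hi)
    · beta_reduce
      rw [if_pos le_rfl, if_neg (by omega), hwk, hσ, ← hwk]
      exact hw.2.2 i hi
    · beta_reduce
      rw [if_neg (by omega), if_neg (by omega)]
      exact hw.2.2 i hi
  · refine ⟨a, ha, fun i _ => ?_⟩
    by_cases h : i ≤ k
    · beta_reduce
      rw [if_pos h]
      constructor
      · intro h; rw [h, hσ]
      · intro h; exact (Equiv.injective _) (h.trans hσ.symm)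
    · beta_reduce
      rw [if_neg h]
  · simp [hk, h1]

/-- This normalizes the second letter, as a preparation for the induction in
`IsLinearWord.connected`. If `a` recurs, a prefix is swapped. If not, the letters after the first
alternate, and one occurrence of `ε` can be turned into `a` beforehand. -/
theorem IsLinearWord.exists_reach_second (hw : IsLinearWord L a b w) (ha : a ≠ ε) (hb : b ≠ ε)
    (hL : 2 ≤ L) (hab : a = b ∨ 3 ≤ L) :
    ∃ w', IsLinearWord L a b w' ∧ Relation.ReflTransGen (LinearStep L a b ε) w w' ∧
      w' 1 = thd a ε := by
  by_cases h1 : w 1 = thd a ε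
  · exact ⟨w, hw, .refl, h1⟩
  have h01 := hw.2.2 0 (by omega)
  rw [hw.1] at h01
  have h1ε : w 1 = ε := by
    rcases eq_or_eq_or_eq_thd ha (w 1) with h | h | h
    · exact absurd h.symm h01
    · exact h
    · exact absurd h h1
  by_cases hk : ∃ k, 1 ≤ k ∧ k ≤ L ∧ w k = a
  · obtain ⟨k, hk, hkL, hwk⟩ := hk
    obtain ⟨w', hs, h⟩ := hw.exists_prefix_swap ha h1ε hk hkL hwk
    exact ⟨w', hs.2.1, .single hs, h⟩
  push Not at hk
  have hba : b ≠ a := by rw [← hw.2.1]; exact hk L (by omega) le_rfl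
  have hL3 : 3 ≤ L := hab.resolve_left hba.symm
  have hbt : b = thd a ε := eq_thd ha hba hb
  have h2 : w 2 = thd a ε :=
    eq_thd ha (hk 2 (by omega) (by omega)) (by rw [← h1ε]; exact (hw.2.2 1 (by omega)).symm)
  have h23 := hw.2.2 2 (by omega)
  have hL4 : 4 ≤ L := by
    by_contra hlt
    have : L = 3 := by omega
    subst this
    exact h23 (by rw [h2, hw.2.1, hbt])
  have h3 : w 3 = ε := by
    rcases eq_or_eq_or_eq_thd ha (w 3) with h | h | h
    · exact absurd h (hk 3 (by omega) (by omega))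
    · exact h
    · exact absurd (h2.trans h.symm) h23
  -- The word begins with `a, ε, t, ε`, where `t` is the third letter, and `a` does not recur.
  -- Writing `a` at position 3 keeps the positions of `t`.
  have hw' : IsLinearWord L a b (Function.update w 3 a) := by
    refine ⟨by simp [hw.1], by rw [Function.update_of_ne (by omega)]; exact hw.2.1, fun i hi => ?_⟩
    by_cases hi3 : i = 3
    · subst hi3
      simpa using (hk 4 (by omega) (by omega)).symm
    · by_cases hi2 : i = 2
      · subst hi2
        simpa using hk 2 (by omega) (by omega)
      · rw [Function.update_of_ne hi3, Function.update_of_ne (by omega)]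
        exact hw.2.2 i hi
  have hstep : LinearStep L a b ε w (Function.update w 3 a) := by
    refine ⟨hw, hw', thd a ε, thd_ne_right ha, fun i _ => ?_⟩
    by_cases hi3 : i = 3
    · subst hi3
      simp [h3, (thd_ne_left ha).symm, (thd_ne_right ha).symm]
    · rw [Function.update_of_ne hi3]
  obtain ⟨w', hs, h⟩ := hw'.exists_prefix_swap (k := 3) ha (by simp [h1ε]) (by omega) (by omega)
    (by simp)
  exact ⟨w', hs.2.1, .head hstep (.single hs), h⟩

/-- Words with ends `a` and `b` are connected by steps that keep the positions of a letter other
than `ε`, if `ε` is not an end. -/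
theorem IsLinearWord.connected (ha : a ≠ ε) (hb : b ≠ ε) (hw : IsLinearWord L a b w)
    (hw' : IsLinearWord L a b w') : Relation.ReflTransGen (LinearStep L a b ε) w w' := by
  induction L generalizing a w w' with
  | zero =>
    refine .single ⟨hw, hw', a, ha, fun i hi => ?_⟩
    obtain rfl : i = 0 := by omega
    rw [hw.1, hw'.1]
  | succ L ih =>
    rcases Nat.eq_zero_or_pos L with rfl | hL
    · refine .single ⟨hw, hw', a, ha, fun i hi => ?_⟩
      obtain rfl | rfl : i = 0 ∨ i = 1 := by omega
      · rw [hw.1, hw'.1]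
      · have h := hw.2.1
        have h' := hw'.2.1
        simp only [zero_add] at h h'
        rw [h, h']
    -- Both words are moved to words with second letter `thd a ε`. As this is not `ε`, the induction
    -- hypothesis applies to the rest. In the remaining case there is just one inner letter, and it
    -- is forced by the different ends.
    by_cases hab : a = b ∨ 3 ≤ L + 1
    · obtain ⟨v, hv, hwv, h1⟩ := hw.exists_reach_second ha hb (by omega) hab
      obtain ⟨v', hv', hwv', h1'⟩ := hw'.exists_reach_second ha hb (by omega) hab
      refine hwv.trans (.trans ?_ (reflTransGen_symm (fun _ _ => LinearStep.symm) hwv'))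
      have hcons : ∀ u : ℕ → Fin 3, u 0 = a → u = fun i => Nat.casesOn i a fun j => u (j + 1) := by
        intro u hu
        funext i
        cases i with
        | zero => exact hu
        | succ j => rfl
      rw [hcons v hv.1, hcons v' hv'.1]
      refine Relation.ReflTransGen.lift (fun (u : ℕ → Fin 3) i => Nat.casesOn (motive := fun _ => Fin 3) i a u) ?_ _ _
        (ih (a := thd a ε) (thd_ne_right ha) ⟨h1, hv.2.1, fun i hi => hv.2.2 (i + 1) (by omega)⟩
        ⟨h1', hv'.2.1, fun i hi => hv'.2.2 (i + 1) (by omega)⟩)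
      have hlin : ∀ u, IsLinearWord L (thd a ε) b u →
          IsLinearWord (L + 1) a b fun i => Nat.casesOn i a u := by
        refine fun u hu => ⟨rfl, hu.2.1, fun i hi => ?_⟩
        cases i with
        | zero => change a ≠ u 0; rw [hu.1]; exact (thd_ne_left ha).symm
        | succ j => exact hu.2.2 j (by omega)
      rintro u u' ⟨hu, hu', s, hs, h⟩
      refine ⟨hlin u hu, hlin u' hu', s, hs, fun i hi => ?_⟩
      cases i with
      | zero => exact Iff.rfl
      | succ j => exact h j (by omega)
    · push Not at hab
      have hL1 : L = 1 := by omega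
      subst hL1
      refine .single ⟨hw, hw', a, ha, fun i hi => ?_⟩
      have key : ∀ u, IsLinearWord (1 + 1) a b u → u 1 = thd a b := fun u hu =>
        eq_thd hab.1 (by rw [← hu.1]; exact (hu.2.2 0 (by omega)).symm)
          (by rw [← hu.2.1]; exact hu.2.2 1 (by omega))
      obtain rfl | rfl | rfl : i = 0 ∨ i = 1 ∨ i = 2 := by omega
      · rw [hw.1, hw'.1]
      · rw [key w hw, key w' hw']
      · have h := hw.2.1
        have h' := hw'.2.1
        rw [show (2 : ℕ) = 1 + 1 from rfl, h, h']

/-- Cyclic words with letters `u 0, …, u (n - 1)`, without equal consecutive letters. -/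
def IsWord (n : ℕ) (u : ℕ → Fin 3) : Prop := (∀ j < n, u j ≠ u (j + 1)) ∧ u n = u 0

/-- Two words have the positions of the letter `s` in common. -/
def WShare (n : ℕ) (s : Fin 3) (u u' : ℕ → Fin 3) : Prop := ∀ j < n, u j = s ↔ u' j = s

/-- Two words agree at the positions `0`, `1` and `n - 1`. -/
def WSame (n : ℕ) (u u' : ℕ → Fin 3) : Prop := u 0 = u' 0 ∧ u 1 = u' 1 ∧ u (n - 1) = u' (n - 1)

/-- A word is linked if there is a word that agrees with it at the positions `0` and `1`, but not
at `n - 1`, and has the same positions of the letter at `0`. -/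
def Linked (n : ℕ) (u : ℕ → Fin 3) : Prop :=
  ∃ u', IsWord n u' ∧ u' 0 = u 0 ∧ u' 1 = u 1 ∧ u' (n - 1) ≠ u (n - 1) ∧ WShare n (u 0) u u'

variable {n : ℕ} {u u' u'' : ℕ → Fin 3} {s : Fin 3} {k : Fin 3}

theorem WShare.symm (h : WShare n s u u') : WShare n s u' u := fun j hj => (h j hj).symm

theorem WShare.of_eqOn (h : ∀ j < n, u j = u' j) : WShare n s u u' := fun j hj => by rw [h j hj]

theorem IsWord.ne_last (hu : IsWord n u) (hn : 4 ≤ n) : u (n - 1) ≠ u 0 := by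
  rw [← hu.2]
  have := hu.1 (n - 1) (by omega)
  rwa [Nat.sub_add_cancel (by omega)] at this

theorem IsWord.perm (hu : IsWord n u) (σ : Equiv.Perm (Fin 3)) : IsWord n (σ ∘ u) :=
  ⟨fun j hj => σ.injective.ne (hu.1 j hj), congrArg σ hu.2⟩

/-- A step between words that agree at the positions `0`, `1` and `n - 1`. -/
def WStep (n : ℕ) (ε : Fin 3) (u u' : ℕ → Fin 3) : Prop :=
  IsWord n u ∧ IsWord n u' ∧ WSame n u u' ∧ ∃ s, s ≠ ε ∧ WShare n s u u'

theorem WStep.symm (h : WStep n ε u u') : WStep n ε u' u :=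
  ⟨h.2.1, h.1, ⟨h.2.2.1.1.symm, h.2.2.1.2.1.symm, h.2.2.1.2.2.symm⟩,
    h.2.2.2.imp fun _ hs => ⟨hs.1, hs.2.symm⟩⟩

/-- With the letter at `0` fixed, a cyclic word is a linear word on the positions from `1` to `n -
1`, so this is `IsLinearWord.connected`. The letter at `0` does not disturb any step, because it is
the same in all words. -/
theorem IsWord.connected (hn : 4 ≤ n) (hu : IsWord n u) (hu' : IsWord n u') (h : WSame n u u')
    (h1 : u 1 ≠ ε) (h2 : u (n - 1) ≠ ε) : Relation.ReflTransGen (WStep n ε) u u' := by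
  have hlin : ∀ v, IsWord n v → WSame n u v →
      IsLinearWord (n - 2) (u 1) (u (n - 1)) fun i => v (i + 1) := by
    intro v hv hs
    refine ⟨hs.2.1.symm, ?_, fun i hi => hv.1 _ (by omega)⟩
    change v (n - 2 + 1) = _
    rw [hs.2.2]; congr 1; omega
  -- The letter `u 0` is put in front, and repeated from position `n` on in order to close the
  -- cycle.
  let lift : (ℕ → Fin 3) → ℕ → Fin 3 := fun v i => if i = 0 ∨ n ≤ i then u 0 else v (i - 1)
  have hlift0 : ∀ v, IsLinearWord (n - 2) (u 1) (u (n - 1)) v →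
      IsWord n (lift v) ∧ WSame n u (lift v) := by
    intro v hv
    refine ⟨⟨fun j hj => ?_, ?_⟩, ?_, ?_, ?_⟩
    · simp only [lift]
      by_cases hj0 : j = 0
      · subst hj0
        rw [if_pos (Or.inl rfl), if_neg (by omega)]
        simp only [zero_add, Nat.sub_self, hv.1]
        exact hu.1 0 (by omega)
      · rw [if_neg (by omega)]
        by_cases hjn : n ≤ j + 1
        · rw [if_pos (Or.inr hjn), show j - 1 = n - 2 by omega, hv.2.1]
          exact hu.ne_last hn
        · rw [if_neg (by omega)]
          have := hv.2.2 (j - 1) (by omega)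
          rwa [show j - 1 + 1 = j + 1 - 1 by omega] at this
    · simp [lift]
    · simp [lift]
    · simp only [lift]
      rw [if_neg (by omega), Nat.sub_self, hv.1]
    · simp only [lift]
      rw [if_neg (by omega), show n - 1 - 1 = n - 2 by omega, hv.2.1]
  have hback : ∀ v, IsWord n v → WSame n u v → ∀ j < n, v j = lift (fun i => v (i + 1)) j := by
    intro v _ hs j hj
    simp only [lift]
    by_cases hj0 : j = 0
    · subst hj0; simp [hs.1]
    · rw [if_neg (by omega), Nat.sub_add_cancel (by omega)]
  have hWS : ∀ v v', WSame n u v → WSame n u v' → WSame n v v' := fun v v' h h' =>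
    ⟨h.1.symm.trans h'.1, h.2.1.symm.trans h'.2.1, h.2.2.symm.trans h'.2.2⟩
  have hend : ∀ v, IsWord n v → WSame n u v → WStep n ε v (lift fun i => v (i + 1)) :=
    fun v hv hs => ⟨hv, (hlift0 _ (hlin v hv hs)).1, hWS _ _ hs (hlift0 _ (hlin v hv hs)).2,
      u 1, h1, .of_eqOn (hback v hv hs)⟩
  have hrefl : WSame n u u := ⟨rfl, rfl, rfl⟩
  refine .head (hend u hu hrefl) (.tail ?_ (hend u' hu' h).symm)
  refine Relation.ReflTransGen.lift lift ?_ _ _ (IsLinearWord.connected h1 h2 (hlin u hu hrefl)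
    (hlin u' hu' h))
  rintro v v' ⟨hv, hv', s, hs, hvv⟩
  refine ⟨(hlift0 v hv).1, (hlift0 v' hv').1, hWS _ _ (hlift0 v hv).2 (hlift0 v' hv').2, s, hs, ?_⟩
  intro j hj
  simp only [lift]
  by_cases hj0 : j = 0
  · simp [hj0]
  · rw [if_neg (by omega), if_neg (by omega)]
    exact hvv _ (by omega)

/-- After the recurrence of `u 0` at `i` the two other letters are exchanged. This fixes `u 0`, so
there is no clash at `i` or at the closing position, and it changes the last letter. -/
theorem IsWord.linked (hn : 4 ≤ n) (hu : IsWord n u) {i : ℕ} (hi : 2 ≤ i) (hin : i ≤ n - 2)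
    (hui : u i = u 0) : Linked n u := by
  have h01 := hu.1 0 (by omega)
  have hne := thd_ne_left h01
  set σ := Equiv.swap (u 1) (thd (u 0) (u 1)) with hσ
  have hσ0 : σ (u 0) = u 0 := Equiv.swap_apply_of_ne_of_ne h01 hne.symm
  refine ⟨fun j => if j ≤ i then u j else σ (u j), ⟨fun j hj => ?_, ?_⟩, by simp,
    by simp [show 1 ≤ i by omega], ?_, fun j hj => ?_⟩
  · rcases lt_trichotomy j i with h | rfl | h
    · beta_reduce
      rw [if_pos h.le, if_pos (by omega)]
      exact hu.1 j hj
    · beta_reduce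
      rw [if_pos le_rfl, if_neg (by omega), hui, ← hσ0, ← hui]
      exact σ.injective.ne (hu.1 j hj)
    · beta_reduce
      rw [if_neg (by omega), if_neg (by omega)]
      exact σ.injective.ne (hu.1 j hj)
  · beta_reduce
    rw [if_neg (by omega), hu.2, hσ0]; simp
  · beta_reduce
    rw [if_neg (by omega)]
    rcases eq_or_eq_or_eq_thd h01 (u (n - 1)) with h | h | h
    · exact absurd h (hu.ne_last hn)
    · rw [h, hσ, Equiv.swap_apply_left]; exact thd_ne_right h01
    · rw [h, hσ, Equiv.swap_apply_right]; exact (thd_ne_right h01).symm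
  · by_cases h : j ≤ i
    · beta_reduce
      rw [if_pos h]
    · beta_reduce
      rw [if_neg h]
      constructor
      · intro h'; rw [h', hσ0]
      · intro h'; exact σ.injective (h'.trans hσ0.symm)

/-- A word shares a letter with a linked word. -/
theorem IsWord.linked_or (hn : 4 ≤ n) (hu : IsWord n u) (h : u 1 ≠ u (n - 1)) :
    Linked n u ∨ (∃ u', IsWord n u' ∧ Linked n u' ∧ WSame n u u' ∧ WShare n (u 1) u u') ∧
      ∃ u', IsWord n u' ∧ Linked n u' ∧ WSame n u u' ∧ WShare n (u (n - 1)) u u' := by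
  by_cases hex : ∃ i, 2 ≤ i ∧ i ≤ n - 2 ∧ u i = u 0
  · obtain ⟨i, h2, hi, hui⟩ := hex
    exact Or.inl (hu.linked hn h2 hi hui)
  right
  push Not at hex
  have h01 := hu.1 0 (by omega)
  have h12 := hu.1 1 (by omega)
  have h23 := hu.1 2 (by omega)
  have h34 := hu.1 3 (by omega)
  simp only [zero_add, Nat.reduceAdd] at h01 h12 h23 h34
  have hl := hu.ne_last hn
  have hn5 : 5 ≤ n := by
    by_contra hlt
    have : n = 4 := by omega
    subst this
    have := hex 2 le_rfl le_rfl
    simp only [Nat.reduceSub] at *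
    grind
  have h20 := hex 2 le_rfl (by omega)
  have h30 := hex 3 (by omega) (by omega)
  have h40 : u 4 ≠ u 0 := by
    by_cases h5 : n = 5
    · subst h5; exact hl
    · exact hex 4 (by omega) (by omega)
  -- As `u 0` does not recur, the letters `u 1, u 2, u 3` alternate. Writing `u 0` at position 2 or
  -- at position 3 makes the word linked; the first keeps the positions of `u 1` and the second
  -- those of `u (n - 1)`.
  have e2 : u 2 = u (n - 1) := by grind
  have e3 : u 3 = u 1 := by grind
  have hup : ∀ i, 2 ≤ i → i ≤ 3 → u (i - 1) ≠ u 0 → u (i + 1) ≠ u 0 →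
      IsWord n (Function.update u i (u 0)) ∧ Linked n (Function.update u i (u 0)) ∧
      WSame n u (Function.update u i (u 0)) := by
    intro i h2 hi hm hp
    have hw : IsWord n (Function.update u i (u 0)) := by
      refine ⟨fun j hj => ?_, ?_⟩
      · by_cases hji : j = i
        · subst hji
          simpa using hp.symm
        · by_cases hji' : j + 1 = i
          · subst hji'
            simpa using hm
          · rw [Function.update_of_ne hji, Function.update_of_ne hji']
            exact hu.1 j hj
      · rw [Function.update_of_ne (by omega), Function.update_of_ne (by omega)]
        exact hu.2
    refine ⟨hw, hw.linked hn h2 (by omega) ?_, ?_, ?_, ?_⟩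
    · rw [Function.update_self, Function.update_of_ne (by omega)]
    all_goals rw [Function.update_of_ne (by omega)]
  have hsh : ∀ i s, u i ≠ s → u 0 ≠ s → WShare n s u (Function.update u i (u 0)) := by
    intro i s h1 h2 j _
    by_cases hji : j = i
    · subst hji
      simp [h1, h2]
    · rw [Function.update_of_ne hji]
  obtain ⟨a1, a2, a3⟩ := hup 2 le_rfl (by omega) h01.symm h30
  obtain ⟨b1, b2, b3⟩ := hup 3 (by omega) le_rfl h20 h40
  exact ⟨⟨_, a1, a2, a3, hsh 2 _ (by rw [e2]; exact h.symm) h01⟩,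
    _, b1, b2, b3, hsh 3 _ (by rw [e3]; exact h) hl.symm⟩

/-- The letter `k` recurs at position 2, which makes the word linked. The rest is filled from the
end by alternating `b` with the third letter, so that `k` does not interfere. -/
theorem exists_linked_word (hn : 4 ≤ n) (ha : k ≠ a) (hb : k ≠ b) :
    ∃ u, IsWord n u ∧ u 0 = k ∧ u 1 = a ∧ u (n - 1) = b ∧ Linked n u := by
  obtain ⟨g, hg0, hgk, hgs⟩ : ∃ g : ℕ → Fin 3, g 0 = b ∧ (∀ i, g i ≠ k) ∧
      ∀ i, g (i + 1) ≠ g i := by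
    refine ⟨fun i => if Even i then b else thd k b, by simp, fun i => ?_, fun i => ?_⟩
    · beta_reduce
      split_ifs
      · exact hb.symm
      · exact thd_ne_left hb
    · by_cases h : Even i
      · simpa [Nat.even_add_one, h] using thd_ne_right hb
      · simpa [Nat.even_add_one, h] using (thd_ne_right hb).symm
  have hu : ∃ u, IsWord n u ∧ u 0 = k ∧ u 1 = a ∧ u (n - 1) = b ∧ u 2 = k := by
    refine ⟨fun j => if j = 0 ∨ j = 2 ∨ n ≤ j then k else if j = 1 then a else g (n - 1 - j),
      ⟨fun j hj => ?_, by simp⟩, by simp, by beta_reduce; rw [if_neg (by omega)]; simp,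
      by beta_reduce; rw [if_neg (by omega), if_neg (by omega), Nat.sub_self, hg0], by simp⟩
    beta_reduce
    by_cases h0 : j = 0
    · subst h0; rw [if_pos (by omega), if_neg (by omega), if_pos rfl]; exact ha
    by_cases h1 : j = 1
    · subst h1; rw [if_neg (by omega), if_pos rfl, if_pos (by omega)]; exact ha.symm
    by_cases h2 : j = 2
    · subst h2; rw [if_pos (by omega), if_neg (by omega), if_neg (by omega)]; exact (hgk _).symm
    by_cases hl : n ≤ j + 1
    · rw [if_neg (by omega), if_neg (by omega), if_pos (by omega)]; exact hgk _
    · rw [if_neg (by omega), if_neg (by omega), if_neg (by omega), if_neg (by omega),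
        show n - 1 - j = (n - 1 - (j + 1)) + 1 by omega]
      exact hgs _
  obtain ⟨u, hw, h0, h1, hl, h2⟩ := hu
  exact ⟨u, hw, h0, h1, hl, hw.linked hn le_rfl (by omega) (h2.trans h0.symm)⟩

/-- Every letter of a word at a position from `2` to `n - 2` can vary alone. -/
theorem exists_words_ne_at {i : ℕ} (ha : k ≠ a) (hi : 2 ≤ i) (hin : i + 2 ≤ n) :
    ∃ u u', IsWord n u ∧ IsWord n u' ∧ u 0 = k ∧ u 1 = a ∧ u i ≠ u' i ∧ ∀ j, j ≠ i → u j = u' j := by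
  -- Only the two letters other than `k` occur, alternately, at the positions from `1` to `n - 1`.
  -- Hence a letter from `2` to `n - 2` can be replaced by `k`.
  let u : ℕ → Fin 3 := fun j => if j = 0 ∨ n ≤ j then k else if Even j then thd k a else a
  have ht := thd_ne_left ha
  have ht' := thd_ne_right ha
  have key : ∀ j, 1 ≤ j → j < n → u j ≠ k := by
    intro j h1 h2
    simp only [u]
    rw [if_neg (by omega)]
    split_ifs
    · exact ht
    · exact ha.symm
  have hk0 : u 0 = k := by simp [u]
  have hkn : u n = k := by simp [u]
  have hw : IsWord n u := by
    refine ⟨fun j hj => ?_, hkn.trans hk0.symm⟩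
    by_cases h0 : j = 0
    · subst h0; rw [hk0]; exact (key 1 le_rfl (by omega)).symm
    by_cases hl : n = j + 1
    · rw [← hl, hkn]; exact key j (by omega) hj
    · simp only [u]
      by_cases h : Even j
      · rw [if_neg (by omega), if_pos h, if_neg (by omega),
          if_neg (by simpa [Nat.even_add_one] using h)]
        exact ht'
      · rw [if_neg (by omega), if_neg h, if_neg (by omega),
          if_pos (by simpa [Nat.even_add_one] using h)]
        exact ht'.symm
  refine ⟨u, Function.update u i k, hw, ⟨fun j hj => ?_, ?_⟩, hk0, ?_, ?_, ?_⟩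
  · by_cases hji : j = i
    · subst hji
      simpa using (key (j + 1) (by omega) (by omega)).symm
    · by_cases hji' : j + 1 = i
      · subst hji'
        simpa using key j (by omega) (by omega)
      · rw [Function.update_of_ne hji, Function.update_of_ne hji']
        exact hw.1 j hj
  · rw [Function.update_of_ne (by omega), Function.update_of_ne (by omega)]
    exact hw.2
  · simp only [u]
    rw [if_neg (by omega)]; simp
  · simpa using key i (by omega) (by omega)
  · intro j hj
    rw [Function.update_of_ne hj]

end Words

/-! ### Systems on cyclic words -/

section WordSystems

theorem thd_eq_iff {a b s : Fin 3} (h : a ≠ b) : thd a b = s ↔ a ≠ s ∧ b ≠ s := by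
  revert a b s; decide

/-- The only other possibility is that the values at the two remaining letters are exchanged. -/
theorem eq_of_agree_of_ne {g g' : Fin 3 → Fin 3} (hg : g.Injective) (hg' : g'.Injective)
    {s t : Fin 3} (hst : s ≠ t) (hs : g s = g' s) (h : g ≠ g') : g' (thd s t) = g t := by
  have ht : g t ≠ g' t := fun ht => h (eq_of_agree_two hg hg' hst hs ht)
  have h2 : g t ≠ g' s := by rw [← hs]; exact hg.ne hst.symm
  exact (eq_thd (hg'.ne hst) (hg'.ne (thd_ne_left hst)) (hg'.ne (thd_ne_right hst))).trans
    (eq_thd (hg'.ne hst) h2 ht).symm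

/-- The cyclic words that start with `k` and `a`. -/
structure WordIn (n : ℕ) (k a : Fin 3) (u : ℕ → Fin 3) : Prop where
  isWord : IsWord n u
  zero : u 0 = k
  one : u 1 = a

/-- The words are permuted in such a way that words with a letter at the same positions assign the
same value to this letter. -/
structure IsWordSystem (n : ℕ) (k a : Fin 3) (f : (ℕ → Fin 3) → Fin 3 → Fin 3) : Prop where
  inj : ∀ u, WordIn n k a u → (f u).Injective
  share : ∀ u u', WordIn n k a u → WordIn n k a u' → ∀ s, WShare n s u u' → f u s = f u' s

variable {n m : ℕ} {k a : Fin 3} {u u' : ℕ → Fin 3} {f : (ℕ → Fin 3) → Fin 3 → Fin 3}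

theorem IsWordSystem.congr (hf : IsWordSystem n k a f) (hu : WordIn n k a u)
    (hu' : WordIn n k a u') (h : ∀ j < n, u j = u' j) : f u = f u' :=
  funext fun s => hf.share u u' hu hu' s (.of_eqOn h)

/-- With the third letter `t` there are three words, `k a k a`, `k a k t` and `k a t a`. The first
shares `k` with the second and `a` with the third. So all that matters is whether the values on
these two differ from the value on the first, and the four possibilities correspond to the four
vertices of the cycle. -/
theorem IsWordSystem.dictated_four (hka : k ≠ a) (hf : IsWordSystem 4 k a f) :
    ∃ i < 4, ∃ β β', ∀ u, WordIn 4 k a u → f u (u i) = β ∧ f u (u (i + 1)) = β' := by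
  have ht := thd_ne_left hka
  have ht' := thd_ne_right hka
  let P : ℕ → Fin 3 := fun j => if j = 1 ∨ j = 3 then a else k
  let Q : ℕ → Fin 3 := fun j => if j = 1 then a else if j = 3 then thd k a else k
  let R : ℕ → Fin 3 := fun j => if j = 1 ∨ j = 3 then a else if j = 2 then thd k a else k
  have hP : WordIn 4 k a P := by
    refine ⟨⟨fun j hj => ?_, by simp [P]⟩, by simp [P], by simp [P]⟩
    interval_cases j <;> simp [P, hka, hka.symm]
  have hQ : WordIn 4 k a Q := by
    refine ⟨⟨fun j hj => ?_, by simp [Q]⟩, by simp [Q], by simp [Q]⟩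
    interval_cases j <;> simp [Q, hka, hka.symm, ht, ht.symm]
  have hR : WordIn 4 k a R := by
    refine ⟨⟨fun j hj => ?_, by simp [R]⟩, by simp [R], by simp [R]⟩
    interval_cases j <;> simp [R, hka, hka.symm, ht', ht'.symm]
  have hPQ : f P k = f Q k := hf.share P Q hP hQ k fun j hj => by
    interval_cases j <;> simp [P, Q, hka.symm, ht]
  have hPR : f P a = f R a := hf.share P R hP hR a fun j hj => by
    interval_cases j <;> simp [P, R, hka, ht']
  have hall : ∀ u, WordIn 4 k a u → (u 2 = k ∧ u 3 = a ∧ f u = f P) ∨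
      (u 2 = k ∧ u 3 = thd k a ∧ f u = f Q) ∨ (u 2 = thd k a ∧ u 3 = a ∧ f u = f R) := by
    intro u hu
    have h0 := hu.zero
    have h1 := hu.one
    have h12 : u 1 ≠ u 2 := hu.isWord.1 1 (by omega)
    have h23 : u 2 ≠ u 3 := hu.isWord.1 2 (by omega)
    have h34 : u 3 ≠ u 4 := hu.isWord.1 3 (by omega)
    have h40 : u 4 = u 0 := hu.isWord.2
    have h2 := eq_or_eq_or_eq_thd hka (u 2)
    have h3 := eq_or_eq_or_eq_thd hka (u 3)
    rw [h1] at h12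
    rw [h40, h0] at h34
    rcases h2 with h2 | h2 | h2
    · rcases h3 with h3 | h3 | h3
      · exact absurd h3 h34
      · exact Or.inl ⟨h2, h3, hf.congr hu hP fun j hj => by
          interval_cases j <;> simp [P, h0, h1, h2, h3]⟩
      · exact Or.inr (Or.inl ⟨h2, h3, hf.congr hu hQ fun j hj => by
          interval_cases j <;> simp [Q, h0, h1, h2, h3]⟩)
    · exact absurd h2.symm h12
    · rcases h3 with h3 | h3 | h3
      · exact absurd h3 h34
      · exact Or.inr (Or.inr ⟨h2, h3, hf.congr hu hR fun j hj => by
          interval_cases j <;> simp [R, h0, h1, h2, h3]⟩)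
      · exact absurd (h2.trans h3.symm) h23
  have iP := hf.inj P hP
  have iQ := hf.inj Q hQ
  have iR := hf.inj R hR
  by_cases h1 : f P = f Q <;> by_cases h2 : f P = f R
  · refine ⟨0, by omega, f P k, f P a, fun u hu => ?_⟩
    rw [zero_add, hu.zero, hu.one]
    rcases hall u hu with ⟨-, -, h⟩ | ⟨-, -, h⟩ | ⟨-, -, h⟩
    · rw [h]; exact ⟨rfl, rfl⟩
    · rw [h, h1]; exact ⟨rfl, rfl⟩
    · rw [h, h2]; exact ⟨rfl, rfl⟩
  · have e : f R (thd a k) = f P k := eq_of_agree_of_ne iP iR hka.symm hPR h2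
    rw [thd_comm] at e
    refine ⟨1, by omega, f P a, f P k, fun u hu => ?_⟩
    rw [one_add_one_eq_two, hu.one]
    rcases hall u hu with ⟨h2', h3, h⟩ | ⟨h2', h3, h⟩ | ⟨h2', h3, h⟩
    · rw [h, h2']; exact ⟨rfl, rfl⟩
    · rw [h, h2', h1]; exact ⟨rfl, rfl⟩
    · rw [h, h2', hPR, e]; exact ⟨rfl, rfl⟩
  · have e : f Q (thd k a) = f P a := eq_of_agree_of_ne iP iQ hka hPQ h1
    refine ⟨3, by omega, f P a, f P k, fun u hu => ?_⟩
    rw [show 3 + 1 = 4 from rfl, hu.isWord.2, hu.zero]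
    rcases hall u hu with ⟨h2', h3, h⟩ | ⟨h2', h3, h⟩ | ⟨h2', h3, h⟩
    · rw [h, h3]; exact ⟨rfl, rfl⟩
    · rw [h, h3, e, hPQ]; exact ⟨rfl, rfl⟩
    · rw [h, h3, h2]; exact ⟨rfl, rfl⟩
  · have e : f Q (thd k a) = f P a := eq_of_agree_of_ne iP iQ hka hPQ h1
    have e' : f R (thd a k) = f P k := eq_of_agree_of_ne iP iR hka.symm hPR h2
    rw [thd_comm] at e'
    refine ⟨2, by omega, f P k, f P a, fun u hu => ?_⟩
    rw [show 2 + 1 = 3 from rfl]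
    rcases hall u hu with ⟨h2', h3, h⟩ | ⟨h2', h3, h⟩ | ⟨h2', h3, h⟩
    · rw [h, h2', h3]; exact ⟨rfl, rfl⟩
    · rw [h, h2', h3, e, hPQ]; exact ⟨rfl, rfl⟩
    · rw [h, h2', h3, e', hPR]; exact ⟨rfl, rfl⟩

theorem WordIn.update (hu : WordIn n k a u) {p : ℕ} {x : Fin 3} (hp : 2 ≤ p) (hpn : p < n)
    (h1 : u (p - 1) ≠ x) (h2 : u (p + 1) ≠ x) : WordIn n k a (Function.update u p x) := by
  refine ⟨⟨fun j hj => ?_, ?_⟩, ?_, ?_⟩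
  · by_cases hjp : j = p
    · subst hjp
      simpa using h2.symm
    · by_cases hjp' : j + 1 = p
      · subst hjp'
        simpa using h1
      · rw [Function.update_of_ne hjp, Function.update_of_ne hjp']
        exact hu.isWord.1 j hj
  · rw [Function.update_of_ne (by omega), Function.update_of_ne (by omega)]
    exact hu.isWord.2
  · rw [Function.update_of_ne (by omega)]; exact hu.zero
  · rw [Function.update_of_ne (by omega)]; exact hu.one

theorem WShare.update {p : ℕ} {x s : Fin 3} (h1 : u p ≠ s) (h2 : x ≠ s) :
    WShare n s u (Function.update u p x) := by
  intro j _
  by_cases hjp : j = p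
  · subst hjp
    simp [h1, h2]
  · rw [Function.update_of_ne hjp]

/-- The letter at the position `m` can be changed if its neighbours are equal. -/
theorem WordIn.update_last (hm : 4 ≤ m) (hu : WordIn (m + 1) k a u) (hum : u (m - 1) = k)
    {x : Fin 3} (hx : k ≠ x) : WordIn (m + 1) k a (Function.update u m x) ∧
      WShare (m + 1) k u (Function.update u m x) := by
  have h1 : u (m + 1) = k := hu.isWord.2.trans hu.zero
  refine ⟨hu.update (by omega) (by omega) (by rwa [hum]) (by rwa [h1]), .update ?_ hx.symm⟩
  rw [← h1]
  exact hu.isWord.1 m (by omega)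

/-- If the letter at the position `m` occurs once more, then the word shares it with a word that
has three different letters at the positions `m - 1`, `m`, `m + 1`. -/
theorem WordIn.exists_share (hm : 4 ≤ m) (hu : WordIn (m + 1) k a u)
    (hum : u (m - 1) = k) {p : ℕ} (hp : 1 ≤ p) (hpm : p ≤ m - 2) (hup : u p = u m) :
    ∃ u', WordIn (m + 1) k a u' ∧ u' (m - 1) ≠ k ∧ u' m = u m ∧ WShare (m + 1) (u m) u u' := by
  have hl : u (m + 1) = k := hu.isWord.2.trans hu.zero
  have hkx : u m ≠ k := by rw [← hl]; exact hu.isWord.1 m (by omega)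
  have ht := thd_ne_left hkx
  have ht' := thd_ne_right hkx
  -- The letters other than `u m` are exchanged from `p` to `m - 1`. The segment is bounded by two
  -- occurrences of `u m`, which is fixed.
  set σ := Equiv.swap k (thd (u m) k) with hσ
  have hσx : σ (u m) = u m := Equiv.swap_apply_of_ne_of_ne hkx ht.symm
  have hx : ∀ y, y = u m ↔ σ y = u m := fun y =>
    ⟨fun h => by rw [h, hσx], fun h => σ.injective (h.trans hσx.symm)⟩
  have hlow : ∀ j, j ≤ p → (if p ≤ j ∧ j < m then σ (u j) else u j) = u j := by
    intro j hj
    split_ifs with h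
    · obtain rfl : j = p := by omega
      rw [hup, hσx]
    · rfl
  refine ⟨fun j => if p ≤ j ∧ j < m then σ (u j) else u j,
    ⟨⟨fun j hj => ?_, ?_⟩, ?_, ?_⟩, ?_, ?_, fun j _ => ?_⟩
  · beta_reduce
    rcases lt_or_ge j p with h | h
    · rw [hlow j h.le, hlow (j + 1) h]
      exact hu.isWord.1 j hj
    · rcases lt_trichotomy (j + 1) m with h' | h' | h'
      · rw [if_pos (by omega), if_pos (by omega)]
        exact σ.injective.ne (hu.isWord.1 j hj)
      · rw [if_pos (by omega), if_neg (by omega), h', ← hσx]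
        exact σ.injective.ne (by rw [← h']; exact hu.isWord.1 j hj)
      · rw [if_neg (by omega), if_neg (by omega)]
        exact hu.isWord.1 j hj
  · beta_reduce
    rw [if_neg (by omega), hlow 0 (Nat.zero_le _)]
    exact hu.isWord.2
  · exact (hlow 0 (Nat.zero_le _)).trans hu.zero
  · exact (hlow 1 hp).trans hu.one
  · beta_reduce
    rw [if_pos (by omega), hum, hσ, Equiv.swap_apply_left]
    exact ht'
  · simp
  · beta_reduce
    split_ifs
    · exact hx _
    · exact Iff.rfl

/-- Without the third letter, `k` and `a` alternate on the inner positions. The letter `k` at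
position 2 is then different from the one at `m - 1`, which excludes `m = 4`. -/
theorem WordIn.of_not_occur (hm : 4 ≤ m) (hka : k ≠ a) (hu : WordIn (m + 1) k a u)
    (hum : u (m - 1) = k) (h : ∀ p, 1 ≤ p → p ≤ m - 2 → u p ≠ thd k a) :
    5 ≤ m ∧ u 2 = k ∧ u 3 = a ∧ u (m - 3) = k ∧ u (m - 2) = a := by
  have h12 : u 1 ≠ u 2 := hu.isWord.1 1 (by omega)
  have h23 : u 2 ≠ u 3 := hu.isWord.1 2 (by omega)
  rw [hu.one] at h12
  have h2 : u 2 = k := by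
    rcases eq_or_eq_or_eq_thd hka (u 2) with h' | h' | h'
    · exact h'
    · exact absurd h'.symm h12
    · exact absurd h' (h 2 (by omega) (by omega))
  have hm5 : 5 ≤ m := by
    by_contra hlt
    have : m = 4 := by omega
    subst this
    exact h23 (h2.trans hum.symm)
  have key : ∀ p, 1 ≤ p → p ≤ m - 2 → u p ≠ k → u p = a := fun p hp hpm hk => by
    rcases eq_or_eq_or_eq_thd hka (u p) with h' | h' | h'
    · exact absurd h' hk
    · exact h'
    · exact absurd h' (h p hp hpm)
  have e1 := hu.isWord.1 (m - 2) (by omega)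
  have e2 := hu.isWord.1 (m - 3) (by omega)
  rw [show m - 2 + 1 = m - 1 by omega, hum] at e1
  rw [show m - 3 + 1 = m - 2 by omega] at e2
  have e3 := key (m - 2) (by omega) (by omega) e1
  refine ⟨hm5, h2, key 3 (by omega) (by omega) (by rw [← h2]; exact h23.symm), ?_, e3⟩
  by_contra hne
  exact e2 ((key (m - 3) (by omega) (by omega) hne).trans e3.symm)

/-- The permutation prescribed by two values. -/
def prescribed (x y β β' : Fin 3) (s : Fin 3) : Fin 3 :=
  if s = x then β else if s = y then β' else thd β β'

theorem prescribed_injective {x y β β' : Fin 3} (hxy : x ≠ y) (h : β ≠ β') :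
    (prescribed x y β β').Injective := by
  revert x y β β'; decide

theorem eq_prescribed {g : Fin 3 → Fin 3} (hg : g.Injective) {x y β β' : Fin 3} (hxy : x ≠ y)
    (hx : g x = β) (hy : g y = β') : g = prescribed x y β β' := by
  have h : β ≠ β' := by rw [← hx, ← hy]; exact hg.ne hxy
  exact eq_of_agree_two hg (prescribed_injective hxy h) hxy (by simp [prescribed, hx])
    (by simp [prescribed, hxy.symm, hy])

/-- The words with `u (m - 1) ≠ k` are dictated by assumption. Any other word shares classes with
these, directly or through intermediate words, and two correct values determine its permutation. -/
theorem IsWordSystem.dictated_of_lt (hm : 4 ≤ m) (hka : k ≠ a) (hf : IsWordSystem (m + 1) k a f)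
    {i : ℕ} (hi : i + 1 < m) {β β' : Fin 3}
    (hB : ∀ u, WordIn (m + 1) k a u → u (m - 1) ≠ k → f u (u i) = β ∧ f u (u (i + 1)) = β') :
    ∀ u, WordIn (m + 1) k a u → f u (u i) = β ∧ f u (u (i + 1)) = β' := by
  have ht := thd_ne_left hka
  have ht' := thd_ne_right hka
  -- The value that dictatorship prescribes for a letter depends only on whether this letter stands
  -- at `i` or at `i + 1`. So it is inherited by words that share the letter.
  have T : ∀ u u' s, WordIn (m + 1) k a u → WordIn (m + 1) k a u' → WShare (m + 1) s u u' →
      (f u' (u' i) = β ∧ f u' (u' (i + 1)) = β') →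
      β ≠ β' ∧ f u s = prescribed (u i) (u (i + 1)) β β' s := by
    intro u u' s hu hu' h hg
    have hne := hu'.isWord.1 i (by omega)
    refine ⟨by rw [← hg.1, ← hg.2]; exact (hf.inj u' hu').ne hne, ?_⟩
    rw [hf.share u u' hu hu' s h, eq_prescribed (hf.inj u' hu') hne hg.1 hg.2]
    have e1 := h i (by omega)
    have e2 := h (i + 1) (by omega)
    simp only [prescribed, eq_comm (a := s), e1, e2]
  have fin : ∀ u s t, WordIn (m + 1) k a u → β ≠ β' → s ≠ t →
      f u s = prescribed (u i) (u (i + 1)) β β' s → f u t = prescribed (u i) (u (i + 1)) β β' t →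
      f u (u i) = β ∧ f u (u (i + 1)) = β' := by
    intro u s t hu hβ hst hs ht
    have hne := hu.isWord.1 i (by omega)
    rw [eq_of_agree_two (hf.inj u hu) (prescribed_injective hne hβ) hst hs ht]
    simp [prescribed, hne.symm]
  have hlast : ∀ u x p, WordIn (m + 1) k a u → u (m - 1) = k → u m = x → 1 ≤ p → p ≤ m - 2 →
      u p = x → β ≠ β' ∧ f u x = prescribed (u i) (u (i + 1)) β β' x := by
    rintro u x p hu hum rfl hp hpm hup
    obtain ⟨u', hu', hm', -, hs⟩ := hu.exists_share hm hum hp hpm hup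
    exact T u u' _ hu hu' hs (hB u' hu' hm')
  have hpre : ∀ (u : ℕ → Fin 3) x, prescribed (Function.update u m x i) (Function.update u m x (i + 1)) β β' =
      prescribed (u i) (u (i + 1)) β β' := by
    intro u x
    rw [Function.update_of_ne (by omega), Function.update_of_ne (by omega)]
  -- The two words that differ only at `m` share `k`. One of them has the correct value at `a`, the
  -- other at the third letter; the common value at `k` avoids both, which makes it correct as well.
  have hocc : ∀ u p, WordIn (m + 1) k a u → u (m - 1) = k → 1 ≤ p → p ≤ m - 2 → u p = thd k a →
      ∀ u', (u' = Function.update u m a ∨ u' = Function.update u m (thd k a)) →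
      f u' (u' i) = β ∧ f u' (u' (i + 1)) = β' := by
    intro u p hu hum hp hpm hup
    obtain ⟨w1, s1⟩ := hu.update_last hm hum hka
    obtain ⟨w2, s2⟩ := hu.update_last hm hum ht.symm
    obtain ⟨hβ, e1⟩ := hlast _ a 1 w1 (by rw [Function.update_of_ne (by omega), hum]) (by simp)
      le_rfl (by omega) (by rw [Function.update_of_ne (by omega), hu.one])
    obtain ⟨-, e2⟩ := hlast _ (thd k a) p w2 (by rw [Function.update_of_ne (by omega), hum])
      (by simp) hp hpm (by rw [Function.update_of_ne (by omega), hup])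
    have e3 := (hf.share _ _ w1 hu k s1.symm).trans (hf.share _ _ hu w2 k s2)
    rw [hpre] at e1 e2
    have hd := prescribed_injective (hu.isWord.1 i (by omega)) hβ
    have e4 : f (Function.update u m a) k = prescribed (u i) (u (i + 1)) β β' k := by
      have n1 := (hf.inj _ w1).ne hka
      have n2 := (hf.inj _ w2).ne ht.symm
      rw [e1] at n1
      rw [e2, ← e3] at n2
      rw [eq_thd (hd.ne ht'.symm) n1 n2]
      exact (eq_thd (hd.ne ht'.symm) (hd.ne hka) (hd.ne ht.symm)).symm
    rintro u' (rfl | rfl)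
    · exact fin _ k a w1 hβ hka (by rw [hpre]; exact e4) (by rw [hpre]; exact e1)
    · exact fin _ k (thd k a) w2 hβ ht.symm (by rw [hpre, ← e3]; exact e4)
        (by rw [hpre]; exact e2)
  intro u hu
  by_cases hum : u (m - 1) = k
  swap
  · exact hB u hu hum
  have hall : ∀ u', (u' = Function.update u m a ∨ u' = Function.update u m (thd k a)) →
      f u' (u' i) = β ∧ f u' (u' (i + 1)) = β' := by
    by_cases h : ∃ p, 1 ≤ p ∧ p ≤ m - 2 ∧ u p = thd k a
    · obtain ⟨p, hp, hpm, hup⟩ := h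
      exact hocc u p hu hum hp hpm hup
    push Not at h
    -- The word alternates between `k` and `a`. Writing the third letter at `m - 2` keeps the
    -- positions of `k`, and writing it at `2` keeps those of `a`; both changes lead to words that
    -- have been settled.
    obtain ⟨hm5, h2, h3, hm3, hm2⟩ := hu.of_not_occur hm hka hum h
    obtain ⟨w1, s1⟩ := hu.update_last hm hum hka
    obtain ⟨w2, s2⟩ := hu.update_last hm hum ht.symm
    obtain ⟨hβ, e1⟩ := hlast _ a 1 w1 (by rw [Function.update_of_ne (by omega), hum]) (by simp)
      le_rfl (by omega) (by rw [Function.update_of_ne (by omega), hu.one])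
    have e3 := (hf.share _ _ w1 hu k s1.symm).trans (hf.share _ _ hu w2 k s2)
    have v1 : WordIn (m + 1) k a (Function.update (Function.update u m a) (m - 2) (thd k a)) := by
      refine w1.update (by omega) (by omega) ?_ ?_
      · rw [Function.update_of_ne (by omega), show m - 2 - 1 = m - 3 by omega, hm3]
        exact ht.symm
      · rw [Function.update_of_ne (by omega), show m - 2 + 1 = m - 1 by omega, hum]
        exact ht.symm
    have v2 : WordIn (m + 1) k a
        (Function.update (Function.update u m (thd k a)) 2 (thd k a)) := by
      refine w2.update (by omega) (by omega) ?_ ?_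
      · rw [Function.update_of_ne (by omega), show 2 - 1 = 1 by omega, hu.one]
        exact ht'.symm
      · rw [Function.update_of_ne (by omega), h3]
        exact ht'.symm
    have g1 := hocc _ (m - 2) v1
      (by rw [Function.update_of_ne (by omega), Function.update_of_ne (by omega), hum])
      (by omega) le_rfl (by simp) (Function.update (Function.update u m a) (m - 2) (thd k a))
      (Or.inl (by rw [Function.update_comm (by omega), Function.update_idem]))
    have g2 := hocc _ 2 v2
      (by rw [Function.update_of_ne (by omega), Function.update_of_ne (by omega), hum])
      (by omega) (by omega) (by simp)
      (Function.update (Function.update u m (thd k a)) 2 (thd k a))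
      (Or.inr (by rw [Function.update_comm (by omega), Function.update_idem]))
    have e4 := (T _ _ k w1 v1 (.update (by rw [Function.update_of_ne (by omega), hm2]; exact hka.symm)
      ht) g1).2
    have e5 := (T _ _ a w2 v2 (.update (by rw [Function.update_of_ne (by omega), h2]; exact hka)
      ht') g2).2
    rintro u' (rfl | rfl)
    · exact fin _ k a w1 hβ hka e4 e1
    · refine fin _ k a w2 hβ hka ?_ e5
      rw [hpre, ← e3, e4, hpre]
  have hm1 : u m ≠ k := by
    rw [← hu.zero, ← hu.isWord.2]
    exact hu.isWord.1 m (by omega)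
  rcases eq_or_eq_or_eq_thd hka (u m) with h | h | h
  · exact absurd h hm1
  · exact hall u (Or.inl (by rw [← h, Function.update_eq_self]))
  · exact hall u (Or.inr (by rw [← h, Function.update_eq_self]))

/-- The dictating vertex of the shorter cycle lies between the positions `m - 1` and `0`, where the
new position `m` is inserted. The new edge always receives the value `thd β β'`. The value at `k` is
constant on the words with `u (m - 1) = k`, and it decides which of the two neighbouring vertices
dictates. -/
theorem IsWordSystem.dictated_of_last (hm : 4 ≤ m) (hka : k ≠ a)
    (hf : IsWordSystem (m + 1) k a f) {β β' : Fin 3}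
    (hB : ∀ u, WordIn (m + 1) k a u → u (m - 1) ≠ k → f u (u (m - 1)) = β ∧ f u k = β') :
    ∃ i < m + 1, ∃ β β', ∀ u, WordIn (m + 1) k a u → f u (u i) = β ∧ f u (u (i + 1)) = β' := by
  have ht := thd_ne_left hka
  have ht' := thd_ne_right hka
  have hB3 : ∀ u, WordIn (m + 1) k a u → u (m - 1) ≠ k → f u (u m) = thd β β' := by
    intro u hu hum
    obtain ⟨h1, h2⟩ := hB u hu hum
    have hl : u (m + 1) = k := hu.isWord.2.trans hu.zero
    have n1 : u m ≠ k := by rw [← hl]; exact hu.isWord.1 m (by omega)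
    have n2 : u m ≠ u (m - 1) := by
      have := hu.isWord.1 (m - 1) (by omega)
      rw [Nat.sub_add_cancel (by omega)] at this
      exact this.symm
    rw [← h1, ← h2]
    exact eq_thd ((hf.inj u hu).ne hum) ((hf.inj u hu).ne n2) ((hf.inj u hu).ne n1)
  have hlast : ∀ u x p, WordIn (m + 1) k a u → u (m - 1) = k → u m = x → 1 ≤ p → p ≤ m - 2 →
      u p = x → f u x = thd β β' := by
    rintro u x p hu hum rfl hp hpm hup
    obtain ⟨u', hu', hm', he, hs⟩ := hu.exists_share hm hum hp hpm hup
    rw [hf.share u u' hu hu' _ hs, ← hB3 u' hu' hm', he]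
  have hlast' : ∀ u x p, WordIn (m + 1) k a u → u (m - 1) = k → k ≠ x → 1 ≤ p → p ≤ m - 2 →
      u p = x → f (Function.update u m x) x = thd β β' := by
    intro u x p hu hum hx hp hpm hup
    exact hlast _ x p (hu.update_last hm hum hx).1 (by rw [Function.update_of_ne (by omega), hum])
      (by simp) hp hpm (by rw [Function.update_of_ne (by omega), hup])
  have hk : ∀ u x, WordIn (m + 1) k a u → u (m - 1) = k → k ≠ x →
      f (Function.update u m x) k = f u k := by
    intro u x hu hum hx
    obtain ⟨w, s⟩ := hu.update_last hm hum hx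
    exact (hf.share _ _ hu w k s).symm
  have hk3 : ∀ u, WordIn (m + 1) k a u → u (m - 1) = k → f u k ≠ thd β β' := by
    intro u hu hum
    rw [← hk u a hu hum hka, ← hlast' u a 1 hu hum hka le_rfl (by omega) hu.one]
    exact (hf.inj _ (hu.update_last hm hum hka).1).ne hka
  have hshare : ∀ (u u' : ℕ → Fin 3) x s, (∀ j < m, u j = s ↔ u' j = s) →
      WShare (m + 1) s (Function.update u m x) (Function.update u' m x) := by
    intro u u' x s h j hj
    by_cases hjm : j = m
    · subst hjm; simp
    · rw [Function.update_of_ne hjm, Function.update_of_ne hjm]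
      exact h j (by omega)
  -- A common position set of `k` can be used at once, after setting the letter at `m` to `a`. For
  -- `a`, the letter at `m` is set to the third letter. If that letter occurs earlier in one of the
  -- words, its value is `thd β β'`, and the values at `a` determine those at `k`. If it occurs in
  -- neither, then `k` stands exactly where `a` does not.
  have hstep : ∀ u u', WordIn (m + 1) k a u → WordIn (m + 1) k a u' → u (m - 1) = k →
      u' (m - 1) = k → (∃ s, s ≠ thd k a ∧ ∀ j < m, u j = s ↔ u' j = s) → f u k = f u' k := by
    rintro u u' hu hu' hum hum' ⟨s, hst, hs⟩
    have case_k : (∀ j < m, u j = k ↔ u' j = k) → f u k = f u' k := by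
      intro h
      rw [← hk u a hu hum hka, ← hk u' a hu' hum' hka]
      exact hf.share _ _ (hu.update_last hm hum hka).1 (hu'.update_last hm hum' hka).1 k
        (hshare u u' a k h)
    rcases eq_or_eq_or_eq_thd hka s with rfl | rfl | rfl
    · exact case_k hs
    swap
    · exact absurd rfl hst
    have w := (hu.update_last hm hum ht.symm).1
    have w' := (hu'.update_last hm hum' ht.symm).1
    have e1 : f (Function.update u m (thd k s)) s = f (Function.update u' m (thd k s)) s :=
      hf.share _ _ w w' s (hshare u u' _ s hs)
    have e2 := hk u _ hu hum ht.symm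
    have e2' := hk u' _ hu' hum' ht.symm
    have h3 := hk3 u hu hum
    have h3' := hk3 u' hu' hum'
    have n1 := (hf.inj _ w).ne hka
    have n1' := (hf.inj _ w').ne hka
    have cancel : f (Function.update u m (thd k s)) s ≠ thd β β' → f u k = f u' k := by
      intro h
      have h' := h
      rw [e1] at h'
      rw [← e2, ← e2']
      rw [← e2] at h3
      rw [← e2'] at h3'
      rw [eq_thd h.symm h3 n1, eq_thd h'.symm h3' n1', e1]
    by_cases h : ∃ p, 1 ≤ p ∧ p ≤ m - 2 ∧ u p = thd k s
    · obtain ⟨p, hp, hpm, hup⟩ := h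
      refine cancel ?_
      rw [← hlast' u _ p hu hum ht.symm hp hpm hup]
      exact (hf.inj _ w).ne ht'.symm
    by_cases h' : ∃ p, 1 ≤ p ∧ p ≤ m - 2 ∧ u' p = thd k s
    · obtain ⟨p, hp, hpm, hup⟩ := h'
      refine cancel ?_
      rw [e1, ← hlast' u' _ p hu' hum' ht.symm hp hpm hup]
      exact (hf.inj _ w').ne ht'.symm
    push Not at h h'
    have key : ∀ v, WordIn (m + 1) k s v → v (m - 1) = k →
        (∀ p, 1 ≤ p → p ≤ m - 2 → v p ≠ thd k s) → ∀ j < m, v j = k ↔ v j ≠ s := by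
      intro v hv hvm hn j hj
      constructor
      · intro h; rw [h]; exact hka
      · intro hns
        rcases Nat.eq_zero_or_pos j with rfl | hj0
        · exact hv.zero
        by_cases hjm : j = m - 1
        · rw [hjm, hvm]
        rcases eq_or_eq_or_eq_thd hka (v j) with h | h | h
        · exact h
        · exact absurd h hns
        · exact absurd h (hn j hj0 (by omega))
    exact case_k fun j hj => by
      rw [key u hu hum h j hj, key u' hu' hum' h' j hj]
      exact not_congr (hs j hj)
  -- The positions from `1` to `m - 1` carry linear words from `a` to `k`. These are connected by
  -- steps that keep the positions of `a` or `k`, neither of which is the third letter.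
  have hconst : ∀ u u', WordIn (m + 1) k a u → WordIn (m + 1) k a u' → u (m - 1) = k →
      u' (m - 1) = k → f u k = f u' k := by
    let lift : (ℕ → Fin 3) → ℕ → Fin 3 := fun v j =>
      if j = 0 ∨ m < j then k else if j = m then a else v (j - 1)
    have hlift : ∀ v, IsLinearWord (m - 2) a k v →
        WordIn (m + 1) k a (lift v) ∧ lift v (m - 1) = k := by
      intro v hv
      have h1 : lift v 1 = a := by
        simp only [lift]
        rw [if_neg (by omega), if_neg (by omega), Nat.sub_self, hv.1]
      have h2 : lift v (m - 1) = k := by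
        simp only [lift]
        rw [if_neg (by omega), if_neg (by omega), show m - 1 - 1 = m - 2 by omega, hv.2.1]
      have h3 : lift v m = a := by
        simp only [lift]
        rw [if_neg (by omega), if_pos trivial]
      refine ⟨⟨⟨fun j hj => ?_, by simp [lift]⟩, by simp [lift], h1⟩, h2⟩
      rcases Nat.eq_zero_or_pos j with rfl | hj0
      · rw [zero_add, h1]; simpa [lift] using hka
      by_cases hjm : j = m
      · rw [hjm, h3]; simpa [lift] using hka.symm
      by_cases hjm' : j + 1 = m
      · rw [hjm', h3, show j = m - 1 by omega, h2]; exact hka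
      · simp only [lift]
        rw [if_neg (by omega), if_neg (by omega), if_neg (by omega), if_neg (by omega)]
        have := hv.2.2 (j - 1) (by omega)
        rwa [show j - 1 + 1 = j + 1 - 1 by omega] at this
    have hlin : ∀ u, WordIn (m + 1) k a u → u (m - 1) = k →
        IsLinearWord (m - 2) a k fun j => u (j + 1) := fun u hu hum =>
      ⟨hu.one, by beta_reduce; rw [show m - 2 + 1 = m - 1 by omega, hum],
        fun i hi => hu.isWord.1 _ (by omega)⟩
    have hback : ∀ u, WordIn (m + 1) k a u → u (m - 1) = k →
        f u k = f (lift fun j => u (j + 1)) k := by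
      intro u hu hum
      obtain ⟨h1, h2⟩ := hlift _ (hlin u hu hum)
      refine hstep _ _ hu h1 hum h2 ⟨a, ht'.symm, fun j hj => ?_⟩
      simp only [lift]
      rcases Nat.eq_zero_or_pos j with rfl | hj0
      · simp [hu.zero]
      · rw [if_neg (by omega), if_neg (by omega), Nat.sub_add_cancel hj0]
    intro u u' hu hu' hum hum'
    rw [hback u hu hum, hback u' hu' hum']
    have hpath := IsLinearWord.connected (ε := thd k a) ht'.symm ht.symm (hlin u hu hum)
      (hlin u' hu' hum')
    generalize (fun j => u' (j + 1)) = w at hpath ⊢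
    induction hpath with
    | refl => rfl
    | tail _ h ih =>
      obtain ⟨h1, h2, s, hs, h⟩ := h
      rw [ih]
      refine hstep _ _ (hlift _ h1).1 (hlift _ h2).1 (hlift _ h1).2 (hlift _ h2).2
        ⟨s, hs, fun j hj => ?_⟩
      simp only [lift]
      rcases Nat.eq_zero_or_pos j with rfl | hj0
      · simp
      · rw [if_neg (by omega), if_neg (by omega), if_neg (by omega), if_neg (by omega)]
        exact h _ (by omega)
  have hA3 : ∀ u, WordIn (m + 1) k a u → u (m - 1) = k → f u (u m) = thd β β' := by
    intro u hu hum
    have hm1 : u m ≠ k := by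
      rw [← hu.zero, ← hu.isWord.2]
      exact hu.isWord.1 m (by omega)
    by_cases h : ∃ p, 1 ≤ p ∧ p ≤ m - 2 ∧ u p = u m
    · obtain ⟨p, hp, hpm, hup⟩ := h
      exact hlast u _ p hu hum rfl hp hpm hup
    push Not at h
    have hma : u m ≠ a := by rw [← hu.one]; exact (h 1 le_rfl (by omega)).symm
    have hmt : u m = thd k a := eq_thd hka hm1 hma
    rw [hmt] at h ⊢
    obtain ⟨hm5, h2, h3, hm3, hm2⟩ := hu.of_not_occur hm hka hum h
    have v : WordIn (m + 1) k a (Function.update u 2 (thd k a)) := by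
      refine hu.update (by omega) (by omega) ?_ ?_
      · rw [show 2 - 1 = 1 by omega, hu.one]; exact ht'.symm
      · rw [h3]; exact ht'.symm
    have vm : Function.update u 2 (thd k a) (m - 1) = k := by
      rw [Function.update_of_ne (by omega), hum]
    have e1 : f u a = f (Function.update u 2 (thd k a)) a :=
      hf.share _ _ hu v a (.update (by rw [h2]; exact hka) ht')
    have e2 := hconst _ _ hu v hum vm
    have e3 := hlast _ (thd k a) 2 v vm (by rw [Function.update_of_ne (by omega), hmt])
      (by omega) (by omega) (by simp)
    rw [← e3, eq_of_agree_two (hf.inj _ hu) (hf.inj _ v) hka e2 e1]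
  -- The value at `k` is never `thd β β'`. If it is `β'`, the pair of positions `m`, `m + 1`
  -- dictates; if it is `β`, the pair `m - 1`, `m` does.
  by_cases hA : ∀ u, WordIn (m + 1) k a u → u (m - 1) = k → f u k = β'
  · refine ⟨m, by omega, thd β β', β', fun u hu => ?_⟩
    rw [hu.isWord.2, hu.zero]
    by_cases hum : u (m - 1) = k
    · exact ⟨hA3 u hu hum, hA u hu hum⟩
    · exact ⟨hB3 u hu hum, (hB u hu hum).2⟩
  · push Not at hA
    obtain ⟨u₀, hu₀, hum₀, hne⟩ := hA
    obtain ⟨v, hv, hvm, -⟩ := hu₀.update_last hm hum₀ hka |>.1.exists_share hm (p := 1)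
      (by rw [Function.update_of_ne (by omega), hum₀]) le_rfl (by omega)
      (by rw [Function.update_of_ne (by omega), hu₀.one]; simp)
    have hββ : β ≠ β' := by
      rw [← (hB v hv hvm).1, ← (hB v hv hvm).2]
      exact (hf.inj v hv).ne hvm
    have hβ : ∀ u, WordIn (m + 1) k a u → u (m - 1) = k → f u k = β := by
      intro u hu hum
      rw [hconst u u₀ hu hu₀ hum hum₀]
      rcases eq_or_eq_or_eq_thd hββ (f u₀ k) with h | h | h
      · exact h
      · exact absurd h hne
      · exact absurd h (hk3 u₀ hu₀ hum₀)
    refine ⟨m - 1, by omega, β, thd β β', fun u hu => ?_⟩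
    rw [Nat.sub_add_cancel (by omega)]
    by_cases hum : u (m - 1) = k
    · exact ⟨by rw [hum]; exact hβ u hu hum, hA3 u hu hum⟩
    · exact ⟨(hB u hu hum).1, hB3 u hu hum⟩

/-- The systems on the words of a cycle of length at least four are dictated by a vertex. -/
theorem IsWordSystem.dictated (hn : 4 ≤ n) (hka : k ≠ a) (hf : IsWordSystem n k a f) :
    ∃ i < n, ∃ β β', ∀ u, WordIn n k a u → f u (u i) = β ∧ f u (u (i + 1)) = β' := by
  induction n, hn using Nat.le_induction generalizing f with
  | base => exact hf.dictated_four hka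
  | succ m hm ih =>
    -- A word of length `m` is prolonged by the letter that differs from its last and its first
    -- letter. The results are the words of length `m + 1` with three different letters at `m - 1`,
    -- `m` and `m + 1`, and the prolongation keeps shared letters.
    let ext : (ℕ → Fin 3) → ℕ → Fin 3 := fun v j =>
      if j < m then v j else if j = m then thd (v (m - 1)) (v 0) else v 0
    have hne : ∀ v, IsWord m v → v (m - 1) ≠ v 0 := fun v hv => hv.ne_last hm
    have hext : ∀ v, WordIn m k a v → WordIn (m + 1) k a (ext v) := by
      intro v hv
      have h0 : ext v 0 = v 0 := by simp [ext, show 0 < m by omega]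
      refine ⟨⟨fun j hj => ?_, ?_⟩, h0.trans hv.zero, ?_⟩
      · rcases lt_trichotomy (j + 1) m with h | h | h
        · simp only [ext]
          rw [if_pos (by omega), if_pos h]
          exact hv.isWord.1 j (by omega)
        · simp only [ext]
          rw [if_pos (by omega), if_neg (by omega), if_pos h, show j = m - 1 by omega]
          exact (thd_ne_left (hne v hv.isWord)).symm
        · simp only [ext]
          rw [if_neg (by omega), if_pos (by omega), if_neg (by omega), if_neg (by omega)]
          exact thd_ne_right (hne v hv.isWord)
      · rw [h0]; simp [ext]
      · simp only [ext]
        rw [if_pos (by omega)]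
        exact hv.one
    have hf' : IsWordSystem m k a fun v => f (ext v) := by
      refine ⟨fun v hv => hf.inj _ (hext v hv), fun v v' hv hv' s h =>
        hf.share _ _ (hext v hv) (hext v' hv') s fun j hj => ?_⟩
      simp only [ext]
      by_cases hjm : j < m
      · rw [if_pos hjm, if_pos hjm]
        exact h j hjm
      · rw [if_neg hjm, if_neg hjm, if_pos (by omega), if_pos (by omega),
          thd_eq_iff (hne v hv.isWord), thd_eq_iff (hne v' hv'.isWord)]
        exact and_congr (not_congr (h _ (by omega))) (not_congr (h _ (by omega)))
    obtain ⟨i, hi, β, β', hd⟩ := ih hf'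
    have hB : ∀ u, WordIn (m + 1) k a u → u (m - 1) ≠ k →
        f u (u i) = β ∧ f u (if i + 1 < m then u (i + 1) else k) = β' := by
      intro u hu hum
      have hv : WordIn m k a fun j => if j < m then u j else u 0 := by
        refine ⟨⟨fun j hj => ?_, ?_⟩, ?_, ?_⟩
        · beta_reduce
          rw [if_pos hj]
          split_ifs with h
          · exact hu.isWord.1 j (by omega)
          · rw [show j = m - 1 by omega, hu.zero]
            exact hum
        · simp
        · simp [hu.zero]
        · simp [hu.one, show 1 < m by omega]
      have e := hd _ hv
      have hc : f (ext fun j => if j < m then u j else u 0) = f u := by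
        refine hf.congr (hext _ hv) hu fun j hj => ?_
        by_cases hjm : j < m
        · simp [ext, hjm]
        · have : j = m := by omega
          subst this
          have h1 := hu.isWord.1 (j - 1) (by omega)
          have h2 := hu.isWord.1 j (by omega)
          rw [Nat.sub_add_cancel (by omega)] at h1
          rw [hu.isWord.2] at h2
          have h3 : u (j - 1) ≠ u 0 := by rw [hu.zero]; exact hum
          simp only [ext, lt_irrefl, if_false, if_true, show j - 1 < j by omega,
            show 0 < j by omega]
          exact (eq_thd h3 h1.symm h2).symm
      beta_reduce at e
      rw [hc, if_pos hi, hu.zero] at e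
      exact e
    by_cases hi1 : i + 1 < m
    · simp only [hi1, if_true] at hB
      exact ⟨i, by omega, β, β', hf.dictated_of_lt hm hka hi1 hB⟩
    · simp only [hi1, if_false] at hB
      obtain rfl : i = m - 1 := by omega
      exact hf.dictated_of_last hm hka hB

end WordSystems

/-! ### Colourings of amalgams -/

section Amalgams

variable {V E : Type*} {G : SimpleGraph V} {st : V → Set E} {W W₀ Wa Wb : Set V} {s : Fin 3}
  {c c' d d' : E → Fin 3} {n m : ℕ} {q : ℕ → V} {u : V}

theorem VertexAmalgam.symm (h : VertexAmalgam G W Wa Wb u) : VertexAmalgam G W Wb Wa u :=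
  ⟨by rw [h.union, Set.union_comm], by rw [Set.inter_comm, h.inter], h.conn_right, h.conn_left,
    fun x hx y hy hxy => (h.no_cross y hy x hx hxy.symm).symm, h.adj_right, h.adj_left⟩

theorem VertexAmalgam.mem_left (h : VertexAmalgam G W Wa Wb u) : u ∈ Wa :=
  (h.inter.symm ▸ rfl : u ∈ Wa ∩ Wb).1

theorem VertexAmalgam.mem_right (h : VertexAmalgam G W Wa Wb u) : u ∈ Wb := h.symm.mem_left

theorem VertexAmalgam.subset_left (h : VertexAmalgam G W Wa Wb u) : Wa ⊆ W := by
  rw [h.union]; exact Set.subset_union_left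

theorem VertexAmalgam.ncard_lt [Finite V] (h : VertexAmalgam G W Wa Wb u) :
    Wa.ncard < W.ncard := by
  refine Set.ncard_lt_ncard (h.subset_left.ssubset_of_not_subset fun hW => ?_) (Set.toFinite _)
  obtain ⟨b, hb, hub⟩ := h.adj_right
  have : b ∈ Wa ∩ Wb := ⟨hW (h.symm.subset_left hb), hb⟩
  rw [h.inter] at this
  exact hub.ne this.symm

theorem EarAmalgam.ncard_lt [Finite V] (h : EarAmalgam G W W₀ m q) : W₀.ncard < W.ncard := by
  have h2 := h.cycle.two_le
  have hsub : W₀ ⊆ W := by rw [h.union]; exact Set.subset_union_left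
  refine Set.ncard_lt_ncard (hsub.ssubset_of_not_subset fun hW => ?_) (Set.toFinite _)
  have h1 : q 1 ∈ q '' Set.Iic (m + 1) := ⟨1, Set.mem_Iic.2 (by omega), rfl⟩
  have : q 1 ∈ W₀ ∩ q '' Set.Iic (m + 1) := ⟨hW (by rw [h.union]; exact Or.inr h1), h1⟩
  rw [h.inter] at this
  rcases this with h' | h'
  · have := h.cycle.injOn (Set.mem_Iic.2 (by omega)) (Set.mem_Iic.2 (by omega)) h'
    omega
  · have := h.cycle.injOn (Set.mem_Iic.2 (by omega)) (Set.mem_Iic.2 le_rfl)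
      (Set.mem_singleton_iff.1 h')
    omega

/-- Induction over the decompositions of a triangle-free graph without minor `K₂,₃`, for
statements about connected sets with a root, which is a vertex or a pair of adjacent vertices. -/
theorem NoK23Minor.induction [Finite V] (hG : NoK23Minor G) (hT : G.CliqueFree 3)
    {P : Set V → V → V → Prop} (single : ∀ r, P {r} r r)
    (edge : ∀ r v, G.Adj r v → P {r, v} r r ∧ P {r, v} r v)
    (vertex : ∀ W Wa Wb u r r', VertexAmalgam G W Wa Wb u → r ∈ Wa → r' ∈ Wa →
      (r = r' ∨ G.Adj r r') → (∀ r ∈ Wa, ∀ r' ∈ Wa, (r = r' ∨ G.Adj r r') → P Wa r r') →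
      (∀ r ∈ Wb, ∀ r' ∈ Wb, (r = r' ∨ G.Adj r r') → P Wb r r') → P W r r')
    (ear : ∀ W W₀ m q r r', EarAmalgam G W W₀ m q → r ∈ W₀ → r' ∈ W₀ →
      (r = r' ∨ G.Adj r r') → (∀ r ∈ W₀, ∀ r' ∈ W₀, (r = r' ∨ G.Adj r r') → P W₀ r r') →
      P W r r') :
    ∀ W, ConnIn G W → ∀ r ∈ W, ∀ r' ∈ W, (r = r' ∨ G.Adj r r') → P W r r' := by
  intro W
  induction hN : W.ncard using Nat.strong_induction_on generalizing W with
  | _ N ih =>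
  subst hN
  intro hW r hr r' hr' hrr
  rcases hG.decompose hT hW hr hr' hrr with h | ⟨v, hv, h⟩ | ⟨Wa, Wb, u, h⟩ | ⟨W₀, m, q, h, h1, h2⟩
  · subst h
    rw [Set.mem_singleton_iff.1 hr']
    exact single r
  · subst h
    rcases hr' with rfl | hr'
    · exact (edge _ v hv).1
    · rw [Set.mem_singleton_iff.1 hr']
      exact (edge r v hv).2
  · have ha := fun r hr r' hr' hrr => ih _ h.ncard_lt Wa rfl h.conn_left r hr r' hr' hrr
    have hb := fun r hr r' hr' hrr => ih _ h.symm.ncard_lt Wb rfl h.conn_right r hr r' hr' hrr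
    -- No edge joins the two sides away from `u`, so an edge that serves as the root lies on one
    -- side.
    have hside : (r ∈ Wa ∧ r' ∈ Wa) ∨ (r ∈ Wb ∧ r' ∈ Wb) := by
      have hu := h.mem_left
      have hu' := h.mem_right
      rw [h.union] at hr hr'
      rcases hrr with rfl | hrr
      · rcases hr with hr | hr
        · exact Or.inl ⟨hr, hr⟩
        · exact Or.inr ⟨hr, hr⟩
      · rcases hr with hr | hr <;> rcases hr' with hr' | hr'
        · exact Or.inl ⟨hr, hr'⟩
        · rcases h.no_cross _ hr _ hr' hrr with rfl | rfl
          · exact Or.inr ⟨hu', hr'⟩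
          · exact Or.inl ⟨hr, hu⟩
        · rcases h.no_cross _ hr' _ hr hrr.symm with rfl | rfl
          · exact Or.inr ⟨hr, hu'⟩
          · exact Or.inl ⟨hu, hr'⟩
        · exact Or.inr ⟨hr, hr'⟩
    rcases hside with ⟨h1, h2⟩ | ⟨h1, h2⟩
    · exact vertex W Wa Wb u r r' h h1 h2 hrr ha hb
    · exact vertex W Wb Wa u r r' h.symm h1 h2 hrr hb ha
  · exact ear W W₀ m q r r' h h1 h2 hrr
      fun r hr r' hr' hrr => ih _ h.ncard_lt W₀ rfl h.conn r hr r' hr' hrr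

open Classical in
/-- The colouring that is `d` at the vertices in `W` and `c` elsewhere. -/
noncomputable def glue (st : V → Set E) (W : Set V) (d c : E → Fin 3) : E → Fin 3 :=
  fun x => if x ∈ edgesOf st W then d x else c x

theorem glue_eqOn_left : Set.EqOn (glue st Wa d c) d (edgesOf st Wa) := fun _ hx => if_pos hx

theorem glue_eqOn_right (h : Set.EqOn d c (edgesOf st Wa ∩ edgesOf st Wb)) :
    Set.EqOn (glue st Wa d c) c (edgesOf st Wb) := by
  intro x hx
  by_cases hxa : x ∈ edgesOf st Wa
  · exact (if_pos hxa).trans (h ⟨hxa, hx⟩)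
  · exact if_neg hxa

theorem proper_glue (h : Set.EqOn d c (edgesOf st Wa ∩ edgesOf st Wb)) (hd : Proper st Wa d)
    (hc : Proper st Wb c) : Proper st (Wa ∪ Wb) (glue st Wa d c) :=
  (hd.congr glue_eqOn_left.symm).union (hc.congr (glue_eqOn_right h).symm)

theorem share_glue (h : Set.EqOn d c (edgesOf st Wa ∩ edgesOf st Wb))
    (h' : Set.EqOn d' c' (edgesOf st Wa ∩ edgesOf st Wb)) (hd : Share (edgesOf st Wa) s d d')
    (hc : Share (edgesOf st Wb) s c c') :
    Share (edgesOf st (Wa ∪ Wb)) s (glue st Wa d c) (glue st Wa d' c') := by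
  rw [edgesOf_union]
  refine .union (fun x hx => ?_) fun x hx => ?_
  · rw [glue_eqOn_left hx, glue_eqOn_left hx]; exact hd x hx
  · rw [glue_eqOn_right h hx, glue_eqOn_right h' hx]; exact hc x hx

theorem VertexAmalgam.edgesOf_inter (hs : IsCubicStar G st) (h : VertexAmalgam G W Wa Wb u) :
    edgesOf st Wa ∩ edgesOf st Wb ⊆ st u := by
  rintro x ⟨⟨a, ha, hxa⟩, b, hb, hxb⟩
  by_cases hab : a = b
  · subst hab
    have : a ∈ Wa ∩ Wb := ⟨ha, hb⟩
    rw [h.inter] at this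
    rwa [← Set.mem_singleton_iff.1 this]
  · rcases h.no_cross a ha b hb ((hs.adj_iff a b hab).1 ⟨x, hxa, hxb⟩) with rfl | rfl
    · exact hxa
    · exact hxb

/-- The edges of a cycle `q 0, …, q (n - 1)` that is attached to a set `W₀` along the edge `e 0`
with the ends `q (n - 1)` and `q 0`: the edge `e j` joins `q (j - 1)` to `q j`, and `h j` is the
third edge at `q j`. -/
structure EarEdges (st : V → Set E) (W W₀ : Set V) (n : ℕ) (q : ℕ → V) (e h : ℕ → E) : Prop where
  four_le : 4 ≤ n
  star : ∀ j < n, st (q j) = {e j, e (j + 1), h j}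
  cyc : e n = e 0
  e_inj : ∀ i < n, ∀ j < n, e i = e j → i = j
  h_inj : ∀ i < n, ∀ j < n, h i = h j → i = j
  e_ne_h : ∀ i < n, ∀ j < n, e i ≠ h j
  union : W = W₀ ∪ q '' Set.Iio n
  mem_zero : q 0 ∈ W₀
  mem_last : q (n - 1) ∈ W₀
  ne : q 0 ≠ q (n - 1)
  edges_inter : edgesOf st W₀ ∩ edgesOf st (q '' Set.Iio n) ⊆ st (q 0) ∪ st (q (n - 1))
  star_zero : ∀ v ∈ W₀, e 0 ∈ st v → v = q 0 ∨ v = q (n - 1)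
  star_one : ∀ v ∈ W₀, e 1 ∈ st v → v = q 0
  star_last : ∀ v ∈ W₀, e (n - 1) ∈ st v → v = q (n - 1)

/-- The third edges are distinct because of chordlessness: a common third edge of `q i` and `q j`
would make these vertices adjacent, hence consecutive on the cycle, and then they would have two
edges in common. -/
theorem EarAmalgam.exists_earEdges (hs : IsCubicStar G st) (h : EarAmalgam G W W₀ m q) :
    ∃ e h, EarEdges st W W₀ (m + 2) q e h := by
  have h2 := h.cycle.two_le
  have hinj : ∀ i ≤ m + 1, ∀ j ≤ m + 1, q i = q j → i = j := fun i hi j hj hij =>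
    h.cycle.injOn (Set.mem_Iic.2 hi) (Set.mem_Iic.2 hj) hij
  have hmid : ∀ i ≤ m, ∃ x, x ∈ st (q i) ∧ x ∈ st (q (i + 1)) := fun i hi =>
    (hs.adj_iff _ _ (h.cycle.adj i hi).ne).2 (h.cycle.adj i hi)
  obtain ⟨κ, hκ0, hκ⟩ := (hs.adj_iff _ _ h.cycle.adj_last.ne).2 h.cycle.adj_last
  have : Nonempty E := ⟨κ⟩
  choose! z hz using hmid
  -- The attaching edge `κ` gets the index `0` and all indices beyond `m + 1`, so that `e (m + 2) =
  -- e 0` closes the cycle.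
  let e : ℕ → E := fun j => if j = 0 ∨ m + 1 < j then κ else z (j - 1)
  have he0 : e 0 = κ := by simp [e]
  have hen : e (m + 2) = κ := by simp [e]
  have hez : ∀ i ≤ m, e (i + 1) = z i := by
    intro i hi
    simp only [e]
    rw [if_neg (by omega), Nat.add_sub_cancel]
  have hel : ∀ j < m + 2, e j ∈ st (q j) := by
    intro j hj
    rcases Nat.eq_zero_or_pos j with rfl | hj0
    · rw [he0]; exact hκ0
    · obtain ⟨i, rfl⟩ := Nat.exists_eq_add_of_lt hj0
      rw [zero_add, hez i (by omega)]
      exact (hz i (by omega)).2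
  have her : ∀ j < m + 2, e (j + 1) ∈ st (q j) := by
    intro j hj
    by_cases hjm : j = m + 1
    · rw [hjm, hen]; exact hκ
    · rw [hez j (by omega)]
      exact (hz j (by omega)).1
  let pr : ℕ → ℕ := fun j => if j = 0 then m + 1 else j - 1
  have hpr : ∀ j < m + 2, pr j < m + 2 ∧ pr j ≠ j ∧ e j ∈ st (q (pr j)) := by
    intro j hj
    simp only [pr]
    rcases Nat.eq_zero_or_pos j with rfl | hj0
    · refine ⟨by simp, by simp, ?_⟩
      rw [if_pos rfl, he0]; exact hκ
    · rw [if_neg (by omega)]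
      refine ⟨by omega, by omega, ?_⟩
      have := her (j - 1) (by omega)
      rwa [Nat.sub_add_cancel hj0] at this
  have hends : ∀ j < m + 2, ∀ v, e j ∈ st v → v = q j ∨ v = q (pr j) := by
    intro j hj v hv
    obtain ⟨h1, h2, h3⟩ := hpr j hj
    rcases hs.two _ v (q j) (q (pr j)) hv (hel j hj) h3 with h | h | h
    · exact Or.inl h
    · exact absurd (hinj _ (by omega) _ (by omega) h).symm h2
    · exact Or.inr h
  have hadj : ∀ i < m + 2, ∀ j < m + 2, e i ∈ st (q j) → j = i ∨ j = pr i := by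
    intro i hi j hj hij
    rcases hends i hi _ hij with h | h
    · exact Or.inl (hinj _ (by omega) _ (by omega) h)
    · exact Or.inr (hinj _ (by omega) _ (by have := (hpr i hi).1; omega) h)
  have einj : ∀ i < m + 2, ∀ j < m + 2, e i = e j → i = j := by
    intro i hi j hj hij
    by_contra hne
    have h1 := (hadj i hi j hj (hij ▸ hel j hj)).resolve_left (Ne.symm hne)
    have h2 := (hadj j hj i hi (hij ▸ hel i hi)).resolve_left hne
    simp only [pr] at h1 h2
    split_ifs at h1 h2 <;> omega
  have hene : ∀ j < m + 2, e j ≠ e (j + 1) := by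
    intro j hj hjj
    by_cases hjm : j = m + 1
    · rw [hjm, hen, ← he0] at hjj
      have := einj _ (by omega) _ (by omega) hjj
      omega
    · have := einj _ hj _ (by omega) hjj
      omega
  have hthird : ∀ j < m + 2, ∃ g, g ∈ st (q j) ∧ g ≠ e j ∧ g ≠ e (j + 1) ∧
      st (q j) = {e j, e (j + 1), g} := fun j hj =>
    hs.exists_third (hel j hj) (her j hj) (hene j hj)
  choose! g hg1 hg2 hg3 hg4 using hthird
  have hC : q '' Set.Iio (m + 2) = q '' Set.Iic (m + 1) := by
    congr 1; ext j; simp only [Set.mem_Iio, Set.mem_Iic]; omega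
  have h0C : q 0 ∈ W₀ ∩ q '' Set.Iic (m + 1) := by rw [h.inter]; simp
  have hlC : q (m + 1) ∈ W₀ ∩ q '' Set.Iic (m + 1) := by rw [h.inter]; simp
  have hnotin : ∀ j, 1 ≤ j → j ≤ m → q j ∉ W₀ := by
    intro j h1 hj hjW
    have : q j ∈ W₀ ∩ q '' Set.Iic (m + 1) := ⟨hjW, j, Set.mem_Iic.2 (by omega), rfl⟩
    rw [h.inter] at this
    rcases this with h' | h'
    · have := hinj _ (by omega) _ (by omega) h'
      omega
    · have := hinj _ (by omega) _ (by omega) (Set.mem_singleton_iff.1 h')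
      omega
  have hegh : ∀ i < m + 2, ∀ j < m + 2, e i ≠ g j := by
    intro i hi j hj hij
    rcases hadj i hi j hj (hij ▸ hg1 j hj) with rfl | hji
    · exact hg2 j hj hij.symm
    · simp only [pr] at hji
      split_ifs at hji with hi0
      · subst hi0 hji
        exact hg3 _ hj (by rw [← hij, hen, he0])
      · refine hg3 j hj ?_
        rw [← hij]; congr 1; omega
  refine ⟨e, g, by omega, hg4, hen.trans he0.symm, einj, ?_, hegh, by rw [hC, h.union], h0C.1,
    hlC.1, fun h' => ?_, ?_, ?_, ?_, ?_⟩
  · intro i hi j hj hij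
    by_contra hne
    have hqne : q i ≠ q j := fun h' => hne (hinj _ (by omega) _ (by omega) h')
    have hi' : g i ∈ st (q j) := hij ▸ hg1 j hj
    have hshared : ∀ a < m + 2, e a ∈ st (q i) → e a ∈ st (q j) → False := fun a ha h1 h2 =>
      hegh a ha i hi (hs.unique _ _ hqne _ _ h1 h2 (hg1 i hi) hi')
    have hA := (hs.adj_iff _ _ hqne).1 ⟨_, hg1 i hi, hi'⟩
    rcases h.cycle.chordless i (by omega) j (by omega) hA with h' | h' | ⟨h', h''⟩ | ⟨h', h''⟩
    · exact hshared j hj (h' ▸ her i hi) (hel j hj)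
    · exact hshared i hi (hel i hi) (h' ▸ her j hj)
    · subst h' h''
      exact hshared 0 (by omega) (hel 0 (by omega)) (by rw [he0]; exact hκ)
    · subst h' h''
      exact hshared 0 (by omega) (by rw [he0]; exact hκ) (hel 0 (by omega))
  · have := hinj _ (by omega) _ (by omega) h'
    omega
  · rw [hC, show m + 2 - 1 = m + 1 by omega]
    rintro x ⟨⟨a, ha, hxa⟩, b, hb, hxb⟩
    by_cases hab : a = b
    · subst hab
      have : a ∈ W₀ ∩ q '' Set.Iic (m + 1) := ⟨ha, hb⟩
      rw [h.inter] at this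
      rcases this with rfl | h'
      · exact Or.inl hxa
      · rw [Set.mem_singleton_iff.1 h'] at hxa
        exact Or.inr hxa
    · rcases h.no_cross a ha b hb ((hs.adj_iff a b hab).1 ⟨x, hxa, hxb⟩) with (rfl | h') | (rfl | h')
      · exact Or.inl hxa
      · rw [Set.mem_singleton_iff.1 h'] at hxa
        exact Or.inr hxa
      · exact Or.inl hxb
      · rw [Set.mem_singleton_iff.1 h'] at hxb
        exact Or.inr hxb
  · intro v _ hv0
    exact hends 0 (by omega) v hv0
  · intro v hv hv1
    rcases hends 1 (by omega) v hv1 with rfl | h'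
    · exact absurd hv (hnotin 1 le_rfl (by omega))
    · exact h'
  · intro v hv hv1
    rw [show m + 2 - 1 = m + 1 by omega] at hv1 ⊢
    rcases hends (m + 1) (by omega) v hv1 with h' | rfl
    · exact h'
    · exact absurd hv (hnotin m (by omega) le_rfl)

end Amalgams

/-! ### Colourings of an ear and cyclic words -/

section EarColorings

variable {V E : Type*} {G : SimpleGraph V} {st : V → Set E} {W W₀ Wa Wb : Set V} {s : Fin 3}
  {c c' d d' : E → Fin 3} {n : ℕ} {q : ℕ → V} {e h : ℕ → E} {u u' : ℕ → Fin 3}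

open Classical in
/-- The colouring of the edges at a cycle that belongs to a cyclic word. -/
noncomputable def cycleColoring (n : ℕ) (e h : ℕ → E) (u : ℕ → Fin 3) : E → Fin 3 := fun x =>
  if hx : ∃ j < n, e j = x then u hx.choose
  else if hx : ∃ j < n, h j = x then thd (u hx.choose) (u (hx.choose + 1)) else 0

namespace EarEdges

variable (hE : EarEdges st W W₀ n q e h)
include hE

theorem e_mem {j : ℕ} (hj : j < n) : e j ∈ st (q j) := by simp [hE.star j hj]

theorem e_succ_mem {j : ℕ} (hj : j < n) : e (j + 1) ∈ st (q j) := by simp [hE.star j hj]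

theorem h_mem {j : ℕ} (hj : j < n) : h j ∈ st (q j) := by simp [hE.star j hj]

theorem e_zero_mem_last : e 0 ∈ st (q (n - 1)) := by
  have hn := hE.four_le
  rw [← hE.cyc]
  have := hE.e_succ_mem (j := n - 1) (by omega)
  rwa [Nat.sub_add_cancel (by omega)] at this

theorem e_mem_edgesOf {j : ℕ} (hj : j < n) : e j ∈ edgesOf st (q '' Set.Iio n) :=
  mem_edgesOf (Set.mem_image_of_mem q hj) (hE.e_mem hj)

theorem e_ne_succ {j : ℕ} (hj : j < n) : e j ≠ e (j + 1) := by
  have hn := hE.four_le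
  intro hjj
  by_cases hjn : j + 1 = n
  · rw [hjn, hE.cyc] at hjj
    have := hE.e_inj j hj 0 (by omega) hjj
    omega
  · have := hE.e_inj j hj (j + 1) (by omega) hjj
    omega

theorem e_succ_ne_h {i j : ℕ} (hi : i < n) (hj : j < n) : e (i + 1) ≠ h j := by
  by_cases hin : i + 1 = n
  · rw [hin, hE.cyc]
    exact hE.e_ne_h 0 (by omega) j hj
  · exact hE.e_ne_h _ (by omega) j hj

theorem subset : W₀ ⊆ W := by rw [hE.union]; exact Set.subset_union_left

theorem ne_of_injOn {j : ℕ} (hj : j < n) (hc : Set.InjOn c (st (q j))) : c (e j) ≠ c (e (j + 1)) :=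
  fun h' => hE.e_ne_succ hj (hc (hE.e_mem hj) (hE.e_succ_mem hj) h')

theorem third {j : ℕ} (hj : j < n) (hc : Set.InjOn c (st (q j))) :
    c (h j) = thd (c (e j)) (c (e (j + 1))) :=
  eq_thd (hE.ne_of_injOn hj hc)
    (fun h' => hE.e_ne_h j hj j hj (hc (hE.h_mem hj) (hE.e_mem hj) h').symm)
    (fun h' => hE.e_succ_ne_h hj hj (hc (hE.h_mem hj) (hE.e_succ_mem hj) h').symm)

theorem isWord (hc : Proper st (q '' Set.Iio n) c) : IsWord n fun j => c (e j) :=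
  ⟨fun _ hj => hE.ne_of_injOn hj (hc _ (Set.mem_image_of_mem q hj)), by simp only [hE.cyc]⟩

theorem cycleColoring_e_lt {j : ℕ} (hj : j < n) : cycleColoring n e h u (e j) = u j := by
  have hx : ∃ i < n, e i = e j := ⟨j, hj, rfl⟩
  rw [cycleColoring, dif_pos hx]
  congr 1
  exact hE.e_inj _ hx.choose_spec.1 _ hj hx.choose_spec.2

theorem cycleColoring_e (hu : IsWord n u) {j : ℕ} (hj : j ≤ n) :
    cycleColoring n e h u (e j) = u j := by
  have hn := hE.four_le
  rcases hj.lt_or_eq with hj | rfl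
  · exact hE.cycleColoring_e_lt hj
  · rw [hE.cyc, hu.2]
    exact hE.cycleColoring_e_lt (by omega)

theorem cycleColoring_h {j : ℕ} (hj : j < n) :
    cycleColoring n e h u (h j) = thd (u j) (u (j + 1)) := by
  have hx : ∃ i < n, h i = h j := ⟨j, hj, rfl⟩
  rw [cycleColoring, dif_neg, dif_pos hx]
  · have := hE.h_inj _ hx.choose_spec.1 _ hj hx.choose_spec.2
    rw [this]
  · rintro ⟨i, hi, hij⟩
    exact hE.e_ne_h i hi j hj hij

theorem proper_cycleColoring (hu : IsWord n u) :
    Proper st (q '' Set.Iio n) (cycleColoring n e h u) := by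
  rintro _ ⟨j, hj, rfl⟩
  have hj : j < n := hj
  rw [hE.star j hj]
  have h1 := hE.cycleColoring_e hu hj.le
  have h2 := hE.cycleColoring_e hu (j := j + 1) hj
  have h3 := hE.cycleColoring_h (u := u) hj
  have n1 := hu.1 j hj
  have n2 := thd_ne_left n1
  have n3 := thd_ne_right n1
  rintro x (rfl | rfl | rfl) y (rfl | rfl | rfl) hxy <;>
    first
    | rfl
    | (rw [h1, h2] at hxy; exact absurd hxy n1)
    | (rw [h2, h1] at hxy; exact absurd hxy.symm n1)
    | (rw [h1, h3] at hxy; exact absurd hxy.symm n2)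
    | (rw [h3, h1] at hxy; exact absurd hxy n2)
    | (rw [h2, h3] at hxy; exact absurd hxy.symm n3)
    | (rw [h3, h2] at hxy; exact absurd hxy n3)

theorem eqOn_cycleColoring {D : Set E} (hD : ∀ x ∈ D, ∃ j < n, (x = e j ∨ x = e (j + 1) ∨ x = h j) ∧
    Set.InjOn d (st (q j)) ∧ d (e j) = u j ∧ d (e (j + 1)) = u (j + 1)) (hu : IsWord n u) :
    Set.EqOn d (cycleColoring n e h u) D := by
  intro x hx
  obtain ⟨j, hj, hxj, hd, h1, h2⟩ := hD x hx
  rcases hxj with rfl | rfl | rfl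
  · rw [hE.cycleColoring_e hu hj.le, h1]
  · rw [hE.cycleColoring_e hu hj, h2]
  · rw [hE.cycleColoring_h hj, hE.third hj hd, h1, h2]

theorem share_cycleColoring (hu : IsWord n u) (hu' : IsWord n u') (h' : WShare n s u u') :
    Share (edgesOf st (q '' Set.Iio n)) s (cycleColoring n e h u) (cycleColoring n e h u') := by
  have hn := hE.four_le
  have hs' : ∀ j ≤ n, u j = s ↔ u' j = s := by
    intro j hj
    rcases hj.lt_or_eq with hj | rfl
    · exact h' j hj
    · rw [hu.2, hu'.2]; exact h' 0 (by omega)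
  rintro x ⟨_, ⟨j, hj, rfl⟩, hx⟩
  have hj : j < n := hj
  rw [hE.star j hj] at hx
  rcases hx with rfl | rfl | rfl
  · rw [hE.cycleColoring_e hu hj.le, hE.cycleColoring_e hu' hj.le]
    exact hs' j hj.le
  · rw [hE.cycleColoring_e hu (j := j + 1) hj, hE.cycleColoring_e hu' (j := j + 1) hj]
    exact hs' _ hj
  · rw [hE.cycleColoring_h hj, hE.cycleColoring_h hj, thd_eq_iff (hu.1 j hj),
      thd_eq_iff (hu'.1 j hj)]
    exact and_congr (not_congr (hs' j hj.le)) (not_congr (hs' _ hj))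

/-- Common edges of the cycle and the old part are incident with `q 0` or `q (n - 1)`. There all
colours are determined by the letters at `0`, `1` and `n - 1`. -/
theorem eqOn_inter (hd : Proper st W₀ d) (hu : IsWord n u) (h' : WSame n u fun j => d (e j)) :
    Set.EqOn d (cycleColoring n e h u) (edgesOf st W₀ ∩ edgesOf st (q '' Set.Iio n)) := by
  have hn := hE.four_le
  refine hE.eqOn_cycleColoring (fun x hx => ?_) hu
  rcases hE.edges_inter hx with hx | hx
  · refine ⟨0, by omega, ?_, hd _ hE.mem_zero, h'.1.symm, h'.2.1.symm⟩
    rwa [hE.star 0 (by omega)] at hx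
  · refine ⟨n - 1, by omega, ?_, hd _ hE.mem_last, h'.2.2.symm, ?_⟩
    · rwa [hE.star (n - 1) (by omega)] at hx
    · rw [Nat.sub_add_cancel (by omega), hE.cyc, hu.2]
      exact h'.1.symm

theorem proper_glue (hd : Proper st W₀ d) (hu : IsWord n u) (h' : WSame n u fun j => d (e j)) :
    Proper st W (glue st W₀ d (cycleColoring n e h u)) := by
  rw [hE.union]
  exact _root_.proper_glue (hE.eqOn_inter hd hu h') hd (hE.proper_cycleColoring hu)

theorem glue_e (hd : Proper st W₀ d) (hu : IsWord n u) (h' : WSame n u fun j => d (e j)) {j : ℕ}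
    (hj : j < n) : glue st W₀ d (cycleColoring n e h u) (e j) = u j := by
  rw [glue_eqOn_right (hE.eqOn_inter hd hu h') (hE.e_mem_edgesOf hj), hE.cycleColoring_e hu hj.le]

theorem share_glue (hd : Proper st W₀ d) (hu : IsWord n u) (h₁ : WSame n u fun j => d (e j))
    (hd' : Proper st W₀ d') (hu' : IsWord n u') (h₁' : WSame n u' fun j => d' (e j))
    (hdd : Share (edgesOf st W₀) s d d') (huu : WShare n s u u') :
    Share (edgesOf st W) s (glue st W₀ d (cycleColoring n e h u))
      (glue st W₀ d' (cycleColoring n e h u')) := by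
  rw [hE.union]
  exact _root_.share_glue (hE.eqOn_inter hd hu h₁) (hE.eqOn_inter hd' hu' h₁') hdd
    (hE.share_cycleColoring hu hu' huu)

theorem proper_left (hc : Proper st W c) : Proper st W₀ c := hc.mono hE.subset

theorem proper_cycle (hc : Proper st W c) : Proper st (q '' Set.Iio n) c :=
  hc.mono (by rw [hE.union]; exact Set.subset_union_right)

/-- Every colouring is glued from its restriction and its word. -/
theorem eqOn_glue (hc : Proper st W c) :
    Set.EqOn c (glue st W₀ c (cycleColoring n e h fun j => c (e j))) (edgesOf st W) := by
  have hw := hE.isWord (hE.proper_cycle hc)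
  rw [hE.union, edgesOf_union]
  rintro x (hx | hx)
  · exact (glue_eqOn_left hx).symm
  · rw [glue_eqOn_right (hE.eqOn_inter (hE.proper_left hc) hw ⟨rfl, rfl, rfl⟩) hx]
    refine hE.eqOn_cycleColoring (D := edgesOf st (q '' Set.Iio n)) ?_ hw hx
    rintro x ⟨_, ⟨j, hj, rfl⟩, hx⟩
    have hj : j < n := hj
    rw [hE.star j hj] at hx
    exact ⟨j, hj, hx, hE.proper_cycle hc _ (Set.mem_image_of_mem q hj), rfl, rfl⟩

theorem e_zero_ne_one (hd : Proper st W₀ d) : d (e 0) ≠ d (e 1) :=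
  hE.ne_of_injOn (by have := hE.four_le; omega) (hd _ hE.mem_zero)

theorem e_zero_ne_last (hd : Proper st W₀ d) : d (e 0) ≠ d (e (n - 1)) := by
  have hn := hE.four_le
  have := hE.ne_of_injOn (j := n - 1) (by omega) (hd _ hE.mem_last)
  rw [Nat.sub_add_cancel (by omega), hE.cyc] at this
  exact this.symm

theorem e_one_mem : e 1 ∈ st (q 0) := hE.e_succ_mem (by have := hE.four_le; omega)

theorem e_zero_mem : e 0 ∈ st (q 0) := hE.e_mem (by have := hE.four_le; omega)

theorem e_last_mem : e (n - 1) ∈ st (q (n - 1)) := hE.e_mem (by have := hE.four_le; omega)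

theorem exists_extension (hd : Proper st W₀ d) :
    ∃ u, IsWord n u ∧ (WSame n u fun j => d (e j)) ∧ Linked n u := by
  obtain ⟨u, hu, h0, h1, hl, hL⟩ := exists_linked_word hE.four_le (hE.e_zero_ne_one hd)
    (hE.e_zero_ne_last hd)
  exact ⟨u, hu, ⟨h0, h1, hl⟩, hL⟩

theorem adj (hs : IsCubicStar G st) : G.Adj (q 0) (q (n - 1)) :=
  (hs.adj_iff _ _ hE.ne).1 ⟨e 0, hE.e_zero_mem, hE.e_zero_mem_last⟩

end EarEdges

/-- Both kinds of colourings exist at the edge `κ` that joins `r` to `r'`. -/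
def BothTypes (st : V → Set E) (W : Set V) (r r' : V) : Prop :=
  ∀ κ x y, κ ∈ st r → κ ∈ st r' → x ∈ st r → x ≠ κ → y ∈ st r' → y ≠ κ →
    (∃ c, Proper st W c ∧ c x = c y) ∧ ∃ c, Proper st W c ∧ c x ≠ c y

theorem IsCubicStar.exists_coloring (hs : IsCubicStar G st) {v : V} {x y : E} (hx : x ∈ st v)
    (hy : y ∈ st v) (hxy : x ≠ y) {a b : Fin 3} (hab : a ≠ b) :
    ∃ c : E → Fin 3, Set.InjOn c (st v) ∧ c x = a ∧ c y = b := by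
  classical
  obtain ⟨g, -, hgx, hgy, hst⟩ := hs.exists_third hx hy hxy
  have ha := thd_ne_left hab
  have hb := thd_ne_right hab
  refine ⟨fun z => if z = x then a else if z = y then b else thd a b, ?_, by simp, by
    simp [hxy.symm]⟩
  rw [hst]
  rintro z (rfl | rfl | rfl) w (rfl | rfl | rfl) hzw <;>
    simp_all [Ne.symm]

theorem IsCubicStar.exists_pair_coloring (hs : IsCubicStar G st) {r v : V} (hrv : G.Adj r v)
    {κ : E} (hκ : κ ∈ st r) (hκ' : κ ∈ st v) (hd : Set.InjOn d (st r)) (hc : Set.InjOn c (st v))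
    (h : d κ = c κ) : ∃ f, Proper st {r, v} f ∧ Set.EqOn f d (st r) ∧ Set.EqOn f c (st v) := by
  have hr : edgesOf st {r} = st r := by ext x; simp [edgesOf]
  have hv : edgesOf st {v} = st v := by ext x; simp [edgesOf]
  have heq : Set.EqOn d c (edgesOf st {r} ∩ edgesOf st {v}) := by
    rw [hr, hv]
    rintro x ⟨hx, hx'⟩
    rw [hs.unique r v hrv.ne x κ hx hx' hκ hκ', h]
  refine ⟨glue st {r} d c, ?_, ?_, ?_⟩
  · refine _root_.proper_glue heq ?_ ?_
    · rintro x rfl; exact hd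
    · rintro x rfl; exact hc
  · rw [← hr]; exact glue_eqOn_left
  · rw [← hv]; exact glue_eqOn_right heq

variable {w : V}

theorem VertexAmalgam.eqOn_inter (hs : IsCubicStar G st) (h : VertexAmalgam G W Wa Wb w)
    (hcd : Set.EqOn d c (st w)) : Set.EqOn d c (edgesOf st Wa ∩ edgesOf st Wb) :=
  hcd.mono (h.edgesOf_inter hs)

theorem VertexAmalgam.proper_glue (hs : IsCubicStar G st) (h : VertexAmalgam G W Wa Wb w)
    (hd : Proper st Wa d) (hc : Proper st Wb c) (hcd : Set.EqOn d c (st w)) :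
    Proper st W (glue st Wa d c) := by
  rw [h.union]
  exact _root_.proper_glue (h.eqOn_inter hs hcd) hd hc

theorem VertexAmalgam.share_glue (hs : IsCubicStar G st) (h : VertexAmalgam G W Wa Wb w)
    (hcd : Set.EqOn d c (st w)) (hcd' : Set.EqOn d' c' (st w)) (hd : Share (edgesOf st Wa) s d d')
    (hc : Share (edgesOf st Wb) s c c') :
    Share (edgesOf st W) s (glue st Wa d c) (glue st Wa d' c') := by
  rw [h.union]
  exact _root_.share_glue (h.eqOn_inter hs hcd) (h.eqOn_inter hs hcd') hd hc

/-- Every colouring of one side extends. -/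
theorem VertexAmalgam.exists_extension (hs : IsCubicStar G st) (h : VertexAmalgam G W Wa Wb w)
    (hd : Proper st Wa d) (hc : Proper st Wb c) :
    ∃ σ : Equiv.Perm (Fin 3), Set.EqOn d (σ ∘ c) (st w) := by
  obtain ⟨σ, hσ⟩ := hs.exists_perm (hc w h.mem_right) (hd w h.mem_left)
  exact ⟨σ, fun x hx => (hσ x hx).symm⟩

/-- Up to renaming the colours, the only requirement of the word is whether `e 1` and `e (n - 1)`
get the same colour, and both types of colourings are available. -/
theorem EarEdges.exists_fit (hE : EarEdges st W W₀ n q e h)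
    (hty : BothTypes st W₀ (q 0) (q (n - 1))) (hu : IsWord n u) :
    ∃ d, Proper st W₀ d ∧ WSame n u fun j => d (e j) := by
  have hn := hE.four_le
  have h01 : u 0 ≠ u 1 := hu.1 0 (by omega)
  have hl := hu.ne_last hn
  have hx : e 1 ≠ e 0 := fun h' => by have := hE.e_inj _ (by omega) _ (by omega) h'; omega
  have hy : e (n - 1) ≠ e 0 := fun h' => by have := hE.e_inj _ (by omega) _ (by omega) h'; omega
  obtain ⟨⟨c, hc, h1⟩, c', hc', h2⟩ := hty (e 0) (e 1) (e (n - 1)) hE.e_zero_mem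
    hE.e_zero_mem_last hE.e_one_mem hx hE.e_last_mem hy
  by_cases h' : u 1 = u (n - 1)
  · obtain ⟨σ, hσ0, hσ1⟩ := exists_perm_of_ne (hE.e_zero_ne_one hc) h01
    refine ⟨σ ∘ c, hc.perm σ, hσ0.symm, hσ1.symm, ?_⟩
    change _ = σ (c (e (n - 1)))
    rw [← h1, hσ1, h']
  · obtain ⟨σ, hσ0, hσ1⟩ := exists_perm_of_ne (hE.e_zero_ne_one hc') h01
    refine ⟨σ ∘ c', hc'.perm σ, hσ0.symm, hσ1.symm, ?_⟩
    change _ = σ (c' (e (n - 1)))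
    rw [eq_thd (hE.e_zero_ne_one hc') (hE.e_zero_ne_last hc').symm h2.symm,
      ← thd_perm σ (hE.e_zero_ne_one hc'), hσ0, hσ1]
    exact eq_thd h01 hl (Ne.symm h')

variable [Finite V]

/-- Every colouring of the part that contains the root extends to the new part: at a cut vertex
after renaming the colours, over an ear by a word with the prescribed letters. So existence and both
types are inherited from the base cases. -/
theorem NoK23Minor.exists_proper_and_bothTypes (hG : NoK23Minor G) (hT : G.CliqueFree 3)
    (hs : IsCubicStar G st) : ∀ W, ConnIn G W → ∀ r ∈ W, ∀ r' ∈ W, (r = r' ∨ G.Adj r r') →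
      (∃ c, Proper st W c) ∧ (G.Adj r r' → BothTypes st W r r') := by
  have hpair : ∀ r v, G.Adj r v → BothTypes st {r, v} r v := by
    intro r v hrv κ x y hκ hκ' hx hxκ hy hyκ
    obtain ⟨d, hd, hdκ, hdx⟩ := hs.exists_coloring hκ hx hxκ.symm (a := 0) (b := 1) (by decide)
    obtain ⟨c, hc, hcκ, hcx⟩ := hs.exists_coloring hκ' hy hyκ.symm (a := 0) (b := 1) (by decide)
    obtain ⟨c', hc', hcκ', hcx'⟩ := hs.exists_coloring hκ' hy hyκ.symm (a := 0) (b := 2) (by decide)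
    obtain ⟨f, hf, h1, h2⟩ := hs.exists_pair_coloring hrv hκ hκ' hd hc (hdκ.trans hcκ.symm)
    obtain ⟨f', hf', h1', h2'⟩ := hs.exists_pair_coloring hrv hκ hκ' hd hc' (hdκ.trans hcκ'.symm)
    refine ⟨⟨f, hf, ?_⟩, f', hf', ?_⟩
    · rw [h1 hx, h2 hy, hdx, hcx]
    · rw [h1' hx, h2' hy, hdx, hcx']; decide
  refine hG.induction hT (P := fun W r r' => (∃ c, Proper st W c) ∧
    (G.Adj r r' → BothTypes st W r r')) ?_ ?_ ?_ ?_
  · intro r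
    obtain ⟨x, hx⟩ := hs.nonempty r
    obtain ⟨f, g, hf, -, -, hst⟩ := hs.exists_enum hx
    obtain ⟨c, hc, -⟩ := hs.exists_coloring hx (y := f) (by simp [hst]) hf (a := 0) (b := 1)
      (by decide)
    exact ⟨⟨c, by rintro _ rfl; exact hc⟩, fun h => absurd rfl h.ne⟩
  · intro r v hrv
    obtain ⟨κ, hκ, hκ'⟩ := (hs.adj_iff r v hrv.ne).2 hrv
    obtain ⟨x, g, hx, -, -, hst⟩ := hs.exists_enum hκ
    obtain ⟨y, g', hy, -, -, hst'⟩ := hs.exists_enum hκ'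
    obtain ⟨⟨c, hc, -⟩, -⟩ := hpair r v hrv κ x y hκ hκ' (by simp [hst]) hx.symm (by simp [hst'])
      hy.symm
    exact ⟨⟨⟨c, hc⟩, fun h => absurd rfl h.ne⟩, ⟨c, hc⟩, fun _ => hpair r v hrv⟩
  · intro W Wa Wb u r r' h hr hr' hrr iha ihb
    obtain ⟨b, hb⟩ := (ihb u h.mem_right u h.mem_right (Or.inl rfl)).1
    have hext : ∀ d, Proper st Wa d → ∃ c, Proper st W c ∧ Set.EqOn c d (edgesOf st Wa) := by
      intro d hd
      obtain ⟨σ, hσ⟩ := h.exists_extension hs hd hb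
      exact ⟨_, h.proper_glue hs hd (hb.perm σ) hσ, glue_eqOn_left⟩
    obtain ⟨⟨a, ha⟩, hty⟩ := iha r hr r' hr' hrr
    obtain ⟨c, hc, -⟩ := hext a ha
    refine ⟨⟨c, hc⟩, fun hadj κ x y hκ hκ' hx hxκ hy hyκ => ?_⟩
    obtain ⟨⟨c, hc, h1⟩, c', hc', h2⟩ := hty hadj κ x y hκ hκ' hx hxκ hy hyκ
    obtain ⟨f, hf, hfc⟩ := hext c hc
    obtain ⟨f', hf', hfc'⟩ := hext c' hc'
    have hxW := mem_edgesOf hr hx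
    have hyW := mem_edgesOf hr' hy
    exact ⟨⟨f, hf, by rw [hfc hxW, hfc hyW, h1]⟩, f', hf', by rwa [hfc' hxW, hfc' hyW]⟩
  · intro W W₀ m q r r' h hr hr' hrr ih
    obtain ⟨e, k, hE⟩ := h.exists_earEdges hs
    have hext : ∀ d, Proper st W₀ d → ∃ c, Proper st W c ∧ Set.EqOn c d (edgesOf st W₀) := by
      intro d hd
      obtain ⟨u, hu, hud, -⟩ := hE.exists_extension hd
      exact ⟨_, hE.proper_glue hd hu hud, glue_eqOn_left⟩
    obtain ⟨⟨a, ha⟩, hty⟩ := ih r hr r' hr' hrr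
    obtain ⟨c, hc, -⟩ := hext a ha
    refine ⟨⟨c, hc⟩, fun hadj κ x y hκ hκ' hx hxκ hy hyκ => ?_⟩
    obtain ⟨⟨c, hc, h1⟩, c', hc', h2⟩ := hty hadj κ x y hκ hκ' hx hxκ hy hyκ
    obtain ⟨f, hf, hfc⟩ := hext c hc
    obtain ⟨f', hf', hfc'⟩ := hext c' hc'
    have hxW := mem_edgesOf hr hx
    have hyW := mem_edgesOf hr' hy
    exact ⟨⟨f, hf, by rw [hfc hxW, hfc hyW, h1]⟩, f', hf', by rwa [hfc' hxW, hfc' hyW]⟩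

theorem NoK23Minor.exists_proper (hG : NoK23Minor G) (hT : G.CliqueFree 3)
    (hs : IsCubicStar G st) (hW : ConnIn G W) {r : V} (hr : r ∈ W) : ∃ c, Proper st W c :=
  (hG.exists_proper_and_bothTypes hT hs W hW r hr r hr (Or.inl rfl)).1

theorem NoK23Minor.bothTypes (hG : NoK23Minor G) (hT : G.CliqueFree 3)
    (hs : IsCubicStar G st) (hW : ConnIn G W) {r r' : V} (hr : r ∈ W) (hr' : r' ∈ W)
    (h : G.Adj r r') : BothTypes st W r r' :=
  (hG.exists_proper_and_bothTypes hT hs W hW r hr r' hr' (Or.inr h)).2 h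

end EarColorings

/-! ### Variation of colours and separation of edges -/

section Separation

variable {V E : Type*} {G : SimpleGraph V} {st : V → Set E} {W W₀ Wa Wb : Set V} {s : Fin 3}
  {c c' d d' : E → Fin 3} {n : ℕ} {q : ℕ → V} {e h : ℕ → E} {u u' : ℕ → Fin 3}

/-- An edge of the cycle that is not incident with `W₀` varies. -/
theorem EarEdges.exists_words_ne (hE : EarEdges st W W₀ n q e h) {f : E}
    (hf : f ∈ edgesOf st (q '' Set.Iio n)) (hf0 : f ∉ edgesOf st W₀) :
    ∃ u u', IsWord n u ∧ IsWord n u' ∧ WSame n u u' ∧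
      cycleColoring n e h u f ≠ cycleColoring n e h u' f := by
  have hn := hE.four_le
  -- The edge is governed by a free position `i`: it is the cycle edge `e i`, or a third edge at one
  -- of the ends of `e i`. The third edge at `q 1` needs `i = 2`, since `e 1` is not free.
  have key : ∃ i, 2 ≤ i ∧ i + 2 ≤ n ∧ (f = e i ∨ ∃ j < n, f = h j ∧ (i = j ∨ i = j + 1)) := by
    have h0 : ∀ x, x ∈ st (q 0) → f ≠ x := fun x hx hfx =>
      hf0 (mem_edgesOf hE.mem_zero (hfx ▸ hx))
    have hl : ∀ x, x ∈ st (q (n - 1)) → f ≠ x := fun x hx hfx =>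
      hf0 (mem_edgesOf hE.mem_last (hfx ▸ hx))
    have he : ∀ j, j < n → f = e j → 2 ≤ j ∧ j + 2 ≤ n := by
      intro j hj hfj
      refine ⟨?_, ?_⟩
      · by_contra hlt
        obtain rfl | rfl : j = 0 ∨ j = 1 := by omega
        · exact h0 _ hE.e_zero_mem hfj
        · exact h0 _ hE.e_one_mem hfj
      · by_contra hlt
        obtain rfl : j = n - 1 := by omega
        exact hl _ hE.e_last_mem hfj
    obtain ⟨_, ⟨j, hj, rfl⟩, hfj⟩ := hf
    have hj : j < n := hj
    rw [hE.star j hj] at hfj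
    rcases hfj with hfj | hfj | hfj
    · obtain ⟨h1, h2⟩ := he j hj hfj
      exact ⟨j, h1, h2, Or.inl hfj⟩
    · by_cases hjn : j + 1 = n
      · rw [hjn, hE.cyc] at hfj
        exact absurd hfj (h0 _ hE.e_zero_mem)
      · obtain ⟨h1, h2⟩ := he (j + 1) (by omega) hfj
        exact ⟨j + 1, h1, h2, Or.inl hfj⟩
    · have hj0 : j ≠ 0 := by rintro rfl; exact h0 _ (hE.h_mem hj) hfj
      have hjl : j ≠ n - 1 := by rintro rfl; exact hl _ (hE.h_mem hj) hfj
      by_cases hj1 : j = 1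
      · exact ⟨2, le_rfl, by omega, Or.inr ⟨j, hj, hfj, Or.inr (by omega)⟩⟩
      · exact ⟨j, by omega, by omega, Or.inr ⟨j, hj, hfj, Or.inl rfl⟩⟩
  obtain ⟨i, hi, hin, hfi⟩ := key
  obtain ⟨u, u', hu, hu', -, -, hne, heq⟩ := exists_words_ne_at (n := n) (k := 0) (a := 1)
    (by decide) hi hin
  refine ⟨u, u', hu, hu', ⟨heq _ (by omega), heq _ (by omega), heq _ (by omega)⟩, ?_⟩
  have cancel : ∀ {a b b' : Fin 3}, a ≠ b → a ≠ b' → b ≠ b' → thd a b ≠ thd a b' := by decide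
  rcases hfi with rfl | ⟨j, hj, rfl, rfl | rfl⟩
  · rwa [hE.cycleColoring_e_lt (by omega), hE.cycleColoring_e_lt (by omega)]
  · rw [hE.cycleColoring_h hj, hE.cycleColoring_h hj, ← heq (i + 1) (by omega), thd_comm,
      thd_comm (u' i)]
    refine cancel (hu.1 i hj).symm ?_ hne
    rw [heq (i + 1) (by omega)]
    exact (hu'.1 i hj).symm
  · rw [hE.cycleColoring_h hj, hE.cycleColoring_h hj, ← heq j (by omega)]
    refine cancel (hu.1 j hj) ?_ hne
    rw [heq j (by omega)]
    exact hu'.1 j hj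

variable [Finite V]

/-- The colour of an edge is not determined by the colours at a vertex that is not an end. -/
theorem NoK23Minor.exists_vary (hG : NoK23Minor G) (hT : G.CliqueFree 3)
    (hs : IsCubicStar G st) : ∀ W, ConnIn G W → ∀ r ∈ W, ∀ f ∈ edgesOf st W, f ∉ st r →
      ∃ c c', Proper st W c ∧ Proper st W c' ∧ Set.EqOn c c' (st r) ∧ c f ≠ c' f := by
  intro W hW r hr
  refine hG.induction hT (P := fun W r _ => ∀ f ∈ edgesOf st W, f ∉ st r →
      ∃ c c', Proper st W c ∧ Proper st W c' ∧ Set.EqOn c c' (st r) ∧ c f ≠ c' f)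
      ?_ ?_ ?_ ?_ W hW r hr r hr (Or.inl rfl)
  · rintro r f ⟨v, hv, hf⟩ hfr
    rw [Set.mem_singleton_iff.1 hv] at hf
    exact absurd hf hfr
  · intro r v hrv
    refine (and_self_iff).2 fun f hf hfr => ?_
    have hfv : f ∈ st v := by
      obtain ⟨w, rfl | hw, hfw⟩ := hf
      · exact absurd hfw hfr
      · rwa [Set.mem_singleton_iff.1 hw] at hfw
    obtain ⟨κ, hκ, hκ'⟩ := (hs.adj_iff r v hrv.ne).2 hrv
    have hκf : κ ≠ f := fun h' => hfr (h' ▸ hκ)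
    obtain ⟨x, g, hx, -, -, hst⟩ := hs.exists_enum hκ
    obtain ⟨d, hd, hdκ, -⟩ := hs.exists_coloring hκ (y := x) (by simp [hst]) hx (a := 0) (b := 1)
      (by decide)
    obtain ⟨c, hc, hcκ, hcf⟩ := hs.exists_coloring hκ' hfv hκf (a := 0) (b := 1) (by decide)
    obtain ⟨c', hc', hcκ', hcf'⟩ := hs.exists_coloring hκ' hfv hκf (a := 0) (b := 2) (by decide)
    obtain ⟨f1, hf1, h1, h2⟩ := hs.exists_pair_coloring hrv hκ hκ' hd hc (hdκ.trans hcκ.symm)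
    obtain ⟨f2, hf2, h1', h2'⟩ := hs.exists_pair_coloring hrv hκ hκ' hd hc' (hdκ.trans hcκ'.symm)
    refine ⟨f1, f2, hf1, hf2, h1.trans h1'.symm, ?_⟩
    rw [h2 hfv, h2' hfv, hcf, hcf']; decide
  · intro W Wa Wb u r r' h hr hr' hrr iha ihb f hf hfr
    by_cases hfa : f ∈ edgesOf st Wa
    · obtain ⟨c, c', hc, hc', hcc, hne⟩ := iha r hr r' hr' hrr f hfa hfr
      obtain ⟨b, hb⟩ := hG.exists_proper hT hs h.conn_right h.mem_right
      obtain ⟨σ, hσ⟩ := h.exists_extension hs hc hb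
      obtain ⟨σ', hσ'⟩ := h.exists_extension hs hc' hb
      refine ⟨_, _, h.proper_glue hs hc (hb.perm σ) hσ, h.proper_glue hs hc' (hb.perm σ') hσ',
        fun x hx => ?_, ?_⟩
      · rw [glue_eqOn_left (mem_edgesOf hr hx), glue_eqOn_left (mem_edgesOf hr hx), hcc hx]
      · rwa [glue_eqOn_left hfa, glue_eqOn_left hfa]
    · have hfb : f ∈ edgesOf st Wb := by
        rw [h.union, edgesOf_union] at hf
        exact hf.resolve_left hfa
      have hfu : f ∉ st u := fun hfu => hfa (mem_edgesOf h.mem_left hfu)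
      obtain ⟨c, c', hc, hc', hcc, hne⟩ := ihb u h.mem_right u h.mem_right (Or.inl rfl) f hfb hfu
      obtain ⟨a, ha⟩ := hG.exists_proper hT hs h.conn_left h.mem_left
      obtain ⟨σ, hσ⟩ := h.symm.exists_extension hs hc ha
      have hσ' : Set.EqOn (σ ∘ a) c' (st u) := hσ.symm.trans hcc
      refine ⟨_, _, h.proper_glue hs (ha.perm σ) hc hσ.symm, h.proper_glue hs (ha.perm σ) hc' hσ',
        fun x hx => ?_, ?_⟩
      · rw [glue_eqOn_left (mem_edgesOf hr hx), glue_eqOn_left (mem_edgesOf hr hx)]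
      · rwa [glue_eqOn_right (h.eqOn_inter hs hσ.symm) hfb,
          glue_eqOn_right (h.eqOn_inter hs hσ') hfb]
  · intro W W₀ m q r r' h hr hr' hrr ih f hf hfr
    obtain ⟨e, k, hE⟩ := h.exists_earEdges hs
    by_cases hf0 : f ∈ edgesOf st W₀
    · obtain ⟨c, c', hc, hc', hcc, hne⟩ := ih r hr r' hr' hrr f hf0 hfr
      obtain ⟨u, hu, hud, -⟩ := hE.exists_extension hc
      obtain ⟨u', hu', hud', -⟩ := hE.exists_extension hc'
      refine ⟨_, _, hE.proper_glue hc hu hud, hE.proper_glue hc' hu' hud', fun x hx => ?_, ?_⟩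
      · rw [glue_eqOn_left (mem_edgesOf hr hx), glue_eqOn_left (mem_edgesOf hr hx), hcc hx]
      · rwa [glue_eqOn_left hf0, glue_eqOn_left hf0]
    · have hfC : f ∈ edgesOf st (q '' Set.Iio (m + 2)) := by
        rw [hE.union, edgesOf_union] at hf
        exact hf.resolve_left hf0
      obtain ⟨u, u', hu, hu', huu, hne⟩ := hE.exists_words_ne hfC hf0
      obtain ⟨d, hd, hud⟩ := hE.exists_fit
        (hG.bothTypes hT hs h.conn hE.mem_zero hE.mem_last (hE.adj hs)) hu
      have hud' : WSame (m + 2) u' fun j => d (e j) :=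
        ⟨huu.1.symm.trans hud.1, huu.2.1.symm.trans hud.2.1, huu.2.2.symm.trans hud.2.2⟩
      refine ⟨_, _, hE.proper_glue hd hu hud, hE.proper_glue hd hu' hud', fun x hx => ?_, ?_⟩
      · rw [glue_eqOn_left (mem_edgesOf hr hx), glue_eqOn_left (mem_edgesOf hr hx)]
      · rwa [glue_eqOn_right (hE.eqOn_inter hd hu hud) hfC,
          glue_eqOn_right (hE.eqOn_inter hd hu' hud') hfC]

/-- Different edges have different colours in some colouring. -/
theorem NoK23Minor.exists_separate (hG : NoK23Minor G) (hT : G.CliqueFree 3)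
    (hs : IsCubicStar G st) (hW : ConnIn G W) {f g : E} (hf : f ∈ edgesOf st W)
    (hg : g ∈ edgesOf st W) (hfg : f ≠ g) : ∃ c, Proper st W c ∧ c f ≠ c g := by
  obtain ⟨r, hr, hfr⟩ := hf
  by_cases hgr : g ∈ st r
  · obtain ⟨c, hc⟩ := hG.exists_proper hT hs hW hr
    exact ⟨c, hc, hc.ne hr hfr hgr hfg⟩
  · obtain ⟨c, c', hc, hc', hcc, hne⟩ := hG.exists_vary hT hs W hW r hr g hg hgr
    by_cases h1 : c f = c g
    · exact ⟨c', hc', fun h2 => hne (by rw [← h1, ← h2, hcc hfr])⟩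
    · exact ⟨c, hc, h1⟩

end Separation

/-! ### Connectedness of the colourings under sharing colour classes -/

section Connectivity

variable {V E : Type*} {G : SimpleGraph V} {st : V → Set E} {W W₀ Wa Wb : Set V} {s : Fin 3}
  {c c' d d' : E → Fin 3} {n : ℕ} {q : ℕ → V} {e h : ℕ → E} {u u' : ℕ → Fin 3} {r w : V}
  {A : Set E} {S S' : Set (Fin 3)} {T : (E → Fin 3) → Prop}

/-- Two colourings with property `T` agree at `r` and share a colour class with a colour in `S`. -/
def SharingStep (st : V → Set E) (W : Set V) (r : V) (S : Set (Fin 3)) (T : (E → Fin 3) → Prop)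
    (c c' : E → Fin 3) : Prop :=
  (Proper st W c ∧ T c) ∧ (Proper st W c' ∧ T c') ∧ Set.EqOn c c' (st r) ∧
    ∃ s ∈ S, Share (edgesOf st W) s c c'

/-- The colourings with property `T` that agree at `r` are connected by steps that share a colour
class which avoids the edges in `A`. -/
def SharingConnected (st : V → Set E) (W : Set V) (r : V) (A : Set E) (T : (E → Fin 3) → Prop) :
    Prop :=
  ∀ c c', Proper st W c → Proper st W c' → T c → T c' → Set.EqOn c c' (st r) →
    Relation.ReflTransGen (SharingStep st W r {s | ∀ x ∈ A, c x ≠ s} T) c c'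

/-- The property is invariant under renaming the colours and depends only on the edges at `W`. -/
structure IsAdmissible (st : V → Set E) (W : Set V) (T : (E → Fin 3) → Prop) : Prop where
  perm : ∀ c (σ : Equiv.Perm (Fin 3)), T c → T (σ ∘ c)
  congr : ∀ c c', Set.EqOn c c' (edgesOf st W) → T c → T c'

theorem isAdmissible_true : IsAdmissible st W fun _ => True := ⟨fun _ _ _ => trivial,
  fun _ _ _ _ => trivial⟩

theorem isAdmissible_eq {x y : E} (hx : x ∈ edgesOf st W) (hy : y ∈ edgesOf st W) :
    IsAdmissible st W fun c => c x = c y :=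
  ⟨fun _ σ h => congrArg σ h, fun c c' hcc h => by rw [← hcc hx, ← hcc hy, h]⟩

theorem SharingStep.symm (h : SharingStep st W r S T c c') : SharingStep st W r S T c' c :=
  ⟨h.2.1, h.1, h.2.2.1.symm, h.2.2.2.imp fun _ hs => ⟨hs.1, hs.2.symm⟩⟩

theorem sharing_symm (h : Relation.ReflTransGen (SharingStep st W r S T) c c') :
    Relation.ReflTransGen (SharingStep st W r S T) c' c :=
  reflTransGen_symm (fun _ _ => SharingStep.symm) h

theorem sharing_end (h : Relation.ReflTransGen (SharingStep st W r S T) c c')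
    (hc : Proper st W c ∧ T c) : (Proper st W c' ∧ T c') ∧ Set.EqOn c c' (st r) := by
  induction h with
  | refl => exact ⟨hc, Set.eqOn_refl _ _⟩
  | tail _ h ih => exact ⟨h.2.1, ih.2.trans h.2.2.1⟩

theorem glue_self : glue st W c c = c := by
  funext x; simp [glue]

theorem IsCubicStar.exists_perm_share (hs : IsCubicStar G st) {v : V} (hd : Set.InjOn d (st v))
    (hd' : Set.InjOn d' (st v)) (h : Share (st v) s d d') :
    ∃ σ : Equiv.Perm (Fin 3), (∀ x ∈ st v, σ (d x) = d' x) ∧ σ s = s := by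
  obtain ⟨σ, hσ⟩ := hs.exists_perm hd hd'
  obtain ⟨f, hf, rfl⟩ := hs.exists_color hd s
  exact ⟨σ, hσ, by rw [hσ f hf]; exact (h f hf).1 rfl⟩

theorem Share.perm (h : Share A s c c') (σ : Equiv.Perm (Fin 3)) :
    Share A (σ s) (σ ∘ c) (σ ∘ c') := fun x hx => by
  simpa using h x hx

theorem edgesOf_subset {v : V} (hv : v ∈ W) : st v ⊆ edgesOf st W := fun _ hx => ⟨v, hv, hx⟩

/-- Each step on one side changes the star of `w` by a permutation that fixes the shared colour.
Applying the same permutation to the colouring of the other side keeps the two sides compatible and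
the class shared. -/
theorem VertexAmalgam.lift_path (hs : IsCubicStar G st) (h : VertexAmalgam G W Wa Wb w)
    (hr : r ∈ Wa) (hT : IsAdmissible st Wa T)
    (hp : Relation.ReflTransGen (SharingStep st Wa r S T) d d') :
    ∃ σ : Equiv.Perm (Fin 3), (∀ x ∈ st w, σ (d x) = d' x) ∧ ∀ b, Proper st Wb b →
      Set.EqOn d b (st w) → Relation.ReflTransGen (SharingStep st W r S T) (glue st Wa d b)
        (glue st Wa d' (σ ∘ b)) := by
  induction hp with
  | refl => exact ⟨1, fun x _ => rfl, fun b _ _ => .refl⟩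
  | @tail d₁ d₂ hp hstep ih =>
    obtain ⟨σ, hσ, hlift⟩ := ih
    obtain ⟨⟨h1, t1⟩, ⟨h2, t2⟩, heq, s, hsS, hsh⟩ := hstep
    obtain ⟨τ, hτ, hτs⟩ := hs.exists_perm_share (h1 w h.mem_left) (h2 w h.mem_left)
      (hsh.mono (edgesOf_subset h.mem_left))
    refine ⟨τ * σ, fun x hx => by rw [Equiv.Perm.mul_apply, hσ x hx, hτ x hx], fun b hb hdb => ?_⟩
    refine (hlift b hb hdb).tail ?_
    have e1 : Set.EqOn d₁ (σ ∘ b) (st w) := fun x hx => by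
      rw [← hσ x hx, hdb hx]; rfl
    have e2 : Set.EqOn d₂ ((τ * σ : Equiv.Perm (Fin 3)) ∘ b) (st w) := fun x hx => by
      rw [← hτ x hx, e1 hx]; rfl
    refine ⟨⟨h.proper_glue hs h1 (hb.perm σ) e1, hT.congr _ _ glue_eqOn_left.symm t1⟩,
      ⟨h.proper_glue hs h2 (hb.perm _) e2, hT.congr _ _ glue_eqOn_left.symm t2⟩, fun x hx => ?_,
      s, hsS, h.share_glue hs e1 e2 hsh (share_comp_perm τ hτs)⟩
    rw [glue_eqOn_left (mem_edgesOf hr hx), glue_eqOn_left (mem_edgesOf hr hx), heq hx]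

/-- The side of the root is adjusted first, with the other side renamed along. Then the other side
is adjusted by steps that avoid the class of `f`. Such a step shares the class of some `t` at `w`,
which may be forbidden by `A`; in that case a detour to a colouring in which `t` differs in colour
from `A` makes it admissible. -/
theorem VertexAmalgam.sharingConnected (hs : IsCubicStar G st) (h : VertexAmalgam G W Wa Wb w)
    (hr : r ∈ Wa) (hA : A ⊆ st r) (hT : IsAdmissible st Wa T)
    (ha : SharingConnected st Wa r A T) {f : E} (hf : f ∈ st w)
    (hb : SharingConnected st Wb w {f} fun _ => True)
    (hgood : ∀ t ∈ st w, t ≠ f → ∃ a, Proper st Wa a ∧ T a ∧ ∀ x ∈ A, a x ≠ a t) :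
    SharingConnected st W r A T := by
  intro c c' hc hc' tc tc' hcc
  have hca := hc.mono h.subset_left
  have hca' := hc'.mono h.subset_left
  have hcb := hc.mono h.symm.subset_left
  have hcb' := hc'.mono h.symm.subset_left
  obtain ⟨σ, hσ, hlift⟩ := h.lift_path hs hr hT (ha c c' hca hca' tc tc' hcc)
  have h1 := hlift c hcb (Set.eqOn_refl _ _)
  rw [glue_self] at h1
  refine h1.trans ?_
  have e1 : Set.EqOn c' (σ ∘ c) (st w) := fun x hx => (hσ x hx).symm
  have hS : {s | ∀ x ∈ A, c x ≠ s} = {s | ∀ x ∈ A, c' x ≠ s} := by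
    ext s
    exact forall₂_congr fun x hx => by rw [hcc (hA hx)]
  have key : ∀ b, Relation.ReflTransGen
      (SharingStep st Wb w {s | ∀ x ∈ ({f} : Set E), (σ ∘ c) x ≠ s} fun _ => True) (σ ∘ c) b →
      Relation.ReflTransGen (SharingStep st W r {s | ∀ x ∈ A, c x ≠ s} T)
        (glue st Wa c' (σ ∘ c)) (glue st Wa c' b) := by
    intro b hp
    induction hp with
    | refl => exact .refl
    | @tail b₁ b₂ hp hstep ih =>
      refine ih.trans ?_
      have f1 : Set.EqOn c' b₁ (st w) := e1.trans (sharing_end hp ⟨hcb.perm σ, trivial⟩).2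
      obtain ⟨⟨hb1, -⟩, ⟨hb2, -⟩, heq, s, hsS, hsh⟩ := hstep
      have f2 : Set.EqOn c' b₂ (st w) := f1.trans heq
      obtain ⟨t, ht, rfl⟩ := hs.exists_color (hc' w (h.subset_left h.mem_left)) s
      have htf : t ≠ f := by
        rintro rfl
        exact hsS t rfl (e1 ht).symm
      -- The root side is moved to `a₀`, the step of the other side is carried out there, and the
      -- root side is moved back. Both moves induce the same permutation `ρ` on the other side.
      obtain ⟨a₀, ha₀, ta₀, hgd⟩ := hgood t ht htf
      obtain ⟨τ, hτ⟩ := hs.exists_perm (ha₀ r hr) (hca' r hr)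
      have hEq : Set.EqOn c' (τ ∘ a₀) (st r) := fun x hx => (hτ x hx).symm
      have hpath := ha c' (τ ∘ a₀) hca' (ha₀.perm τ) tc' (hT.perm _ τ ta₀) hEq
      rw [← hS] at hpath
      obtain ⟨ρ, hρ, hl⟩ := h.lift_path hs hr hT hpath
      refine (hl b₁ hb1 f1).trans (.trans (.single ?_) (sharing_symm (hl b₂ hb2 f2)))
      have g1 : Set.EqOn (τ ∘ a₀) (ρ ∘ b₁) (st w) := fun x hx => by
        rw [← hρ x hx, f1 hx]; rfl
      have g2 : Set.EqOn (τ ∘ a₀) (ρ ∘ b₂) (st w) := fun x hx => by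
        rw [← hρ x hx, f2 hx]; rfl
      refine ⟨⟨h.proper_glue hs (ha₀.perm τ) (hb1.perm ρ) g1,
        hT.congr _ _ glue_eqOn_left.symm (hT.perm _ τ ta₀)⟩,
        ⟨h.proper_glue hs (ha₀.perm τ) (hb2.perm ρ) g2,
        hT.congr _ _ glue_eqOn_left.symm (hT.perm _ τ ta₀)⟩, fun x hx => ?_, ρ (c' t), ?_,
        h.share_glue hs g1 g2 (.refl _ _ _) (hsh.perm ρ)⟩
      · rw [glue_eqOn_left (mem_edgesOf hr hx), glue_eqOn_left (mem_edgesOf hr hx)]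
      · intro x hx
        rw [hρ t ht, hcc (hA hx), hEq (hA hx)]
        exact τ.injective.ne (hgd x hx)
  have h2 := key c' (hb (σ ∘ c) c' (hcb.perm σ) hcb' trivial trivial e1.symm)
  rwa [glue_self] at h2

theorem Linked.perm (h : Linked n u) (σ : Equiv.Perm (Fin 3)) : Linked n (σ ∘ u) := by
  obtain ⟨v, hv, h0, h1, hl, hs⟩ := h
  exact ⟨σ ∘ v, hv.perm σ, congrArg σ h0, congrArg σ h1, σ.injective.ne hl,
    fun j hj => by simpa using hs j hj⟩

namespace EarEdges

variable (hE : EarEdges st W W₀ n q e h)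
include hE

/-- The colouring is renamed except at the three edges of the cycle that are incident with `W₀`
and belong to it. -/
theorem proper_flip [DecidableEq E] (hd : Proper st W₀ d) (hty : d (e 1) = d (e (n - 1))) :
    Proper st W₀ fun x => if x = e 0 ∨ x = e 1 ∨ x = e (n - 1) then d x else
      Equiv.swap (d (e 0)) (d (e 1)) (d x) := by
  have hn := hE.four_le
  intro v hv
  -- Since `e 1` and `e (n - 1)` have the same colour, the third edges at `q 0` and `q (n - 1)`
  -- carry the colour that the exchange fixes. So nothing changes at these two vertices.
  have hthird : ∀ j, (j = 0 ∨ j = n - 1) → Equiv.swap (d (e 0)) (d (e 1)) (d (h j)) = d (h j) := by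
    rintro j (rfl | rfl)
    · have h0 := hE.ne_of_injOn (by omega) (hd _ hE.mem_zero)
      rw [hE.third (by omega) (hd _ hE.mem_zero)]
      exact Equiv.swap_apply_of_ne_of_ne (thd_ne_left h0) (thd_ne_right h0)
    · have h0 := hE.ne_of_injOn (by omega) (hd _ hE.mem_last)
      rw [hE.third (by omega) (hd _ hE.mem_last), Nat.sub_add_cancel (by omega), hE.cyc, ← hty]
      rw [Nat.sub_add_cancel (by omega), hE.cyc, ← hty] at h0
      exact Equiv.swap_apply_of_ne_of_ne (thd_ne_right h0) (thd_ne_left h0)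
  have hfix : ∀ j, (j = 0 ∨ j = n - 1) → ∀ x ∈ st (q j),
      (if x = e 0 ∨ x = e 1 ∨ x = e (n - 1) then d x else
      Equiv.swap (d (e 0)) (d (e 1)) (d x)) = d x := by
    intro j hj x hx
    split_ifs with hxe
    · rfl
    push Not at hxe
    rw [hE.star j (by omega)] at hx
    rcases hx with rfl | rfl | rfl
    · rcases hj with rfl | rfl
      · exact absurd rfl hxe.1
      · exact absurd rfl hxe.2.2
    · rcases hj with rfl | rfl
      · exact absurd rfl hxe.2.1
      · rw [Nat.sub_add_cancel (by omega), hE.cyc] at hxe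
        exact absurd rfl hxe.1
    · exact hthird j hj
  by_cases h0 : v = q 0
  · subst h0
    exact (hd _ hv).congr fun x hx => (hfix 0 (Or.inl rfl) x hx).symm
  by_cases hl : v = q (n - 1)
  · subst hl
    exact (hd _ hv).congr fun x hx => (hfix (n - 1) (Or.inr rfl) x hx).symm
  refine ((hd.perm (Equiv.swap (d (e 0)) (d (e 1)))) v hv).congr fun x hx => ?_
  rw [if_neg]
  · rfl
  rintro (rfl | rfl | rfl)
  · exact (hE.star_zero v hv hx).elim h0 hl
  · exact h0 (hE.star_one v hv hx)
  · exact hl (hE.star_last v hv hx)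

theorem sharingStep_glue (hT : IsAdmissible st W₀ T) (hr : r ∈ W₀) (hd : Proper st W₀ d ∧ T d)
    (hd' : Proper st W₀ d' ∧ T d') (heq : Set.EqOn d d' (st r)) (hu : IsWord n u)
    (hud : WSame n u fun j => d (e j)) (hu' : IsWord n u') (hud' : WSame n u' fun j => d' (e j))
    (hs : s ∈ S) (hdd : Share (edgesOf st W₀) s d d') (huu : WShare n s u u') :
    SharingStep st W r S T (glue st W₀ d (cycleColoring n e h u))
      (glue st W₀ d' (cycleColoring n e h u')) := by
  refine ⟨⟨hE.proper_glue hd.1 hu hud, hT.congr _ _ glue_eqOn_left.symm hd.2⟩,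
    ⟨hE.proper_glue hd'.1 hu' hud', hT.congr _ _ glue_eqOn_left.symm hd'.2⟩, fun x hx => ?_,
    s, hs, hE.share_glue hd.1 hu hud hd'.1 hu' hud' hdd huu⟩
  rw [glue_eqOn_left (mem_edgesOf hr hx), glue_eqOn_left (mem_edgesOf hr hx), heq hx]

/-- The words over one colouring of `W₀` are connected. -/
theorem fibre_connected (hT : IsAdmissible st W₀ T) (hr : r ∈ W₀) (hd : Proper st W₀ d ∧ T d)
    {ε : Fin 3} (h1 : d (e 1) ≠ ε) (h2 : d (e (n - 1)) ≠ ε) (hS : ∀ s, s ≠ ε → s ∈ S)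
    (hu : IsWord n u) (hud : WSame n u fun j => d (e j)) (hu' : IsWord n u')
    (hud' : WSame n u' fun j => d (e j)) :
    Relation.ReflTransGen (SharingStep st W r S T) (glue st W₀ d (cycleColoring n e h u))
      (glue st W₀ d (cycleColoring n e h u')) := by
  have hp := hu.connected hE.four_le hu' (ε := ε)
    ⟨hud.1.trans hud'.1.symm, hud.2.1.trans hud'.2.1.symm, hud.2.2.trans hud'.2.2.symm⟩
    (by rwa [hud.2.1]) (by rwa [hud.2.2])
  clear hud'
  induction hp with
  | refl => exact .refl
  | @tail v v' hp hstep ih =>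
    have hvd : WSame n v fun j => d (e j) := by
      clear ih hstep
      induction hp with
      | refl => exact hud
      | tail _ hs ih =>
        have := ih
        exact ⟨hs.2.2.1.1.symm.trans this.1, hs.2.2.1.2.1.symm.trans this.2.1,
          hs.2.2.1.2.2.symm.trans this.2.2⟩
    obtain ⟨hv, hv', hvv, s, hs, hsh⟩ := hstep
    refine (ih hv).tail (hE.sharingStep_glue hT hr hd hd (Set.eqOn_refl _ _) hv hvd hv'
      ⟨hvv.1.symm.trans hvd.1, hvv.2.1.symm.trans hvd.2.1, hvv.2.2.symm.trans hvd.2.2⟩ (hS s hs)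
      (.refl _ _ _) hsh)

end EarEdges

end Connectivity

/-! ### Sharing steps over an ear -/

section Connectivity

variable {V E : Type*} {G : SimpleGraph V} {st : V → Set E} {W W₀ Wa Wb : Set V} {s : Fin 3}
  {c c' d d' : E → Fin 3} {n : ℕ} {q : ℕ → V} {e h : ℕ → E} {u u' : ℕ → Fin 3} {r w : V}
  {A : Set E} {S S' : Set (Fin 3)} {T : (E → Fin 3) → Prop}

namespace EarEdges

variable (hE : EarEdges st W W₀ n q e h)
include hE

/-- If the shared colour is on neither `e 0` nor `e 1`, it is the third colour at `q 0` in both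
colourings, and it is fixed as well. -/
theorem share_perm (hd : Proper st W₀ d) (hd' : Proper st W₀ d')
    (hdd : Share (edgesOf st W₀) s d d') :
    ∃ τ : Equiv.Perm (Fin 3), τ s = s ∧ τ (d (e 0)) = d' (e 0) ∧ τ (d (e 1)) = d' (e 1) := by
  have h1 := hE.e_zero_ne_one hd
  have h1' := hE.e_zero_ne_one hd'
  have s0 := hdd _ (mem_edgesOf hE.mem_zero hE.e_zero_mem)
  have s1 := hdd _ (mem_edgesOf hE.mem_zero hE.e_one_mem)
  obtain ⟨τ, t0, t1⟩ := exists_perm_of_ne h1 h1'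
  refine ⟨τ, ?_, t0, t1⟩
  rcases eq_or_eq_or_eq_thd h1 s with rfl | rfl | rfl
  · rw [t0]; exact s0.1 rfl
  · rw [t1]; exact s1.1 rfl
  · rw [← thd_perm τ h1, t0, t1]
    exact (eq_thd h1' (fun h' => (thd_ne_left h1) (s0.2 h'.symm).symm)
      (fun h' => (thd_ne_right h1) (s1.2 h'.symm).symm)).symm

/-- Colourings of different types can share only the class of the edge `e 0`. -/
theorem eq_of_share_of_type (hd' : Proper st W₀ d')
    (hdd : Share (edgesOf st W₀) s d d') (hty : d (e 1) = d (e (n - 1)))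
    (hty' : d' (e 1) ≠ d' (e (n - 1))) : d (e 0) = s ∧ d' (e 0) = s := by
  have s0 := hdd _ (mem_edgesOf hE.mem_zero hE.e_zero_mem)
  have s1 := hdd _ (mem_edgesOf hE.mem_zero hE.e_one_mem)
  have sl := hdd _ (mem_edgesOf hE.mem_last hE.e_last_mem)
  have h1' := hE.e_zero_ne_one hd'
  have hl' := hE.e_zero_ne_last hd'
  have n1 : d' (e 1) ≠ s := fun h' => hty' (h'.trans (sl.1 (hty ▸ s1.2 h')).symm)
  have nl : d' (e (n - 1)) ≠ s := fun h' => n1 (s1.1 (hty.trans (sl.2 h')))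
  have h0 : d' (e 0) = s := by
    rw [eq_thd hty' h1' hl']
    exact (eq_thd hty' n1.symm nl.symm).symm
  exact ⟨s0.2 h0, h0⟩

/-- Steps between colourings of `W₀` lift to steps between colourings with linked words. -/
theorem exists_lift (hT : IsAdmissible st W₀ T) (hr : r ∈ W₀)
    (hstep : SharingStep st W₀ r S T d d') (hu : IsWord n u)
    (hud : WSame n u fun j => d (e j)) (hL : Linked n u) :
    ∃ u', IsWord n u' ∧ (WSame n u' fun j => d' (e j)) ∧ Linked n u' ∧
      SharingStep st W r S T (glue st W₀ d (cycleColoring n e h u))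
        (glue st W₀ d' (cycleColoring n e h u')) := by
  have hn := hE.four_le
  obtain ⟨hd, hd', heq, s, hsS, hdd⟩ := hstep
  obtain ⟨τ, τs, t0, t1⟩ := hE.share_perm hd.1 hd'.1 hdd
  have h1 := hE.e_zero_ne_one hd.1
  have hl := hE.e_zero_ne_last hd.1
  have h1' := hE.e_zero_ne_one hd'.1
  have hl' := hE.e_zero_ne_last hd'.1
  have hsame : ∀ v, v 0 = u 0 → v 1 = u 1 → (v (n - 1) = u 1 ↔ d' (e 1) = d' (e (n - 1))) →
      v (n - 1) ≠ u 0 → WSame n (τ ∘ v) fun j => d' (e j) := by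
    intro v v0 v1 hty hv0
    refine ⟨?_, ?_, ?_⟩
    · change τ (v 0) = d' (e 0)
      rw [v0, hud.1, t0]
    · change τ (v 1) = d' (e 1)
      rw [v1, hud.2.1, t1]
    · change τ (v (n - 1)) = d' (e (n - 1))
      by_cases hA : v (n - 1) = u 1
      · rw [hA, hud.2.1, t1]; exact hty.1 hA
      · have h01 : u 0 ≠ u 1 := by rw [hud.1, hud.2.1]; exact h1
        rw [eq_thd h01 hv0 hA, ← thd_perm τ h01, hud.1, hud.2.1, t0, t1]
        exact (eq_thd h1' hl'.symm (fun h' => hA (hty.2 h'.symm))).symm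
  have huty : u (n - 1) = u 1 ↔ d (e 1) = d (e (n - 1)) := by
    rw [hud.2.1, hud.2.2]; exact eq_comm
  -- If the type is kept, renaming the word is enough. If it changes, the shared class is that of `e
  -- 0`, and the word is first replaced by its linked partner, which has the other type and the same
  -- positions of this letter.
  by_cases hty : d (e 1) = d (e (n - 1)) ↔ d' (e 1) = d' (e (n - 1))
  · have hw := hsame u rfl rfl (huty.trans hty) (by rw [hud.1, hud.2.2]; exact hl.symm)
    exact ⟨τ ∘ u, hu.perm τ, hw, hL.perm τ, hE.sharingStep_glue hT hr hd hd' heq hu hud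
      (hu.perm τ) hw hsS hdd fun j _ => share_comp_perm (D := Set.univ) (c := u) τ τs j trivial⟩
  · obtain ⟨v, hv, v0, v1, vl, hvs⟩ := hL
    have hs0 : d (e 0) = s := by
      by_cases hA : d (e 1) = d (e (n - 1))
      · exact (hE.eq_of_share_of_type hd'.1 hdd hA fun h' => hty ⟨fun _ => h', fun _ => hA⟩).1
      · have hA' : d' (e 1) = d' (e (n - 1)) := by
          by_contra hA'
          exact hty ⟨fun h' => absurd h' hA, fun h' => absurd h' hA'⟩
        exact (hE.eq_of_share_of_type hd.1 hdd.symm hA' hA).2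
    have hvl0 : v (n - 1) ≠ u 0 := by rw [← v0]; exact hv.ne_last hn
    have h01 : u 0 ≠ u 1 := by rw [hud.1, hud.2.1]; exact h1
    have hw := hsame v v0 v1 (by
      rw [← not_iff.1 hty, ← huty]
      constructor
      · intro h' h''
        exact vl (h'.trans h''.symm)
      · intro h'
        rcases eq_or_eq_or_eq_thd h01 (v (n - 1)) with h'' | h'' | h''
        · exact absurd h'' hvl0
        · exact h''
        · exact absurd (h''.trans (eq_thd h01 (hu.ne_last hn) h').symm) vl) hvl0
    have huv : WShare n s u (τ ∘ v) := by
      intro j hj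
      rw [← hs0, show d (e 0) = u 0 from hud.1.symm, hvs j hj]
      have h0 : s = u 0 := by rw [← hs0]; exact hud.1.symm
      rw [← h0]
      exact share_comp_perm (D := Set.univ) (c := v) τ τs j trivial
    exact ⟨τ ∘ v, hv.perm τ, hw, .perm ⟨u, hu, v0.symm, v1.symm, vl.symm, by
      rw [v0]; exact hvs.symm⟩ τ, hE.sharingStep_glue hT hr hd hd' heq hu hud
      (hv.perm τ) hw hsS hdd huv⟩

theorem lift_path (hT : IsAdmissible st W₀ T) (hr : r ∈ W₀)
    (hp : Relation.ReflTransGen (SharingStep st W₀ r S T) d d') (hu : IsWord n u)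
    (hud : WSame n u fun j => d (e j)) (hL : Linked n u) :
    ∃ u', IsWord n u' ∧ (WSame n u' fun j => d' (e j)) ∧ Linked n u' ∧
      Relation.ReflTransGen (SharingStep st W r S T) (glue st W₀ d (cycleColoring n e h u))
        (glue st W₀ d' (cycleColoring n e h u')) := by
  induction hp with
  | refl => exact ⟨u, hu, hud, hL, .refl⟩
  | tail _ hstep ih =>
    obtain ⟨v, hv, hvd, hvL, hpath⟩ := ih
    obtain ⟨v', hv', hvd', hvL', hstep'⟩ := hE.exists_lift hT hr hstep hv hvd hvL
    exact ⟨v', hv', hvd', hvL', hpath.tail hstep'⟩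

/-- The colourings of an ear amalgam are connected if those of `W₀` and the fibres are. -/
theorem sharingConnected_of_fibres (hT : IsAdmissible st W₀ T) (hr : r ∈ W₀)
    (hA : A ⊆ st r) (hAr : ∃ x ∈ st r, x ∉ A) (h₀ : SharingConnected st W₀ r A T)
    (hfib : ∀ d u u', Proper st W₀ d → T d → IsWord n u → IsWord n u' →
      (WSame n u fun j => d (e j)) → (WSame n u' fun j => d (e j)) →
      Relation.ReflTransGen (SharingStep st W r {s | ∀ x ∈ A, d x ≠ s} T)
        (glue st W₀ d (cycleColoring n e h u)) (glue st W₀ d (cycleColoring n e h u'))) :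
    SharingConnected st W r A T := by
  intro c c' hc hc' tc tc' hcc
  have hS : {s | ∀ x ∈ A, c x ≠ s} = {s | ∀ x ∈ A, c' x ≠ s} := by
    ext s
    exact forall₂_congr fun x hx => by rw [hcc (hA hx)]
  have hd := hE.proper_left hc
  have hd' := hE.proper_left hc'
  have hw := hE.isWord (hE.proper_cycle hc)
  have hw' := hE.isWord (hE.proper_cycle hc')
  have step : ∀ b, Proper st W b → T b → (∀ x ∈ A, b x = c x) →
      SharingStep st W r {s | ∀ x ∈ A, c x ≠ s} T b
        (glue st W₀ b (cycleColoring n e h fun j => b (e j))) := by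
    intro b hb tb hbc
    have hb0 := hE.proper_left hb
    have hbw := hE.isWord (hE.proper_cycle hb)
    obtain ⟨x, hxr, hx⟩ := hAr
    have hs : ∀ y ∈ A, c y ≠ c x := fun y hy =>
      hc.ne (hE.subset hr) (hA hy) hxr fun h' => hx (h' ▸ hy)
    exact ⟨⟨hb, tb⟩, ⟨hE.proper_glue hb0 hbw ⟨rfl, rfl, rfl⟩,
      hT.congr _ _ glue_eqOn_left.symm tb⟩, fun x hx =>
      hE.eqOn_glue hb (mem_edgesOf (hE.subset hr) hx), c x, hs, .of_eqOn (hE.eqOn_glue hb)⟩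
  -- The path in the old part is lifted starting from a linked word. The words of `c` and `c'`
  -- themselves are connected to the ends of the lifted path inside the fibres.
  obtain ⟨v, hv, hvd, hvL⟩ := hE.exists_extension hd
  obtain ⟨v', hv', hvd', -, hpath⟩ := hE.lift_path hT hr (h₀ c c' hd hd' tc tc' hcc) hv hvd hvL
  refine .head (step c hc tc fun _ _ => rfl) (.trans (hfib c _ v hd tc hw hv ⟨rfl, rfl, rfl⟩ hvd)
    (hpath.trans (.tail ?_ (step c' hc' tc' fun x hx => (hcc (hA hx)).symm).symm)))
  rw [hS]
  exact hfib c' _ _ hd' tc' hv' hw' hvd' ⟨rfl, rfl, rfl⟩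

/-- The fibre over a colouring with equal colours at the ends of the cycle is connected by steps
that avoid an edge outside the cycle. -/
theorem fibre_connected_of_eq (hr : r ∈ W₀) {a : E} (ha : a ∈ st r)
    (ha1 : a ≠ e 1) (hal : a ≠ e (n - 1)) (hd : Proper st W₀ d) (hty : d (e 1) = d (e (n - 1)))
    (hu : IsWord n u) (hu' : IsWord n u') (hud : WSame n u fun j => d (e j))
    (hud' : WSame n u' fun j => d (e j)) :
    Relation.ReflTransGen (SharingStep st W r {s | ∀ x ∈ ({a} : Set E), d x ≠ s} fun _ => True)
      (glue st W₀ d (cycleColoring n e h u)) (glue st W₀ d (cycleColoring n e h u')) := by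
  classical
  have hn := hE.four_le
  -- The words are connected by steps that avoid a letter which is neither at `1` nor at `n - 1`.
  -- This settles the case in which `a` has another colour than `e 1`.
  by_cases hε : d (e 1) = d a
  swap
  · refine hE.fibre_connected isAdmissible_true hr ⟨hd, trivial⟩ (ε := d a) hε (by rwa [← hty])
      (fun s hs x hx => ?_) hu hud hu' hud'
    rw [Set.mem_singleton_iff.1 hx]; exact hs.symm
  have h01 := hE.e_zero_ne_one hd
  have hr0 : r ≠ q 0 := by
    rintro rfl
    exact hd.ne hr ha hE.e_one_mem ha1 hε.symm
  have hrl : r ≠ q (n - 1) := by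
    rintro rfl
    exact hd.ne hr ha hE.e_last_mem hal (hε.symm.trans hty)
  -- Flip and renaming together exchange two colours on `e 0`, `e 1` and `e (n - 1)` only. As `r` is
  -- neither `q 0` nor `q (n - 1)`, nothing changes at `r`, while `e 1` no longer has the colour of
  -- `a`. The third class is shared.
  set σ := Equiv.swap (d (e 0)) (d (e 1)) with hσ
  set fl : E → Fin 3 := fun x => if x = e 0 ∨ x = e 1 ∨ x = e (n - 1) then d x else σ (d x)
    with hfl
  have hflip : Proper st W₀ (σ ∘ fl) := (hE.proper_flip hd hty).perm σ
  have hon : ∀ x, (x = e 0 ∨ x = e 1 ∨ x = e (n - 1)) → (σ ∘ fl) x = σ (d x) := fun x hx => by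
    simp only [Function.comp, hfl, if_pos hx]
  have hoff : ∀ x, ¬(x = e 0 ∨ x = e 1 ∨ x = e (n - 1)) → (σ ∘ fl) x = d x := fun x hx => by
    simp only [Function.comp, hfl, if_neg hx]
    exact Equiv.swap_apply_self _ _ _
  have f0 := hon (e 0) (by simp)
  have f1 := hon (e 1) (by simp)
  have fl' := hon (e (n - 1)) (by simp)
  have hEq : Set.EqOn d (σ ∘ fl) (st r) := by
    intro x hx
    refine (hoff x ?_).symm
    rintro (rfl | rfl | rfl)
    · exact (hE.star_zero r hr hx).elim hr0 hrl
    · exact hr0 (hE.star_one r hr hx)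
    · exact hrl (hE.star_last r hr hx)
  have hτs : σ (thd (d (e 0)) (d (e 1))) = thd (d (e 0)) (d (e 1)) :=
    Equiv.swap_apply_of_ne_of_ne (thd_ne_left h01) (thd_ne_right h01)
  have hsh : Share (edgesOf st W₀) (thd (d (e 0)) (d (e 1))) d (σ ∘ fl) := by
    intro x _
    by_cases hx : x = e 0 ∨ x = e 1 ∨ x = e (n - 1)
    · rw [hon x hx]
      exact share_comp_perm (D := Set.univ) (c := d) σ hτs x trivial
    · rw [hoff x hx]
  have hsame : ∀ {v}, (WSame n v fun j => d (e j)) → WSame n (σ ∘ v) fun j => (σ ∘ fl) (e j) := by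
    intro v hv
    refine ⟨?_, ?_, ?_⟩
    · exact (congrArg σ hv.1).trans f0.symm
    · exact (congrArg σ hv.2.1).trans f1.symm
    · exact (congrArg σ hv.2.2).trans fl'.symm
  have hstep : ∀ {v}, IsWord n v → (WSame n v fun j => d (e j)) → SharingStep st W r
      {s | ∀ x ∈ ({a} : Set E), d x ≠ s} (fun _ => True) (glue st W₀ d (cycleColoring n e h v))
      (glue st W₀ (σ ∘ fl) (cycleColoring n e h (σ ∘ v))) := by
    intro v hv hvd
    refine hE.sharingStep_glue isAdmissible_true hr ⟨hd, trivial⟩ ⟨hflip, trivial⟩ hEq hv hvd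
      (hv.perm σ) (hsame hvd) ?_ hsh fun j _ =>
        share_comp_perm (D := Set.univ) (c := v) σ hτs j trivial
    intro x hx
    rw [Set.mem_singleton_iff.1 hx, ← hε]
    exact (thd_ne_right h01).symm
  refine .head (hstep hu hud) (.tail ?_ (hstep hu' hud').symm)
  have hσ1 : σ (d (e 1)) = d (e 0) := Equiv.swap_apply_right _ _
  refine hE.fibre_connected isAdmissible_true hr ⟨hflip, trivial⟩ (ε := d a) ?_ ?_
    (fun s hs x hx => ?_) (hu.perm σ) (hsame hud) (hu'.perm σ) (hsame hud')
  · rw [f1, hσ1, ← hε]; exact h01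
  · rw [fl', ← hty, hσ1, ← hε]; exact h01
  · rw [Set.mem_singleton_iff.1 hx]; exact hs.symm

/-- Connectedness under steps that avoid an edge outside the cycle. -/
theorem sharingConnected_singleton (hs : IsCubicStar G st) (hr : r ∈ W₀) {a : E} (ha : a ∈ st r)
    (ha1 : a ≠ e 1) (hal : a ≠ e (n - 1))
    (hty : BothTypes st W₀ (q 0) (q (n - 1)))
    (h₀ : SharingConnected st W₀ r {a} fun _ => True) :
    SharingConnected st W r {a} fun _ => True := by
  have hn := hE.four_le
  obtain ⟨f, g, haf, -, -, hst⟩ := hs.exists_enum ha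
  refine hE.sharingConnected_of_fibres isAdmissible_true hr (by simpa using ha)
    ⟨f, by simp [hst], by simpa using haf.symm⟩ h₀ ?_
  intro d u u' hd _ hu hu' hud hud'
  by_cases hA : d (e 1) = d (e (n - 1))
  · exact hE.fibre_connected_of_eq hr ha ha1 hal hd hA hu hu' hud hud'
  have hx : e 1 ≠ e 0 := fun h' => by have := hE.e_inj _ (by omega) _ (by omega) h'; omega
  have hy : e (n - 1) ≠ e 0 := fun h' => by have := hE.e_inj _ (by omega) _ (by omega) h'; omega
  obtain ⟨⟨b, hb, hbt⟩, -⟩ := hty (e 0) (e 1) (e (n - 1)) hE.e_zero_mem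
    hE.e_zero_mem_last hE.e_one_mem hx hE.e_last_mem hy
  obtain ⟨σ, hσ⟩ := hs.exists_perm (hb r hr) (hd r hr)
  have hpath := h₀ d (σ ∘ b) hd (hb.perm σ) trivial trivial fun x hx => (hσ x hx).symm
  -- Linked words can follow a path in the old part to a colouring of the equal type, where the
  -- fibre is known to be connected, and come back.
  have linked : ∀ u u', IsWord n u → IsWord n u' → (WSame n u fun j => d (e j)) →
      (WSame n u' fun j => d (e j)) → Linked n u → Linked n u' →
      Relation.ReflTransGen (SharingStep st W r {s | ∀ x ∈ ({a} : Set E), d x ≠ s} fun _ => True)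
        (glue st W₀ d (cycleColoring n e h u)) (glue st W₀ d (cycleColoring n e h u')) := by
    intro u u' hu hu' hud hud' hL hL'
    obtain ⟨v, hv, hvb, -, hp⟩ := hE.lift_path isAdmissible_true hr hpath hu hud hL
    obtain ⟨v', hv', hvb', -, hp'⟩ := hE.lift_path isAdmissible_true hr hpath hu' hud' hL'
    refine hp.trans (.trans ?_ (sharing_symm hp'))
    have := hE.fibre_connected_of_eq hr ha ha1 hal (hb.perm σ) (congrArg σ hbt) hv hv' hvb hvb'
    have hSe : {s | ∀ x ∈ ({a} : Set E), (σ ∘ b) x ≠ s} = {s | ∀ x ∈ ({a} : Set E), d x ≠ s} := by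
      ext s
      simp only [Set.mem_singleton_iff, forall_eq, Set.mem_ofPred_eq, Function.comp, hσ a ha]
    rwa [hSe] at this
  -- A word that is not linked shares the letter at `1` with one linked word and the letter at `n -
  -- 1` with another. At least one of these letters is not the colour of `a`.
  have tolinked : ∀ u, IsWord n u → (WSame n u fun j => d (e j)) → ∃ v, IsWord n v ∧
      (WSame n v fun j => d (e j)) ∧ Linked n v ∧
      Relation.ReflTransGen (SharingStep st W r {s | ∀ x ∈ ({a} : Set E), d x ≠ s} fun _ => True)
        (glue st W₀ d (cycleColoring n e h u)) (glue st W₀ d (cycleColoring n e h v)) := by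
    intro u hu hud
    have step : ∀ s, s ≠ d a → (∃ v, IsWord n v ∧ Linked n v ∧ WSame n u v ∧ WShare n s u v) →
        ∃ v, IsWord n v ∧ (WSame n v fun j => d (e j)) ∧ Linked n v ∧
        Relation.ReflTransGen (SharingStep st W r {s | ∀ x ∈ ({a} : Set E), d x ≠ s} fun _ => True)
        (glue st W₀ d (cycleColoring n e h u)) (glue st W₀ d (cycleColoring n e h v)) := by
      rintro s hs ⟨v, hv, hL, huv, hsh⟩
      have hvd : WSame n v fun j => d (e j) :=
        ⟨huv.1.symm.trans hud.1, huv.2.1.symm.trans hud.2.1, huv.2.2.symm.trans hud.2.2⟩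
      refine ⟨v, hv, hvd, hL, .single (hE.sharingStep_glue isAdmissible_true hr ⟨hd, trivial⟩
        ⟨hd, trivial⟩ (Set.eqOn_refl _ _) hu hud hv hvd (s := s) ?_ (.refl _ _ _) hsh)⟩
      intro x hx
      rw [Set.mem_singleton_iff.1 hx]; exact hs.symm
    have hne : u 1 ≠ u (n - 1) := by rw [hud.2.1, hud.2.2]; exact hA
    rcases hu.linked_or hn hne with hL | ⟨h1, h2⟩
    · exact ⟨u, hu, hud, hL, .refl⟩
    · by_cases h1a : u 1 = d a
      · exact step _ (by rw [← h1a]; exact hne.symm) h2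
      · exact step _ h1a h1
  obtain ⟨v, hv, hvd, hL, hp⟩ := tolinked u hu hud
  obtain ⟨v', hv', hvd', hL', hp'⟩ := tolinked u' hu' hud'
  exact hp.trans ((linked v v' hv hv' hvd hvd' hL hL').trans (sharing_symm hp'))

/-- Connectedness under arbitrary steps. -/
theorem sharingConnected_empty (hs : IsCubicStar G st) (hT : IsAdmissible st W₀ T) (hr : r ∈ W₀)
    (h₀ : SharingConnected st W₀ r ∅ T) : SharingConnected st W r ∅ T := by
  obtain ⟨x, hx⟩ := hs.nonempty r
  refine hE.sharingConnected_of_fibres hT hr (Set.empty_subset _) ⟨x, hx, by simp⟩ h₀ ?_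
  intro d u u' hd td hu hu' hud hud'
  exact hE.fibre_connected hT hr ⟨hd, td⟩ (hE.e_zero_ne_one hd).symm (hE.e_zero_ne_last hd).symm
    (fun s _ x hx => absurd hx (by simp)) hu hud hu' hud'

end EarEdges

end Connectivity

/-! ### Connectedness of the colourings that agree at a root -/

section Connectivity

variable {V E : Type*} {G : SimpleGraph V} {st : V → Set E} {W W₀ Wa Wb : Set V} {s : Fin 3}
  {c c' d d' : E → Fin 3} {n : ℕ} {q : ℕ → V} {e h : ℕ → E} {r w : V}

theorem VertexAmalgam.exists_left_edge (hs : IsCubicStar G st) (h : VertexAmalgam G W Wa Wb w) :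
    ∃ f ∈ st w, ∀ v ∈ Wb, f ∈ st v → v = w := by
  obtain ⟨a, ha, hwa⟩ := h.adj_left
  obtain ⟨f, hf, hf'⟩ := (hs.adj_iff w a hwa.ne).2 hwa
  refine ⟨f, hf, fun v hv hfv => ?_⟩
  rcases hs.two f v w a hfv hf hf' with h' | h' | h'
  · exact h'
  · exact absurd h' hwa.ne
  · have : a ∈ Wa ∩ Wb := ⟨ha, h' ▸ hv⟩
    rw [h.inter] at this
    exact absurd (Set.mem_singleton_iff.1 this).symm hwa.ne

theorem EarEdges.ne_of_half (hE : EarEdges st W W₀ n q e h) {a : E}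
    (ha : ∀ v ∈ W, a ∈ st v → v = r) :
    a ≠ e 0 ∧ a ≠ e 1 ∧ a ≠ e (n - 1) := by
  have hn := hE.four_le
  have hC : ∀ j < n, q j ∈ W := fun j hj => by
    rw [hE.union]; exact Or.inr (Set.mem_image_of_mem q hj)
  have key : ∀ i, i < n → ∀ j, j < n → i ≠ j → a ∈ st (q i) → a ∈ st (q j) → q i = q j :=
    fun i hi j hj _ h1 h2 => (ha _ (hC i hi) h1).trans (ha _ (hC j hj) h2).symm
  have hq0 : q 0 ≠ q 1 := fun h' => hE.e_ne_h 1 (by omega) 0 (by omega) (by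
    have := hE.star 0 (by omega)
    rw [h', hE.star 1 (by omega)] at this
    have hmem : e 2 ∈ ({e 0, e 1, h 0} : Set E) := by rw [← this]; simp
    rcases hmem with h2 | h2 | h2
    · have := hE.e_inj 2 (by omega) 0 (by omega) h2; omega
    · have := hE.e_inj 2 (by omega) 1 (by omega) h2; omega
    · exact absurd h2 (hE.e_ne_h 2 (by omega) 0 (by omega)))
  refine ⟨?_, ?_, ?_⟩
  · rintro rfl
    exact hE.ne (key 0 (by omega) (n - 1) (by omega) (by omega) hE.e_zero_mem hE.e_zero_mem_last)
  · rintro rfl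
    exact hq0 (key 0 (by omega) 1 (by omega) (by omega) hE.e_one_mem (hE.e_mem (by omega)))
  · rintro rfl
    have h1 := key (n - 2) (by omega) (n - 1) (by omega) (by omega)
      (by have := hE.e_succ_mem (j := n - 2) (by omega)
          rwa [show n - 2 + 1 = n - 1 by omega] at this) hE.e_last_mem
    have hst := hE.star (n - 1) (by omega)
    rw [← h1, hE.star (n - 2) (by omega)] at hst
    have hmem : e (n - 2) ∈ ({e (n - 1), e (n - 1 + 1), h (n - 1)} : Set E) := by
      rw [← hst]; simp
    rcases hmem with h2 | h2 | h2
    · have := hE.e_inj _ (by omega) _ (by omega) h2; omega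
    · rw [Nat.sub_add_cancel (by omega), hE.cyc] at h2
      have := hE.e_inj _ (by omega) _ (by omega) h2; omega
    · exact hE.e_ne_h _ (by omega) _ (by omega) h2

/-- The flip: the colours `d (e 0)` and `d (e 1)` are exchanged off the cycle. -/
theorem EarEdges.exists_flip [DecidableEq E] (hE : EarEdges st W W₀ n q e h) (hd : Proper st W₀ d)
    (hty : d (e 1) = d (e (n - 1))) : ∃ f, Proper st W₀ f ∧ f (e 1) = f (e (n - 1)) ∧
      Set.EqOn d f (st (q 0)) ∧ Share (edgesOf st W₀) (thd (d (e 0)) (d (e 1))) d f ∧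
      ∀ x, f x = if x = e 0 ∨ x = e 1 ∨ x = e (n - 1) then d x else
        Equiv.swap (d (e 0)) (d (e 1)) (d x) := by
  have hn := hE.four_le
  have h01 := hE.e_zero_ne_one hd
  have hτs : Equiv.swap (d (e 0)) (d (e 1)) (thd (d (e 0)) (d (e 1))) = thd (d (e 0)) (d (e 1)) :=
    Equiv.swap_apply_of_ne_of_ne (thd_ne_left h01) (thd_ne_right h01)
  refine ⟨fun x => if x = e 0 ∨ x = e 1 ∨ x = e (n - 1) then d x else
        Equiv.swap (d (e 0)) (d (e 1)) (d x), hE.proper_flip hd hty, by simp [hty], fun x hx => ?_,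
        fun x _ => ?_, fun _ => rfl⟩
  · beta_reduce
    split_ifs with hxe
    · rfl
    rw [hE.star 0 (by omega)] at hx
    rcases hx with rfl | rfl | rfl
    · exact absurd (Or.inl rfl) hxe
    · exact absurd (Or.inr (Or.inl rfl)) hxe
    · rw [hE.third (by omega) (hd _ hE.mem_zero)]
      exact hτs.symm
  · beta_reduce
    split_ifs with hxe
    · rfl
    · exact share_comp_perm (D := Set.univ) (c := d) _ hτs x trivial

variable [Finite V]

/-- Induction over the decompositions with the root kept in the old part. At a cut vertex away from
`a`, the detours use colourings that separate `a` from the relevant edge; this is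
`NoK23Minor.exists_separate`. -/
theorem NoK23Minor.sharingConnected (hG : NoK23Minor G) (hT : G.CliqueFree 3)
    (hs : IsCubicStar G st) (hW : ConnIn G W) (hr : r ∈ W) {a : E} (ha : a ∈ st r)
    (hhalf : ∀ v ∈ W, a ∈ st v → v = r) : SharingConnected st W r {a} fun _ => True := by
  refine hG.induction hT (P := fun W r _ => ∀ a ∈ st r, (∀ v ∈ W, a ∈ st v → v = r) →
    SharingConnected st W r {a} fun _ => True) ?_ ?_ ?_ ?_ W hW r hr r hr (Or.inl rfl) a ha hhalf
  · intro r a ha _ c c' hc hc' _ _ hcc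
    obtain ⟨f, g, haf, -, -, hst⟩ := hs.exists_enum ha
    have hf : f ∈ st r := by simp [hst]
    refine .single ⟨⟨hc, trivial⟩, ⟨hc', trivial⟩, hcc, c f, ?_, .of_eqOn ?_⟩
    · intro x hx
      rw [Set.mem_singleton_iff.1 hx]
      exact hc.ne rfl ha hf haf
    · rintro x ⟨v, hv, hx⟩
      rw [Set.mem_singleton_iff.1 hv] at hx
      exact hcc hx
  · intro r v hrv
    refine (and_self_iff).2 fun a ha hh c c' hc hc' _ _ hcc => ?_
    obtain ⟨κ, hκ, hκ'⟩ := (hs.adj_iff r v hrv.ne).2 hrv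
    have hκa : a ≠ κ := by
      rintro rfl
      exact hrv.ne (hh v (by simp) hκ').symm
    refine .single ⟨⟨hc, trivial⟩, ⟨hc', trivial⟩, hcc, c κ, ?_, ?_⟩
    · intro x hx
      rw [Set.mem_singleton_iff.1 hx]
      exact hc.ne (by simp) ha hκ hκa
    · rintro x ⟨w, rfl | hw, hx⟩
      · rw [hcc hx]
      · rw [Set.mem_singleton_iff.1 hw] at hx
        constructor
        · intro h'
          rw [hc v (by simp) hx hκ' h', ← hcc hκ]
        · intro h'
          rw [hcc hκ] at h'
          rw [hc' v (by simp) hx hκ' h']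
  · intro W Wa Wb u r r' h hr hr' hrr iha ihb a ha hh
    have iha' := iha r hr r' hr' hrr a ha fun v hv => hh v (h.subset_left hv)
    have ihb' := ihb u h.mem_right u h.mem_right (Or.inl rfl)
    by_cases hau : a ∈ st u
    · obtain rfl : u = r := hh u (h.subset_left h.mem_left) hau
      refine h.sharingConnected hs hr (by simpa using ha) isAdmissible_true iha' ha
        (ihb' a ha fun v hv => hh v (h.symm.subset_left hv)) fun t ht hta => ?_
      obtain ⟨b, hb⟩ := hG.exists_proper hT hs h.conn_left hr
      refine ⟨b, hb, trivial, fun x hx => ?_⟩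
      rw [Set.mem_singleton_iff.1 hx]
      exact hb.ne hr ha ht hta.symm
    · obtain ⟨f, hf, hfh⟩ := h.exists_left_edge hs
      refine h.sharingConnected hs hr (by simpa using ha) isAdmissible_true iha' hf
        (ihb' f hf hfh) fun t ht _ => ?_
      obtain ⟨b, hb, hbt⟩ := hG.exists_separate hT hs h.conn_left (mem_edgesOf hr ha)
        (mem_edgesOf h.mem_left ht) fun h' => hau (h' ▸ ht)
      refine ⟨b, hb, trivial, fun x hx => ?_⟩
      rwa [Set.mem_singleton_iff.1 hx]
  · intro W W₀ m q r r' h hr hr' hrr ih a ha hh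
    obtain ⟨e, k, hE⟩ := h.exists_earEdges hs
    obtain ⟨-, h1, hl⟩ := hE.ne_of_half hh
    exact hE.sharingConnected_singleton hs hr ha h1 hl
      (hG.bothTypes hT hs h.conn hE.mem_zero hE.mem_last (hE.adj hs))
      (ih r hr r' hr' hrr a ha fun v hv => hh v (hE.subset hv))

/-- No class is forbidden here, so at a cut vertex any colouring of the equal type serves for the
detours, and over an ear each fibre is connected because the letter at `0` may play the role of `ε`.
-/
theorem NoK23Minor.sharingConnected_type (hG : NoK23Minor G) (hT : G.CliqueFree 3)
    (hs : IsCubicStar G st) (hW : ConnIn G W) (hr : r ∈ W) {r' : V} (hr' : r' ∈ W)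
    (hrr : G.Adj r r') {κ x y : E} (hκ : κ ∈ st r) (hκ' : κ ∈ st r') (hx : x ∈ st r) (hxκ : x ≠ κ)
    (hy : y ∈ st r') (hyκ : y ≠ κ) : SharingConnected st W r ∅ fun c => c x = c y := by
  refine hG.induction hT (P := fun W r r' => G.Adj r r' → ∀ κ x y, κ ∈ st r → κ ∈ st r' →
    x ∈ st r → x ≠ κ → y ∈ st r' → y ≠ κ → SharingConnected st W r ∅ fun c => c x = c y)
    ?_ ?_ ?_ ?_ W hW r hr r' hr' (Or.inr hrr) hrr κ x y hκ hκ' hx hxκ hy hyκ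
  · exact fun r h => absurd rfl h.ne
  · intro r v _
    refine ⟨fun h => absurd rfl h.ne, fun hrv κ x y hκ hκ' hx hxκ hy hyκ c c' hc hc' tc tc' hcc => ?_⟩
    refine .single ⟨⟨hc, tc⟩, ⟨hc', tc'⟩, hcc, c κ, fun z hz => absurd hz (by simp), .of_eqOn ?_⟩
    have hsh : Share (st v) (c κ) c c' := by
      intro z hz
      constructor
      · intro h'
        rw [hc v (by simp) hz hκ' h', ← hcc hκ]
      · intro h'
        rw [hcc hκ] at h'
        rw [hc' v (by simp) hz hκ' h']
    have hv := hs.eqOn_of_share (hc v (by simp)) (hc' v (by simp)) hsh hy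
      (hc.ne (v := v) (by simp) hy hκ' hyκ) (by rw [← tc, ← tc', hcc hx])
    rintro z ⟨w, rfl | hw, hz⟩
    · exact hcc hz
    · rw [Set.mem_singleton_iff.1 hw] at hz
      exact hv hz
  · intro W Wa Wb u r r' h hr hr' hrr iha ihb hadj κ x y hκ hκ' hx hxκ hy hyκ
    obtain ⟨f, hf, hfh⟩ := h.exists_left_edge hs
    refine h.sharingConnected hs hr (Set.empty_subset _)
      (isAdmissible_eq (mem_edgesOf hr hx) (mem_edgesOf hr' hy))
      (iha r hr r' hr' hrr hadj κ x y hκ hκ' hx hxκ hy hyκ) hf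
      (hG.sharingConnected hT hs h.conn_right h.mem_right hf hfh) fun t ht _ => ?_
    obtain ⟨⟨b, hb, hbt⟩, -⟩ := hG.bothTypes hT hs h.conn_left hr hr' hadj κ x y hκ hκ' hx hxκ hy hyκ
    exact ⟨b, hb, hbt, fun z hz => absurd hz (by simp)⟩
  · intro W W₀ m q r r' h hr hr' hrr ih hadj κ x y hκ hκ' hx hxκ hy hyκ
    obtain ⟨e, k, hE⟩ := h.exists_earEdges hs
    exact hE.sharingConnected_empty hs (isAdmissible_eq (mem_edgesOf hr hx) (mem_edgesOf hr' hy)) hr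
      (ih r hr r' hr' hrr hadj κ x y hκ hκ' hx hxκ hy hyκ)

/-- Colourings with equal colours at the ends of the cycle are connected by steps that avoid the
edge `e 1`. -/
theorem NoK23Minor.sharingConnected_type_one (hG : NoK23Minor G) (hT : G.CliqueFree 3)
    (hs : IsCubicStar G st) (hE : EarEdges st W W₀ n q e h) (hW : ConnIn G W₀) :
    SharingConnected st W₀ (q 0) {e 1} fun c => c (e 1) = c (e (n - 1)) := by
  have hn := hE.four_le
  have hx : e 1 ≠ e 0 := fun h' => by have := hE.e_inj _ (by omega) _ (by omega) h'; omega
  have hy : e (n - 1) ≠ e 0 := fun h' => by have := hE.e_inj _ (by omega) _ (by omega) h'; omega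
  classical
  intro c c' hc hc' tc tc' hcc
  have hp := hG.sharingConnected_type hT hs hW hE.mem_zero hE.mem_last (hE.adj hs) hE.e_zero_mem
    hE.e_zero_mem_last hE.e_one_mem hx hE.e_last_mem hy c c' hc hc' tc tc' hcc
  clear tc' hc' hcc
  induction hp with
  | refl => exact .refl
  | @tail b b' hp hstep ih =>
    refine ih.trans ?_
    have hcb := (sharing_end hp ⟨hc, tc⟩).2
    obtain ⟨⟨hb, tb⟩, ⟨hb', tb'⟩, hbb, s, -, hsh⟩ := hstep
    have c0 := hcb hE.e_zero_mem
    have c1 := hcb hE.e_one_mem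
    have b0 := hbb hE.e_zero_mem
    have b1 := hbb hE.e_one_mem
    have h01 := hE.e_zero_ne_one hb
    -- A step that shares the class of `e 1` is forbidden. Both of its ends are flipped, which keeps
    -- the third class; off the three edges the flip turns the class of `e 1` into that of `e 0`, so
    -- the flipped colourings share the latter.
    by_cases hsx : s = c (e 1)
    swap
    · exact .single ⟨⟨hb, tb⟩, ⟨hb', tb'⟩, hbb, s, fun x hx => by
        rw [Set.mem_singleton_iff.1 hx]; exact Ne.symm hsx, hsh⟩
    obtain ⟨f, hf, tf, hbf, hsf, hfx⟩ := hE.exists_flip hb tb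
    obtain ⟨f', hf', tf', hbf', hsf', hfx'⟩ := hE.exists_flip hb' tb'
    have third : thd (b (e 0)) (b (e 1)) ∈ {s | ∀ x ∈ ({e 1} : Set E), c x ≠ s} := fun x hx => by
      rw [Set.mem_singleton_iff.1 hx, c1]
      exact (thd_ne_right h01).symm
    rw [← b0, ← b1] at hsf' hfx'
    refine .head ⟨⟨hb, tb⟩, ⟨hf, tf⟩, hbf, _, third, hsf⟩ (.head (b := f') ?_
      (.single ⟨⟨hf', tf'⟩, ⟨hb', tb'⟩, hbf'.symm, _, third, hsf'.symm⟩))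
    refine ⟨⟨hf, tf⟩, ⟨hf', tf'⟩, hbf.symm.trans (hbb.trans hbf'), b (e 0), fun x hx => ?_, ?_⟩
    · rw [Set.mem_singleton_iff.1 hx, c1]; exact h01.symm
    · intro x hxW
      have hsw : ∀ z, Equiv.swap (b (e 0)) (b (e 1)) z = b (e 0) ↔ z = b (e 1) := by
        intro z
        rw [Equiv.swap_apply_eq_iff, Equiv.swap_apply_left]
      rw [hfx, hfx']
      split_ifs with hxe
      · rcases hxe with rfl | rfl | rfl
        · rw [b0]
        · rw [b1]
        · rw [← tb, ← tb', b1]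
      · rw [hsw, hsw, ← c1, ← hsx]
        exact hsh x hxW

end Connectivity

/-! ### Systems of permutations -/

section Systems

variable {V E : Type*} {G : SimpleGraph V} {st : V → Set E} {W W₀ Wa Wb : Set V} {s : Fin 3}
  {c c' d d' c₀ : E → Fin 3} {r w : V} {f : (E → Fin 3) → Fin 3 → Fin 3}

/-- Every colouring is assigned a permutation, in such a way that the image of a colour depends only
on the colour class. -/
structure IsSystem (st : V → Set E) (W : Set V) (f : (E → Fin 3) → Fin 3 → Fin 3) : Prop where
  inj : ∀ c, Proper st W c → (f c).Injective
  share : ∀ c c', Proper st W c → Proper st W c' → ∀ s s',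
    (∀ x ∈ edgesOf st W, c x = s ↔ c' x = s') → f c s = f c' s'

/-- Colour classes are mapped according to the edge at a fixed vertex that they contain. -/
def HasDictators (st : V → Set E) (W : Set V) : Prop :=
  ∀ f, IsSystem st W f → ∃ w ∈ W, ∃ β : E → Fin 3, ∀ c, Proper st W c → ∀ x ∈ st w, f c (c x) = β x

/-- The colourings that agree with `c₀` at `r`. -/
def Normalized (st : V → Set E) (W : Set V) (r : V) (c₀ c : E → Fin 3) : Prop :=
  Proper st W c ∧ Set.EqOn c₀ c (st r)

/-- A system on the normalized colourings. -/
structure IsNormalizedSystem (st : V → Set E) (W : Set V) (r : V) (c₀ : E → Fin 3)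
    (f : (E → Fin 3) → Fin 3 → Fin 3) : Prop where
  inj : ∀ c, Normalized st W r c₀ c → (f c).Injective
  share : ∀ c c', Normalized st W r c₀ c → Normalized st W r c₀ c' → ∀ s,
    Share (edgesOf st W) s c c' → f c s = f c' s

/-- A system on the normalized colourings is dictated by a vertex. -/
def IsDictated (st : V → Set E) (W : Set V) (r : V) (c₀ : E → Fin 3)
    (f : (E → Fin 3) → Fin 3 → Fin 3) : Prop :=
  ∃ w ∈ W, ∃ β : E → Fin 3, ∀ c, Normalized st W r c₀ c → ∀ x ∈ st w, f c (c x) = β x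

theorem IsNormalizedSystem.congr (hf : IsNormalizedSystem st W r c₀ f)
    (hc : Normalized st W r c₀ c) (hc' : Normalized st W r c₀ c')
    (h : Set.EqOn c c' (edgesOf st W)) : f c = f c' :=
  funext fun s => hf.share c c' hc hc' s (.of_eqOn h)

/-- A system on the normalized colourings extends to all colourings by first applying the renaming
`σ c` that normalizes `c` at `r`. For a normalized colouring this renaming is the identity. -/
theorem HasDictators.isDictated (hs : IsCubicStar G st) (hW : HasDictators st W) (hr : r ∈ W)
    (hc₀ : Set.InjOn c₀ (st r)) (hf : IsNormalizedSystem st W r c₀ f) :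
    IsDictated st W r c₀ f := by
  have hex : ∀ c, ∃ σ : Equiv.Perm (Fin 3), Proper st W c → ∀ x ∈ st r, σ (c x) = c₀ x := by
    intro c
    by_cases hc : Proper st W c
    · obtain ⟨σ, hσ⟩ := hs.exists_perm (hc r hr) hc₀
      exact ⟨σ, fun _ => hσ⟩
    · exact ⟨1, fun h => absurd h hc⟩
  choose σ hσ using hex
  have hN : ∀ c, Proper st W c → Normalized st W r c₀ (σ c ∘ c) := fun c hc =>
    ⟨hc.perm _, fun x hx => (hσ c hc x hx).symm⟩
  obtain ⟨w, hw, β, hβ⟩ := hW (fun c s => f (σ c ∘ c) (σ c s)) ⟨fun c hc =>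
    (hf.inj _ (hN c hc)).comp (σ c).injective, fun c c' hc hc' s s' h => by
      obtain ⟨e, he, rfl⟩ := hs.exists_color (hc r hr) s
      have he' : c' e = s' := (h e (mem_edgesOf hr he)).1 rfl
      subst he'
      rw [hσ c hc e he, hσ c' hc' e he]
      refine hf.share _ _ (hN c hc) (hN c' hc') _ fun x hx => ?_
      have h1 : (σ c ∘ c) x = c₀ e ↔ c x = c e := by
        rw [← hσ c hc e he]; exact (σ c).injective.eq_iff
      have h2 : (σ c' ∘ c') x = c₀ e ↔ c' x = c' e := by
        rw [← hσ c' hc' e he]; exact (σ c').injective.eq_iff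
      rw [h1, h2]
      exact h x hx⟩
  refine ⟨w, hw, β, fun c hc x hx => ?_⟩
  have h1 : σ c = 1 := by
    obtain ⟨e, he⟩ := hs.nonempty r
    obtain ⟨g, g', hg, -, -, hst⟩ := hs.exists_enum he
    have hgr : g ∈ st r := by simp [hst]
    refine perm_eq_of_ne (hc.1.ne hr he hgr hg) ?_ ?_
    · rw [hσ c hc.1 e he]; exact hc.2 he
    · rw [hσ c hc.1 g hgr]; exact hc.2 hgr
  have := hβ c hc.1 x hx
  rw [h1] at this
  exact this

theorem HasDictators.of_isDictated (hs : IsCubicStar G st) (hr : r ∈ W)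
    (hc₀ : Set.InjOn c₀ (st r))
    (h : ∀ f, IsNormalizedSystem st W r c₀ f → IsDictated st W r c₀ f) : HasDictators st W := by
  intro f hf
  obtain ⟨w, hw, β, hβ⟩ := h f ⟨fun c hc => hf.inj c hc.1, fun c c' hc hc' s hsh =>
    hf.share c c' hc.1 hc'.1 s s hsh⟩
  refine ⟨w, hw, β, fun c hc x hx => ?_⟩
  obtain ⟨σ, hσ⟩ := hs.exists_perm (hc r hr) hc₀
  rw [hf.share c (σ ∘ c) hc (hc.perm σ) (c x) (σ (c x)) fun y _ => σ.injective.eq_iff.symm]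
  exact hβ (σ ∘ c) ⟨hc.perm σ, fun y hy => (hσ y hy).symm⟩ x hx

/-- Suppose that a step in the first argument, which preserves the value at `t`, changes the map for
one `y₀`. Then along steps of the second argument that preserve the value at some `s ≠ t`, neither
of the two maps can change, and this rigidity spreads to all first arguments. -/
theorem dichotomy {X Y : Type*} {f : X → Y → Fin 3 → Fin 3} (hinj : ∀ x y, (f x y).Injective)
    {RX : Fin 3 → X → X → Prop} {RY : Fin 3 → Y → Y → Prop}
    (hX : ∀ s x x' y, RX s x x' → f x y s = f x' y s)
    (hY : ∀ s x y y', RY s y y' → f x y s = f x y' s) {T : Set (Fin 3)}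
    (connX : ∀ x x', Relation.ReflTransGen (fun a b => ∃ t ∈ T, RX t a b) x x')
    (connY : ∀ t ∈ T, ∀ y y', Relation.ReflTransGen (fun a b => ∃ s, s ≠ t ∧ RY s a b) y y') :
    (∀ x x' y, f x y = f x' y) ∨ ∀ x y y', f x y = f x y' := by
  by_cases hstep : ∀ x x' y, (∃ t ∈ T, RX t x x') → f x y = f x' y
  · left
    intro x x' y
    induction connX x x' with
    | refl => rfl
    | tail _ h ih => rw [ih, hstep _ _ y h]
  right
  push Not at hstep
  obtain ⟨x₀, x₁, y₀, ⟨t, ht, hR⟩, hne⟩ := hstep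
  -- The values at `s` for `x₀` and `x₁` are different and stay fixed during the step, and the value
  -- at `t` is common to both. It is therefore the one value that remains, before and after the
  -- step.
  have hpiv : ∀ y, f x₀ y = f x₀ y₀ ∧ f x₁ y = f x₁ y₀ := by
    intro y
    have hp := connY t ht y₀ y
    induction hp with
    | refl => exact ⟨rfl, rfl⟩
    | @tail y y' _ h ih =>
      obtain ⟨s, hst, hs⟩ := h
      have e0 := hY s x₀ y y' hs
      have e1 := hY s x₁ y y' hs
      have ft := hX t x₀ x₁ y₀ hR
      have ft' := hX t x₀ x₁ y' hR
      rw [ih.1] at e0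
      rw [ih.2] at e1
      have hs_ne : f x₀ y₀ s ≠ f x₁ y₀ s := fun h' =>
        hne (eq_of_agree_two (hinj _ _) (hinj _ _) hst h' ft)
      have n0 := (hinj x₀ y').ne hst
      have n1 := (hinj x₁ y').ne hst
      rw [← e0] at n0
      rw [← e1, ← ft'] at n1
      have m0 := (hinj x₀ y₀).ne hst
      have m1 := (hinj x₁ y₀).ne hst
      rw [← ft] at m1
      have key : f x₀ y' t = f x₀ y₀ t :=
        (eq_thd hs_ne n0.symm n1.symm).trans (eq_thd hs_ne m0.symm m1.symm).symm
      refine ⟨eq_of_agree_two (hinj _ _) (hinj _ _) hst e0.symm key, ?_⟩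
      refine eq_of_agree_two (hinj _ _) (hinj _ _) hst e1.symm ?_
      rw [← ft', key, ft]
  -- If `f x` is constant and `x'` is one step away with shared letter `t'`, then the value of `f
  -- x'` at `t'` is constant. Steps of `y` that keep a value at another letter leave no freedom.
  have hconst : ∀ x y y', f x y = f x y' := by
    intro x
    induction connX x₀ x with
    | refl => intro y y'; rw [(hpiv y).1, (hpiv y').1]
    | @tail x x' _ h ih =>
      obtain ⟨t', ht', hR'⟩ := h
      intro y y'
      induction connY t' ht' y y' with
      | refl => rfl
      | @tail z z' _ h ih' =>
        obtain ⟨s, hst, hs⟩ := h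
        rw [ih']
        refine eq_of_agree_two (hinj _ _) (hinj _ _) hst (hY s x' z z' hs) ?_
        rw [← hX t' x x' z hR', ← hX t' x x' z' hR', ih z z']
  exact hconst

theorem hasDictators_singleton (hs : IsCubicStar G st) (v : V) : HasDictators st {v} := by
  obtain ⟨x, hx⟩ := hs.nonempty v
  obtain ⟨y, y', hxy, -, -, hst⟩ := hs.exists_enum hx
  obtain ⟨c₀, hc₀, -⟩ := hs.exists_coloring hx (y := y) (by simp [hst]) hxy (a := 0) (b := 1)
    (by decide)
  refine .of_isDictated (r := v) hs rfl hc₀ fun f hf =>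
    ⟨v, rfl, fun x => f c₀ (c₀ x), fun c hc x hx => ?_⟩
  have hN : Normalized st {v} v c₀ c₀ := ⟨by rintro _ rfl; exact hc₀, Set.eqOn_refl _ _⟩
  beta_reduce
  rw [hf.congr hN hc, hc.2 hx]
  rintro z ⟨w, hw, hz⟩
  rw [Set.mem_singleton_iff.1 hw] at hz
  exact hc.2 hz

/-- After normalization at `r` there are only two colourings, which differ by exchanging the colours
of the two edges at `v` other than `κ`. They share the class of `κ`. So the maps are equal and `r`
dictates, or they differ by the corresponding exchange of values and `v` dictates. -/
theorem hasDictators_pair (hs : IsCubicStar G st) {v : V} (hrv : G.Adj r v) :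
    HasDictators st {r, v} := by
  obtain ⟨κ, hκ, hκ'⟩ := (hs.adj_iff r v hrv.ne).2 hrv
  obtain ⟨x, x', hx, -, -, hst⟩ := hs.exists_enum hκ
  obtain ⟨y, g, hy, hg, hyg, hst'⟩ := hs.exists_enum hκ'
  obtain ⟨d, hd, hdκ, -⟩ := hs.exists_coloring hκ (y := x) (by simp [hst]) hx (a := 0) (b := 1)
    (by decide)
  obtain ⟨c, hc, hcκ, -⟩ := hs.exists_coloring hκ' (y := y) (by simp [hst']) hy (a := 0) (b := 1)
    (by decide)
  obtain ⟨c₀, hc₀, -, -⟩ := hs.exists_pair_coloring hrv hκ hκ' hd hc (hdκ.trans hcκ.symm)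
  have hr : r ∈ ({r, v} : Set V) := by simp
  have hv : v ∈ ({r, v} : Set V) := by simp
  refine .of_isDictated hs hr (hc₀ r hr) fun f hf => ?_
  have hN : Normalized st {r, v} r c₀ c₀ := ⟨hc₀, Set.eqOn_refl _ _⟩
  have heq : ∀ c c', Normalized st {r, v} r c₀ c → Normalized st {r, v} r c₀ c' → c y = c' y →
      f c = f c' := by
    intro c c' hc hc' hcc
    refine hf.congr hc hc' ?_
    have hr' := hc.2.symm.trans hc'.2
    rintro z ⟨w, rfl | hw, hz⟩
    · exact hr' hz
    · rw [Set.mem_singleton_iff.1 hw, hst'] at hz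
      have hy' : y ∈ st v := by simp [hst']
      have hg' : g ∈ st v := by simp [hst']
      rcases hz with rfl | rfl | rfl
      · exact hr' hκ
      · exact hcc
      · rw [eq_thd (hc.1.ne hv hκ' hy' hy) (hc.1.ne hv hg' hκ' hg.symm)
          (hc.1.ne hv hg' hy' hyg.symm), hr' hκ, hcc]
        exact (eq_thd (hc'.1.ne hv hκ' hy' hy) (hc'.1.ne hv hg' hκ' hg.symm)
          (hc'.1.ne hv hg' hy' hyg.symm)).symm
  have hκsh : ∀ c, Normalized st {r, v} r c₀ c → f c₀ (c₀ κ) = f c (c₀ κ) := by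
    intro c hc
    refine hf.share _ _ hN hc _ ?_
    rintro z ⟨w, rfl | hw, hz⟩
    · rw [hc.2 hz]
    · rw [Set.mem_singleton_iff.1 hw] at hz
      constructor
      · intro h'
        rw [hc₀ v hv hz hκ' h', ← hc.2 hκ]
      · intro h'
        rw [hc.2 hκ] at h'
        rw [hc.1 v hv hz hκ' h']
  by_cases hall : ∀ c, Normalized st {r, v} r c₀ c → f c = f c₀
  · refine ⟨r, hr, fun z => f c₀ (c₀ z), fun c hc z hz => ?_⟩
    beta_reduce
    rw [hall c hc, hc.2 hz]
  · push Not at hall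
    obtain ⟨c₁, hc₁, hne⟩ := hall
    refine ⟨v, hv, fun z => f c₀ (c₀ z), fun c hc z hz => ?_⟩
    by_cases hcy : c y = c₀ y
    · rw [heq c c₀ hc hN hcy]
      have : Set.EqOn c c₀ (st v) := by
        refine hs.eqOn_of_share (s := c₀ κ) (hc.1 v hv) (hc₀ v hv) ?_ (e := y) (by simp [hst']) ?_ hcy
        · intro z hz
          constructor
          · intro h'
            rw [hc.2 hκ] at h'
            rw [hc.1 v hv hz hκ' h']
          · intro h'
            rw [hc₀ v hv hz hκ' h', ← hc.2 hκ]
        · rw [hcy]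
          exact hc₀.ne hv (by simp [hst']) hκ' hy.symm
      rw [this hz]
    · have hy' : y ∈ st v := by simp [hst']
      have hg' : g ∈ st v := by simp [hst']
      have k0 := hc.2 hκ
      have n1 := hc₀.ne hv hκ' hy' hy
      have e0 : c₀ g = thd (c₀ κ) (c₀ y) :=
        eq_thd n1 (hc₀.ne hv hg' hκ' hg.symm) (hc₀.ne hv hg' hy' hyg.symm)
      have n2 := hc.1.ne hv hκ' hy' hy
      have e1 : c g = thd (c κ) (c y) :=
        eq_thd n2 (hc.1.ne hv hg' hκ' hg.symm) (hc.1.ne hv hg' hy' hyg.symm)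
      have ecy : c y = c₀ g := by
        rw [e0]; exact eq_thd n1 (by rw [k0]; exact n2.symm) hcy
      have ecg : c g = c₀ y := by
        rw [e1, ecy, ← k0, e0, thd_thd n1]
      have hne' : f c₀ ≠ f c := by
        intro h'
        have h1y : c₁ y ≠ c₀ y := fun h'' => hne (heq c₁ c₀ hc₁ hN h'')
        have k1 := hc₁.2 hκ
        have : c₁ y = c₀ g := by
          rw [e0]
          exact eq_thd n1 (by rw [k1]; exact (hc₁.1.ne hv hκ' hy' hy).symm) h1y
        exact hne ((heq c₁ c hc₁ hc (this.trans ecy.symm)).trans h'.symm)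
      have sw := eq_of_agree_of_ne (hf.inj _ hN) (hf.inj _ hc) n1 (hκsh c hc) hne'
      have sw' := eq_of_agree_of_ne (hf.inj _ hN) (hf.inj _ hc) (t := c₀ g)
        (hc₀.ne hv hκ' hg' hg) (hκsh c hc) hne'
      rw [hst'] at hz
      rcases hz with rfl | rfl | rfl
      · rw [← k0]; exact (hκsh c hc).symm
      · rw [ecy, e0]; exact sw
      · rw [ecg]
        rw [e0, thd_thd n1] at sw'
        beta_reduce
        rw [sw', e0]

variable [Finite V]

/-- In the right part `g` has no end besides `w`, so its colourings are connected by steps that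
avoid the class of `g`. In the left part this holds for the other two edges at `w`. These are the
restrictions in `dichotomy`, which leaves a system on one part alone. -/
theorem VertexAmalgam.isDictated_of_edge (hG : NoK23Minor G) (hT : G.CliqueFree 3)
    (hs : IsCubicStar G st) (h : VertexAmalgam G W Wa Wb w) (ha : HasDictators st Wa)
    (hb : HasDictators st Wb) {g : E} (hg : g ∈ st w) (hgb : ∀ v ∈ Wb, g ∈ st v → v = w)
    (hga : ∀ t ∈ st w, t ≠ g → ∀ v ∈ Wa, t ∈ st v → v = w) (hc₀ : Proper st W c₀)
    (hf : IsNormalizedSystem st W w c₀ f) : IsDictated st W w c₀ f := by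
  have hwW := h.subset_left h.mem_left
  have hca := hc₀.mono h.subset_left
  have hcb := hc₀.mono h.symm.subset_left
  have hglue : ∀ a b, Normalized st Wa w c₀ a → Normalized st Wb w c₀ b →
      Normalized st W w c₀ (glue st Wa a b) := fun a b ha hb =>
    ⟨h.proper_glue hs ha.1 hb.1 (ha.2.symm.trans hb.2), fun x hx => by
      rw [glue_eqOn_left (mem_edgesOf h.mem_left hx), ha.2 hx]⟩
  have hNa : ∀ c, Normalized st W w c₀ c → Normalized st Wa w c₀ c :=
    fun c hc => ⟨hc.1.mono h.subset_left, hc.2⟩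
  have hNb : ∀ c, Normalized st W w c₀ c → Normalized st Wb w c₀ c :=
    fun c hc => ⟨hc.1.mono h.symm.subset_left, hc.2⟩
  have hsh : ∀ a a' b b' s, Normalized st Wa w c₀ a → Normalized st Wa w c₀ a' →
      Normalized st Wb w c₀ b → Normalized st Wb w c₀ b' → Share (edgesOf st Wa) s a a' →
      Share (edgesOf st Wb) s b b' → f (glue st Wa a b) s = f (glue st Wa a' b') s :=
    fun a a' b b' s ha ha' hb hb' hsa hsb => hf.share _ _ (hglue a b ha hb) (hglue a' b' ha' hb') s
      (h.share_glue hs (ha.2.symm.trans hb.2) (ha'.2.symm.trans hb'.2) hsa hsb)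
  have h₀ : Normalized st W w c₀ c₀ := ⟨hc₀, Set.eqOn_refl _ _⟩
  have hconn : ∀ {U : Set V}, ConnIn G U → w ∈ U → ∀ t ∈ st w, (∀ v ∈ U, t ∈ st v → v = w) →
      ∀ a b : {c // Normalized st U w c₀ c}, Relation.ReflTransGen
        (fun a b : {c // Normalized st U w c₀ c} => ∃ s, s ≠ c₀ t ∧ Share (edgesOf st U) s a.1 b.1)
        a b := by
    intro U hU hwU t ht hh a b
    have hp := hG.sharingConnected hT hs hU hwU ht hh a.1 b.1 a.2.1 b.2.1 trivial trivial
      (a.2.2.symm.trans b.2.2)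
    obtain ⟨b, hb⟩ := b
    change Relation.ReflTransGen _ a.1 b at hp
    induction hp with
    | refl => exact .refl
    | @tail b₁ b₂ hp hstep ih =>
      have hb₁ : Normalized st U w c₀ b₁ := ⟨hstep.1.1, hb.2.trans hstep.2.2.1.symm⟩
      obtain ⟨s, hs, hsh⟩ := hstep.2.2.2
      refine (ih hb₁).tail ⟨s, ?_, hsh⟩
      rw [a.2.2 ht]
      exact (hs t rfl).symm
  rcases dichotomy (X := {c // Normalized st Wb w c₀ c}) (Y := {c // Normalized st Wa w c₀ c})
      (f := fun b a => f (glue st Wa a.1 b.1)) (T := {s | s ≠ c₀ g})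
      (RX := fun s b b' => Share (edgesOf st Wb) s b.1 b'.1)
      (RY := fun s a a' => Share (edgesOf st Wa) s a.1 a'.1)
      (fun b a => hf.inj _ (hglue _ _ a.2 b.2))
      (fun s b b' a hR => hsh _ _ _ _ s a.2 a.2 b.2 b'.2 (.refl _ _ _) hR)
      (fun s b a a' hR => hsh _ _ _ _ s a.2 a'.2 b.2 b.2 hR (.refl _ _ _))
      (hconn h.conn_right h.mem_right g hg hgb)
      (fun t ht a a' => by
        obtain ⟨x, hx, rfl⟩ := hs.exists_color (hc₀ w hwW) t
        exact hconn h.conn_left h.mem_left x hx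
          (hga x hx (fun h' => ht (congrArg c₀ h'))) a a') with hd | hd
  · obtain ⟨v, hv, β, hβ⟩ := ha.isDictated (r := w) (c₀ := c₀) (f := fun a => f (glue st Wa a c₀)) hs
      h.mem_left (hc₀ w hwW) ⟨fun a ha => hf.inj _ (hglue _ _ ha (hNb _ h₀)),
        fun a a' ha ha' s hs' => hsh _ _ _ _ s ha ha' (hNb _ h₀) (hNb _ h₀) hs' (.refl _ _ _)⟩
    refine ⟨v, h.subset_left hv, β, fun c hc x hx => ?_⟩
    have e := hd ⟨c, hNb c hc⟩ ⟨c₀, hNb _ h₀⟩ ⟨c, hNa c hc⟩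
    beta_reduce at e
    rw [glue_self] at e
    rw [e]
    exact hβ c (hNa c hc) x hx
  · obtain ⟨v, hv, β, hβ⟩ := hb.isDictated (r := w) (c₀ := c₀) (f := fun b => f (glue st Wa c₀ b)) hs
      h.mem_right (hc₀ w hwW) ⟨fun b hb => hf.inj _ (hglue _ _ (hNa _ h₀) hb),
        fun b b' hb hb' s hs' => hsh _ _ _ _ s (hNa _ h₀) (hNa _ h₀) hb hb' (.refl _ _ _) hs'⟩
    refine ⟨v, h.symm.subset_left hv, β, fun c hc x hx => ?_⟩
    have e := hd ⟨c, hNb c hc⟩ ⟨c, hNa c hc⟩ ⟨c₀, hNa _ h₀⟩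
    beta_reduce at e
    rw [glue_self] at e
    rw [e]
    exact hβ c (hNb c hc) x hx

/-- At least one of the three edges at `w` leads into each part. Wherever the remaining edge leads,
some part receives only one edge, and this is the `g` of `isDictated_of_edge`. -/
theorem VertexAmalgam.hasDictators (hG : NoK23Minor G) (hT : G.CliqueFree 3)
    (hs : IsCubicStar G st) (h : VertexAmalgam G W Wa Wb w) (hc₀ : Proper st W c₀)
    (ha : HasDictators st Wa) (hb : HasDictators st Wb) : HasDictators st W := by
  refine .of_isDictated (r := w) hs (h.subset_left h.mem_left)
    (hc₀ w (h.subset_left h.mem_left)) fun f hf => ?_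
  have hside : ∀ {Wa Wb}, VertexAmalgam G W Wa Wb w → ∃ t ∈ st w, ∃ v ∈ Wa, v ≠ w ∧ t ∈ st v := by
    intro Wa Wb h
    obtain ⟨a, ha, hwa⟩ := h.adj_left
    obtain ⟨t, ht, ht'⟩ := (hs.adj_iff w a hwa.ne).2 hwa
    exact ⟨t, ht, a, ha, hwa.ne.symm, ht'⟩
  have hexcl : ∀ t ∈ st w, ∀ v ∈ Wa, v ≠ w → t ∈ st v → ∀ v' ∈ Wb, t ∈ st v' → v' = w := by
    intro t ht v hv hvw htv v' hv' htv'
    rcases hs.two t w v v' ht htv htv' with h' | rfl | h'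
    · exact absurd h'.symm hvw
    · have : v ∈ Wa ∩ Wb := ⟨hv, hv'⟩
      rw [h.inter] at this
      exact absurd (Set.mem_singleton_iff.1 this) hvw
    · exact h'.symm
  obtain ⟨t, ht, v, hv, hvw, htv⟩ := hside h
  obtain ⟨t', ht', v', hv', hvw', htv'⟩ := hside h.symm
  have htt : t ≠ t' := by
    rintro rfl
    exact hvw' (hexcl t ht v hv hvw htv v' hv' htv')
  obtain ⟨z, hz, -, -, hst⟩ := hs.exists_third ht ht' htt
  by_cases hzL : ∃ v ∈ Wa, v ≠ w ∧ z ∈ st v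
  · obtain ⟨y, hy, hyw, hzy⟩ := hzL
    have hg' : ∀ v ∈ Wa, t' ∈ st v → v = w := by
      intro x hx htx
      by_contra hxw
      exact hvw' (hexcl t' ht' x hx hxw htx v' hv' htv')
    refine h.symm.isDictated_of_edge hG hT hs hb ha ht' hg' ?_ hc₀ hf
    intro x hx hxt
    rw [hst] at hx
    rcases hx with rfl | rfl | rfl
    · exact hexcl _ ht v hv hvw htv
    · exact absurd rfl hxt
    · exact hexcl _ hz y hy hyw hzy
  · push Not at hzL
    refine h.isDictated_of_edge hG hT hs ha hb ht (hexcl t ht v hv hvw htv) ?_ hc₀ hf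
    intro x hx hxt y hy hxy
    by_contra hyw
    rw [hst] at hx
    rcases hx with rfl | rfl | rfl
    · exact hxt rfl
    · exact hvw' (hexcl x ht' y hy hyw hxy v' hv' htv')
    · exact hzL y hy hyw hxy

end Systems

/-! ### Systems over an ear -/

section EarSystems

variable {V E : Type*} {G : SimpleGraph V} {st : V → Set E} {W W₀ : Set V} {s k a φ : Fin 3}
  {c₀ d d' : E → Fin 3} {n : ℕ} {q : ℕ → V} {e h : ℕ → E} {u u' : ℕ → Fin 3}
  {F : (E → Fin 3) → (ℕ → Fin 3) → Fin 3 → Fin 3}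

/-- A colouring and a word on the cycle that agree on the common edges. -/
structure Fits (st : V → Set E) (W₀ : Set V) (n : ℕ) (e : ℕ → E) (k a : Fin 3) (d : E → Fin 3)
    (u : ℕ → Fin 3) : Prop where
  proper : Proper st W₀ d
  word : WordIn n k a u
  zero : d (e 0) = k
  one : d (e 1) = a
  last : d (e (n - 1)) = u (n - 1)

/-- A system of permutations on the pairs of a colouring and a word that fit. -/
structure IsEarSystem (st : V → Set E) (W₀ : Set V) (n : ℕ) (e : ℕ → E) (k a : Fin 3)
    (F : (E → Fin 3) → (ℕ → Fin 3) → Fin 3 → Fin 3) : Prop where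
  inj : ∀ d u, Fits st W₀ n e k a d u → (F d u).Injective
  share : ∀ d u d' u' s, Fits st W₀ n e k a d u → Fits st W₀ n e k a d' u' →
    Share (edgesOf st W₀) s d d' → WShare n s u u' → F d u s = F d' u' s

theorem Fits.same (hf : Fits st W₀ n e k a d u) : WSame n u fun j => d (e j) :=
  ⟨hf.word.zero.trans hf.zero.symm, hf.word.one.trans hf.one.symm, hf.last.symm⟩

theorem Fits.of_same (hd : Proper st W₀ d) (hu : WordIn n k a u)
    (h : WSame n u fun j => d (e j)) : Fits st W₀ n e k a d u :=
  ⟨hd, hu, h.1.symm.trans hu.zero, h.2.1.symm.trans hu.one, h.2.2.symm⟩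

theorem Fits.replace_word (hf : Fits st W₀ n e k a d u) (hu' : IsWord n u') (h : WSame n u u') :
    Fits st W₀ n e k a d u' :=
  ⟨hf.proper, ⟨hu', h.1 ▸ hf.word.zero, h.2.1 ▸ hf.word.one⟩, hf.zero, hf.one,
    hf.last.trans h.2.2⟩

theorem WordIn.ne (hn : 4 ≤ n) (hu : WordIn n k a u) : k ≠ a := by
  have := hu.isWord.1 0 (by omega)
  rwa [hu.zero, hu.one] at this

theorem WordIn.last_ne (hn : 4 ≤ n) (hu : WordIn n k a u) : u (n - 1) ≠ k := by
  have := hu.isWord.ne_last hn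
  rwa [hu.zero] at this

theorem WordIn.last_eq_thd (hn : 4 ≤ n) (hu : WordIn n k a u) (h : u (n - 1) ≠ a) :
    u (n - 1) = thd k a := eq_thd (hu.ne hn) (hu.last_ne hn) h

theorem WordIn.exists_partner (hn : 4 ≤ n) (hu : WordIn n k a u) (h : u (n - 1) ≠ a)
    (hL : Linked n u) : ∃ u', WordIn n k a u' ∧ u' (n - 1) = a ∧ WShare n k u u' := by
  obtain ⟨w, hw, h0, h1, hl, hs⟩ := hL
  rw [hu.zero] at h0 hs
  rw [hu.one] at h1
  have hw' : WordIn n k a w := ⟨hw, h0, h1⟩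
  refine ⟨w, hw', ?_, hs⟩
  by_contra hwa
  exact hl ((hw'.last_eq_thd hn hwa).trans (hu.last_eq_thd hn h).symm)

theorem EarEdges.normalized (hE : EarEdges st W W₀ n q e h) (hc₀ : Set.InjOn c₀ (st (q 0)))
    (hd : Proper st W₀ d) (h0 : c₀ (e 0) = d (e 0)) (h1 : c₀ (e 1) = d (e 1)) :
    Normalized st W₀ (q 0) c₀ d := by
  have hn := hE.four_le
  refine ⟨hd, fun x hx => ?_⟩
  rw [hE.star 0 (by omega)] at hx
  rcases hx with rfl | rfl | rfl
  · exact h0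
  · exact h1
  · rw [hE.third (by omega) hc₀, hE.third (by omega) (hd _ hE.mem_zero), h0, h1]

theorem exists_eq_of_injective {g : Fin 3 → Fin 3} (hg : g.Injective) (x : Fin 3) :
    ∃ y, g y = x := (Finite.injective_iff_surjective.1 hg) x

namespace IsEarSystem

variable (hF : IsEarSystem st W₀ n e k a F)
include hF

theorem share_word (hf : Fits st W₀ n e k a d u) (hf' : Fits st W₀ n e k a d u')
    (h : WShare n s u u') : F d u s = F d u' s := hF.share _ _ _ _ s hf hf' (.refl _ _ _) h

theorem share_left (hf : Fits st W₀ n e k a d u) (hf' : Fits st W₀ n e k a d' u)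
    (h : Share (edgesOf st W₀) s d d') : F d u s = F d' u s :=
  hF.share _ _ _ _ s hf hf' h (.of_eqOn fun _ _ => rfl)

variable (hE : EarEdges st W W₀ n q e h)
include hE

/-- A linked word has a partner that fits `d'` and shares `k`. A word that is not linked shares its
other two letters with linked words. There `φ` is taken by `k`, so in the given word `φ` is not
taken by these two letters, and only `k` is left. -/
theorem apply_first (hd' : Proper st W₀ d') (h0 : d' (e 0) = k) (h1 : d' (e 1) = a)
    (hl : d' (e (n - 1)) = a) (hφ : ∀ w, Fits st W₀ n e k a d' w → F d' w k = φ)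
    (hf : Fits st W₀ n e k a d u) (hu : u (n - 1) ≠ a) (hsh : Share (edgesOf st W₀) k d d') :
    F d u k = φ := by
  have hn := hE.four_le
  have key : ∀ w, Fits st W₀ n e k a d w → w (n - 1) ≠ a → Linked n w → F d w k = φ := by
    intro w hw hwa hL
    obtain ⟨w', hw', hl', hs⟩ := hw.word.exists_partner hn hwa hL
    have hf' : Fits st W₀ n e k a d' w' := ⟨hd', hw', h0, h1, hl.trans hl'.symm⟩
    rw [hF.share d w d' w' k hw hf' hsh hs, hφ w' hf']
  have hka := hf.word.ne hn
  rcases hf.word.isWord.linked_or hn (by rw [hf.word.one]; exact hu.symm) with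
    hL | ⟨⟨v, hv, hvL, hvs, hvsh⟩, v', hv', hvL', hvs', hvsh'⟩
  · exact key u hf hu hL
  have f1 := hf.replace_word hv hvs
  have f2 := hf.replace_word hv' hvs'
  have e1 := hF.share_word hf f1 hvsh
  have e2 := hF.share_word hf f2 hvsh'
  have k1 := key v f1 (by rwa [← hvs.2.2]) hvL
  have k2 := key v' f2 (by rwa [← hvs'.2.2]) hvL'
  rw [hf.word.one] at e1
  rw [hf.word.last_eq_thd hn hu] at e2
  obtain ⟨y, hy⟩ := exists_eq_of_injective (hF.inj _ _ hf) φ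
  rcases eq_or_eq_or_eq_thd hka y with rfl | rfl | rfl
  · exact hy
  · rw [e1, ← k1] at hy
    exact absurd (hF.inj _ _ f1 hy).symm hka
  · rw [e2, ← k2] at hy
    exact absurd (hF.inj _ _ f2 hy) (thd_ne_left hka)

/-- The values on two words over a colouring with different colours at the ends of the cycle
agree if they can be transported to a colouring with equal colours. -/
theorem eq_of_path {t : Fin 3} {v v' : ℕ → Fin 3}
    (hA : ∀ d w w', Fits st W₀ n e k a d w → Fits st W₀ n e k a d w' → w (n - 1) = a →
      F d w = F d w')
    (hv : WordIn n k a v) (hv' : WordIn n k a v') (hva : v (n - 1) ≠ a) (hva' : v' (n - 1) ≠ a)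
    (hsh : WShare n t v v')
    (hp : Relation.ReflTransGen (fun d d' => Proper st W₀ d' ∧ d' (e 0) = k ∧
      (d' (e 1) ≠ d' (e (n - 1)) → d' (e 1) = a) ∧ ∃ s, s ≠ t ∧ Share (edgesOf st W₀) s d d') d d')
    (hd' : d' (e 1) = d' (e (n - 1))) (hf : Fits st W₀ n e k a d v) : F d v = F d v' := by
  have hn := hE.four_le
  have hka := hv.ne hn
  have hlast : ∀ w, WordIn n k a w → w (n - 1) ≠ a → ∀ d, Proper st W₀ d → d (e 0) = k →
      d (e 1) = a → d (e (n - 1)) ≠ d (e 1) → Fits st W₀ n e k a d w := by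
    intro w hw hwa d hd h0 h1 hl
    refine ⟨hd, hw, h0, h1, ?_⟩
    rw [hw.last_eq_thd hn hwa, eq_thd (hE.e_zero_ne_one hd) (hE.e_zero_ne_last hd).symm hl, h0, h1]
  by_contra hne
  suffices H : Fits st W₀ n e k a d' v ∧ F d' v ≠ F d' v' by
    refine hva ?_
    rw [← H.1.last, ← hd', H.1.one]
  clear hd'
  induction hp with
  | refl => exact ⟨hf, hne⟩
  | @tail b b' _ hstep ih =>
    obtain ⟨hfb, hneb⟩ := ih
    obtain ⟨hb', h0, h1, s, hst, hsb⟩ := hstep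
    have hfbv : Fits st W₀ n e k a b v' := hlast v' hv' hva' b hfb.proper hfb.zero hfb.one
      (by rw [hfb.last, hfb.one]; exact hva)
    -- The difference of the two maps persists along steps that share a letter other than `t`. At a
    -- change of type the shared letter is `k`, and `apply_first` forces equal values there; with
    -- the equal values at `t` this is a contradiction.
    by_cases hty : b' (e 1) = b' (e (n - 1))
    · exfalso
      have hbt : b (e 1) ≠ b (e (n - 1)) := by rw [hfb.last, hfb.one]; exact hva.symm
      obtain ⟨-, hs⟩ := hE.eq_of_share_of_type hfb.proper hsb.symm hty hbt
      rw [hfb.zero] at hs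
      subst hs
      obtain ⟨σ, σ0, σ1⟩ := exists_perm_of_ne (hE.e_zero_ne_one hb') hka
      rw [h0] at σ0
      have hσ := hb'.perm σ
      have hall : ∀ w w', Fits st W₀ n e k a (σ ∘ b') w → Fits st W₀ n e k a (σ ∘ b') w' →
          F (σ ∘ b') w = F (σ ∘ b') w' := by
        intro w w' hw hw'
        refine hA _ _ _ hw hw' ?_
        rw [← hw.last]
        change σ (b' (e (n - 1))) = a
        rw [← hty, σ1]
      have hshσ : Share (edgesOf st W₀) k b (σ ∘ b') := hsb.trans (share_comp_perm σ σ0)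
      obtain ⟨w₀, hw₀, hz, hw1, hwl, -⟩ := exists_linked_word (k := k) (a := a) (b := a) hn hka hka
      have hfit₀ : Fits st W₀ n e k a (σ ∘ b') w₀ := ⟨hσ, ⟨hw₀, hz, hw1⟩, by
        change σ (b' (e 0)) = k
        rw [h0, σ0], σ1, by
        change σ (b' (e (n - 1))) = _
        rw [← hty, σ1, hwl]⟩
      have key : ∀ w, Fits st W₀ n e k a b w → w (n - 1) ≠ a → F b w k = F (σ ∘ b') w₀ k :=
        fun w hw hwa => hF.apply_first hE hσ hfit₀.zero hfit₀.one
          (hfit₀.last.trans hwl) (fun w' hw' => by rw [hall w' w₀ hw' hfit₀]) hw hwa hshσ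
      exact hneb (eq_of_agree_two (hF.inj _ _ hfb) (hF.inj _ _ hfbv) hst
        ((key v hfb hva).trans (key v' hfbv hva').symm) (hF.share_word hfb hfbv hsh))
    · have hf1 := hlast v hv hva b' hb' h0 (h1 hty) (Ne.symm hty)
      have hf2 := hlast v' hv' hva' b' hb' h0 (h1 hty) (Ne.symm hty)
      refine ⟨hf1, fun h' => hneb ?_⟩
      refine eq_of_agree_two (hF.inj _ _ hfb) (hF.inj _ _ hfbv) hst ?_
        (hF.share_word hfb hfbv hsh)
      rw [hF.share_left hfb hf1 hsb, hF.share_left hfbv hf2 hsb, h']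

end IsEarSystem

theorem EarEdges.exists_type (hE : EarEdges st W W₀ n q e h)
    (hty : BothTypes st W₀ (q 0) (q (n - 1))) :
    (∃ c, Proper st W₀ c ∧ c (e 1) = c (e (n - 1))) ∧
      ∃ c, Proper st W₀ c ∧ c (e 1) ≠ c (e (n - 1)) := by
  have hn := hE.four_le
  have hx : e 1 ≠ e 0 := fun h' => by have := hE.e_inj _ (by omega) _ (by omega) h'; omega
  have hy : e (n - 1) ≠ e 0 := fun h' => by have := hE.e_inj _ (by omega) _ (by omega) h'; omega
  exact hty (e 0) (e 1) (e (n - 1)) hE.e_zero_mem hE.e_zero_mem_last hE.e_one_mem hx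
    hE.e_last_mem hy

variable [Finite V]

/-- If the system does not depend on the word for one kind of colourings, then it never does. -/
theorem IsEarSystem.eq_of_words (hG : NoK23Minor G) (hT : G.CliqueFree 3) (hs : IsCubicStar G st)
    (hF : IsEarSystem st W₀ n e k a F) (hE : EarEdges st W W₀ n q e h) (hW : ConnIn G W₀)
    (hA : ∀ d w w', Fits st W₀ n e k a d w → Fits st W₀ n e k a d w' → w (n - 1) = a →
      F d w = F d w')
    (hf : Fits st W₀ n e k a d u) (hf' : Fits st W₀ n e k a d u') : F d u = F d u' := by
  have hn := hE.four_le
  by_cases hua : u (n - 1) = a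
  · exact hA d u u' hf hf' hua
  have hka := hf.word.ne hn
  obtain ⟨⟨c, hc, tc⟩, -⟩ := hE.exists_type
    (hG.bothTypes hT hs hW hE.mem_zero hE.mem_last (hE.adj hs))
  have hsame : WSame n u u' := ⟨hf.word.zero.trans hf'.word.zero.symm,
    hf.word.one.trans hf'.word.one.symm, hf.last.symm.trans hf'.last⟩
  have hpath : ∀ t, t ≠ k → ∃ d', d' (e 1) = d' (e (n - 1)) ∧
      Relation.ReflTransGen (fun d d' => Proper st W₀ d' ∧ d' (e 0) = k ∧
      (d' (e 1) ≠ d' (e (n - 1)) → d' (e 1) = a) ∧ ∃ s, s ≠ t ∧ Share (edgesOf st W₀) s d d')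
      d d' := by
    intro t htk
    -- A path to the equal type must avoid the class of `t`. This is the class of `e 1` or of `e (n
    -- - 1)`, and either edge has only one end in the old part, so that end serves as the root.
    by_cases hta : t = a
    · obtain ⟨σ, hσ⟩ := hs.exists_perm (hc _ hE.mem_zero) (hf.proper _ hE.mem_zero)
      have hp := hG.sharingConnected hT hs hW hE.mem_zero hE.e_one_mem
        (fun v hv hv' => hE.star_one v hv hv') d (σ ∘ c) hf.proper (hc.perm σ) trivial trivial
        fun x hx => (hσ x hx).symm
      refine ⟨σ ∘ c, congrArg σ tc, ?_⟩
      generalize σ ∘ c = c' at hp ⊢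
      induction hp with
      | refl => exact .refl
      | @tail b b' hp hstep ih =>
        refine ih.tail ?_
        have hdb := (sharing_end (hp.tail hstep) ⟨hf.proper, trivial⟩).2
        obtain ⟨-, ⟨hb', -⟩, -, s, hs', hsh⟩ := hstep
        refine ⟨hb', by rw [← hdb hE.e_zero_mem, hf.zero],
          fun _ => by rw [← hdb hE.e_one_mem, hf.one], s, ?_, hsh⟩
        have := hs' (e 1) rfl
        rw [hf.one] at this
        rw [hta]
        exact this.symm
    · obtain ⟨σ, hσ⟩ := hs.exists_perm (hc _ hE.mem_last) (hf.proper _ hE.mem_last)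
      have hp := hG.sharingConnected hT hs hW hE.mem_last hE.e_last_mem
        (fun v hv hv' => hE.star_last v hv hv') d (σ ∘ c) hf.proper (hc.perm σ) trivial trivial
        fun x hx => (hσ x hx).symm
      refine ⟨σ ∘ c, congrArg σ tc, ?_⟩
      generalize σ ∘ c = c' at hp ⊢
      induction hp with
      | refl => exact .refl
      | @tail b b' hp hstep ih =>
        refine ih.tail ?_
        have hdb := (sharing_end (hp.tail hstep) ⟨hf.proper, trivial⟩).2
        obtain ⟨-, ⟨hb', -⟩, -, s, hs', hsh⟩ := hstep
        have hl : d (e (n - 1)) = thd k a := hf.last.trans (hf.word.last_eq_thd hn hua)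
        have h0 : b' (e 0) = k := by rw [← hdb hE.e_zero_mem_last, hf.zero]
        have hl' : b' (e (n - 1)) = thd k a := by rw [← hdb hE.e_last_mem, hl]
        refine ⟨hb', h0, fun hty => ?_, s, ?_, hsh⟩
        · have := eq_thd (hE.e_zero_ne_last hb') (hE.e_zero_ne_one hb').symm hty
          rw [this, h0, hl', thd_thd hka]
        · have := hs' (e (n - 1)) rfl
          rw [hl, ← eq_thd hka htk hta] at this
          exact this.symm
  have hp := hf.word.isWord.connected hn hf'.word.isWord hsame (ε := k)
    (by rw [hf.word.one]; exact hka.symm) (hf.word.last_ne hn)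
  clear hsame hf'
  suffices H : Fits st W₀ n e k a d u' ∧ F d u = F d u' from H.2
  induction hp with
  | refl => exact ⟨hf, rfl⟩
  | @tail v v' _ hstep ih =>
    obtain ⟨hv, hv', hvv, t, htk, hsh⟩ := hstep
    have hf' := ih.1.replace_word hv' hvv
    refine ⟨hf', ih.2.trans ?_⟩
    obtain ⟨d', hd', hp⟩ := hpath t htk
    have hl : ∀ w, Fits st W₀ n e k a d w → w (n - 1) ≠ a := fun w hw => by
      rwa [← hw.last, hf.last]
    exact hF.eq_of_path hE hA ih.1.word hf'.word (hl v ih.1) (hl v' hf') hsh hp hd' ih.1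

end EarSystems

/-! ### Dictators over an ear -/

section EarDictators

variable {V E : Type*} {G : SimpleGraph V} {st : V → Set E} {W W₀ : Set V} {s k a : Fin 3}
  {c₀ d d' : E → Fin 3} {n : ℕ} {q : ℕ → V} {e h : ℕ → E} {u u' : ℕ → Fin 3}
  {F : (E → Fin 3) → (ℕ → Fin 3) → Fin 3 → Fin 3}

/-- If the system does not depend on the word, then it is dictated by a vertex of the old part. -/
theorem IsEarSystem.dictated_left (hF : IsEarSystem st W₀ n e k a F)
    (hE : EarEdges st W W₀ n q e h) (hs : IsCubicStar G st) (hR : HasDictators st W₀)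
    (hc₀ : Set.InjOn c₀ (st (q 0))) (h0 : c₀ (e 0) = k) (h1 : c₀ (e 1) = a)
    (hw : ∀ d w w', Fits st W₀ n e k a d w → Fits st W₀ n e k a d w' → F d w = F d w') :
    ∃ w ∈ W₀, ∃ β : E → Fin 3, ∀ d u, Fits st W₀ n e k a d u → ∀ x ∈ st w, F d u (d x) = β x := by
  -- Since the word is irrelevant, any extension defines the system on the old part. Linked
  -- extensions are taken because they allow a class shared by two colourings to be shared by
  -- suitable words as well.
  choose! U hU using fun d (hd : Proper st W₀ d) => hE.exists_extension hd
  have hfit : ∀ d u, Normalized st W₀ (q 0) c₀ d → IsWord n u → WSame n u (fun j => d (e j)) →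
      Fits st W₀ n e k a d u := fun d u hd hu hud => .of_same hd.1
    ⟨hu, hud.1.trans ((hd.2 hE.e_zero_mem).symm.trans h0),
      hud.2.1.trans ((hd.2 hE.e_one_mem).symm.trans h1)⟩ hud
  have hfitU : ∀ d, Normalized st W₀ (q 0) c₀ d → Fits st W₀ n e k a d (U d) :=
    fun d hd => hfit d _ hd (hU d hd.1).1 (hU d hd.1).2.1
  obtain ⟨w, hwW, β, hβ⟩ := hR.isDictated (f := fun d => F d (U d)) hs hE.mem_zero hc₀
    ⟨fun d hd => hF.inj _ _ (hfitU d hd), fun d d' hd hd' s hsh => by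
      obtain ⟨hu, hud, hL⟩ := hU d hd.1
      obtain ⟨u', hu', hud', -, hstep⟩ := hE.exists_lift (S := {s}) isAdmissible_true hE.mem_zero
        ⟨⟨hd.1, trivial⟩, ⟨hd'.1, trivial⟩, hd.2.symm.trans hd'.2, s, rfl, hsh⟩ hu hud hL
      obtain ⟨s', rfl, hsh'⟩ := hstep.2.2.2
      have hfit' := hfit d' u' hd' hu' hud'
      rw [hw d' (U d') u' (hfitU d' hd') hfit']
      refine hF.share _ _ _ _ _ (hfitU d hd) hfit' hsh fun j hj => ?_
      have := hsh' (e j) (mem_edgesOf (v := q j) (by rw [hE.union]; exact Or.inr ⟨j, hj, rfl⟩)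
        (hE.e_mem hj))
      rwa [hE.glue_e hd.1 hu hud hj, hE.glue_e hd'.1 hu' hud' hj] at this⟩
  refine ⟨w, hwW, β, fun d u hf x hx => ?_⟩
  have hd := hE.normalized hc₀ hf.proper (h0.trans hf.zero.symm) (h1.trans hf.one.symm)
  rw [hw d u (U d) hf (hfitU d hd)]
  exact hβ d hd x hx

/-- Pairing the equal type with the partner `u'` and the other type with `u` yields a system on the
old part, hence a dictator `w`. The flip of a colouring of the equal type does not affect the
system, and this forces `w` to be an end of `e 0`. There `d` and `d'` agree on two edges. -/
theorem IsEarSystem.apply_eq_of_linked (hF : IsEarSystem st W₀ n e k a F)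
    (hE : EarEdges st W W₀ n q e h) (hs : IsCubicStar G st) (hR : HasDictators st W₀)
    (hty : ∃ c, Proper st W₀ c ∧ c (e 1) = c (e (n - 1)))
    (hA : ∀ d d' w, Fits st W₀ n e k a d w → Fits st W₀ n e k a d' w → w (n - 1) = a →
      F d w = F d' w)
    (hf : Fits st W₀ n e k a d u) (hf' : Fits st W₀ n e k a d' u) (hua : u (n - 1) ≠ a)
    (hL : Linked n u) : F d u = F d' u := by
  classical
  have hn := hE.four_le
  have hka := hf.word.ne hn
  obtain ⟨u', hu', hl', hsh⟩ := hf.word.exists_partner hn hua hL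
  have hc₀ := hf.proper _ hE.mem_zero
  have hfit : ∀ c, Normalized st W₀ (q 0) d c →
      Fits st W₀ n e k a c (if c (e (n - 1)) = a then u' else u) := by
    intro c hc
    have z := (hc.2 hE.e_zero_mem).symm.trans hf.zero
    have o := (hc.2 hE.e_one_mem).symm.trans hf.one
    split_ifs with hca
    · exact ⟨hc.1, hu', z, o, hca.trans hl'.symm⟩
    · refine ⟨hc.1, hf.word, z, o, ?_⟩
      rw [hf.word.last_eq_thd hn hua, ← z]
      refine eq_thd ?_ (hE.e_zero_ne_last hc.1).symm hca
      rwa [z]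
  obtain ⟨w, hw, β, hβ⟩ := hR.isDictated
    (f := fun c => F c (if c (e (n - 1)) = a then u' else u)) hs hE.mem_zero hc₀
    ⟨fun c hc => hF.inj _ _ (hfit c hc), fun c c' hc hc' s hss => by
      refine hF.share _ _ _ _ s (hfit c hc) (hfit c' hc') hss ?_
      have o := (hc.2 hE.e_one_mem).symm.trans hf.one
      have o' := (hc'.2 hE.e_one_mem).symm.trans hf.one
      have z := (hc.2 hE.e_zero_mem).symm.trans hf.zero
      have z' := (hc'.2 hE.e_zero_mem).symm.trans hf.zero
      split_ifs with h1 h2 h2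
      · exact fun _ _ => Iff.rfl
      · obtain ⟨hk, -⟩ := hE.eq_of_share_of_type hc'.1 hss (o.trans h1.symm)
          (by rw [o']; exact Ne.symm h2)
        rw [← hk, z]
        exact hsh.symm
      · obtain ⟨hk, -⟩ := hE.eq_of_share_of_type hc.1 hss.symm (o'.trans h2.symm)
          (by rw [o]; exact Ne.symm h1)
        rw [← hk, z']
        exact hsh
      · exact fun _ _ => Iff.rfl⟩
  obtain ⟨c, hc, tc⟩ := hty
  obtain ⟨σ, hσ⟩ := hs.exists_perm (hc _ hE.mem_zero) hc₀
  set b := σ ∘ c with hb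
  have hbP : Proper st W₀ b := hc.perm σ
  have hbN : Normalized st W₀ (q 0) d b := ⟨hbP, fun x hx => (hσ x hx).symm⟩
  have tb : b (e 1) = b (e (n - 1)) := congrArg σ tc
  have b0 : b (e 0) = k := (hbN.2 hE.e_zero_mem).symm.trans hf.zero
  have b1 : b (e 1) = a := (hbN.2 hE.e_one_mem).symm.trans hf.one
  have bl : b (e (n - 1)) = a := tb.symm.trans b1
  obtain ⟨g, hg, tg, hbg, -, hgx⟩ := hE.exists_flip hbP tb
  have hgN : Normalized st W₀ (q 0) d g := ⟨hg, hbN.2.trans hbg⟩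
  have gl : g (e (n - 1)) = a := by rw [← tg, ← hbg hE.e_one_mem, b1]
  -- Both `b` and `g` have the equal type, so their maps coincide by `hA`. As the dictator assigns
  -- the same values to its edges in both, injectivity gives equal colours.
  have hbgw : ∀ x ∈ st w, b x = g x := by
    intro x hx
    have fb := hfit b hbN
    have fg := hfit g hgN
    have eb := hβ b hbN x hx
    have eg := hβ g hgN x hx
    beta_reduce at eb eg
    rw [if_pos bl] at fb eb
    rw [if_pos gl] at fg eg
    rw [← eg, hA b g u' fb fg hl'] at eb
    exact hF.inj _ _ fg eb
  -- An edge of colour `k` in `b` has colour `a` after the flip unless it is `e 0`. But the edge of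
  -- colour `k` at `w` keeps its colour.
  have hew : e 0 ∈ st w := by
    obtain ⟨x, hx, hbx⟩ := hs.exists_color (hbP w hw) k
    have hg := hbgw x hx
    rw [hgx] at hg
    by_cases hxe : x = e 0 ∨ x = e 1 ∨ x = e (n - 1)
    · rcases hxe with rfl | rfl | rfl
      · exact hx
      · exact absurd (hbx.symm.trans b1) hka
      · exact absurd (hbx.symm.trans bl) hka
    · rw [if_neg hxe, b0, b1, hbx, Equiv.swap_apply_left] at hg
      exact absurd hg hka
  have hdN : Normalized st W₀ (q 0) d d := ⟨hf.proper, Set.eqOn_refl _ _⟩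
  have hdN' : Normalized st W₀ (q 0) d d' :=
    hE.normalized hc₀ hf'.proper (hf.zero.trans hf'.zero.symm) (hf.one.trans hf'.one.symm)
  have key : ∀ x ∈ st w, d x = d' x → F d u (d x) = F d' u (d x) := by
    intro x hx hdd
    have e1 := hβ d hdN x hx
    have e2 := hβ d' hdN' x hx
    beta_reduce at e1 e2
    rw [if_neg (by rwa [hf.last])] at e1
    rw [if_neg (by rwa [hf'.last])] at e2
    rw [e1, hdd, e2]
  have k0 := key (e 0) hew (hf.zero.trans hf'.zero.symm)
  rcases hE.star_zero w hw hew with rfl | rfl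
  · exact eq_of_agree_two (hF.inj _ _ hf) (hF.inj _ _ hf') (hE.e_zero_ne_one hf.proper) k0
      (key (e 1) hE.e_one_mem (hf.one.trans hf'.one.symm))
  · exact eq_of_agree_two (hF.inj _ _ hf) (hF.inj _ _ hf') (hE.e_zero_ne_last hf.proper) k0
      (key (e (n - 1)) hE.e_last_mem (hf.last.trans hf'.last.symm))

/-- If the system does not depend on the colouring for one kind of words, then it never does. -/
theorem IsEarSystem.eq_of_colorings (hF : IsEarSystem st W₀ n e k a F)
    (hE : EarEdges st W W₀ n q e h) (hs : IsCubicStar G st) (hR : HasDictators st W₀)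
    (hty : ∃ c, Proper st W₀ c ∧ c (e 1) = c (e (n - 1)))
    (hA : ∀ d d' w, Fits st W₀ n e k a d w → Fits st W₀ n e k a d' w → w (n - 1) = a →
      F d w = F d' w)
    (hf : Fits st W₀ n e k a d u) (hf' : Fits st W₀ n e k a d' u) : F d u = F d' u := by
  have hn := hE.four_le
  by_cases hua : u (n - 1) = a
  · exact hA d d' u hf hf' hua
  have hka := hf.word.ne hn
  rcases hf.word.isWord.linked_or hn (by rw [hf.word.one]; exact Ne.symm hua) with
    hL | ⟨⟨v, hv, hvL, hvs, hvsh⟩, v', hv', hvL', hvs', hvsh'⟩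
  · exact hF.apply_eq_of_linked hE hs hR hty hA hf hf' hua hL
  · have key : ∀ v s, IsWord n v → Linked n v → WSame n u v → WShare n s u v →
        F d u s = F d' u s := by
      intro v s hv hvL hvs hvsh
      have f1 := hf.replace_word hv hvs
      have f2 := hf'.replace_word hv hvs
      rw [hF.share_word hf f1 hvsh, hF.share_word hf' f2 hvsh,
        hF.apply_eq_of_linked hE hs hR hty hA f1 f2 (by rwa [← hvs.2.2]) hvL]
    refine eq_of_agree_two (hF.inj _ _ hf) (hF.inj _ _ hf') ?_ (key v _ hv hvL hvs hvsh)
      (key v' _ hv' hvL' hvs' hvsh')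
    rw [hf.word.one]
    exact Ne.symm hua

/-- If the system does not depend on the colouring, then it is dictated by a vertex of the
cycle. -/
theorem IsEarSystem.dictated_right (hF : IsEarSystem st W₀ n e k a F)
    (hE : EarEdges st W W₀ n q e h) (hka : k ≠ a) (hty : BothTypes st W₀ (q 0) (q (n - 1)))
    (hsh : ∃ d d', Proper st W₀ d ∧ Proper st W₀ d' ∧ d (e 0) = k ∧ d (e 1) = a ∧
      d (e (n - 1)) = a ∧ d' (e 0) = k ∧ d' (e 1) = a ∧ d' (e (n - 1)) ≠ a ∧
      Share (edgesOf st W₀) k d d')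
    (hd : ∀ d d' w, Fits st W₀ n e k a d w → Fits st W₀ n e k a d' w → F d w = F d' w) :
    ∃ i < n, ∃ β β', ∀ d u, Fits st W₀ n e k a d u →
      F d u (u i) = β ∧ F d u (u (i + 1)) = β' := by
  have hn := hE.four_le
  choose! D hD using fun u (hu : WordIn n k a u) => hE.exists_fit hty hu.isWord
  have hfit : ∀ u, WordIn n k a u → Fits st W₀ n e k a (D u) u :=
    fun u hu => .of_same (hD u hu).1 hu (hD u hu).2
  obtain ⟨d, d', hdP, hdP', d0, d1, dl, d0', d1', dl', hdd⟩ := hsh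
  -- Words of different types can share only `k`. The chosen colourings `D u` and `D u'` need not
  -- share `k`, but since the colouring is irrelevant they may be replaced by `d` and `d'`, which
  -- do.
  have hmixed : ∀ u u' s, WordIn n k a u → WordIn n k a u' → u (n - 1) = a → u' (n - 1) ≠ a →
      WShare n s u u' → F (D u) u s = F (D u') u' s := by
    intro u u' s hu hu' hua hua' huu
    have hl' := hu'.last_eq_thd hn hua'
    have hs : s = k := by
      have h1 := huu (n - 1) (by omega)
      rw [hua, hl'] at h1
      rcases eq_or_eq_or_eq_thd hka s with rfl | rfl | rfl
      · rfl
      · exact absurd (h1.1 rfl) (thd_ne_right hka)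
      · exact absurd (h1.2 rfl).symm (thd_ne_right hka)
    subst hs
    have f1 : Fits st W₀ n e s a d u := ⟨hdP, hu, d0, d1, dl.trans hua.symm⟩
    have f2 : Fits st W₀ n e s a d' u' := ⟨hdP', hu', d0', d1', by
      rw [hl', ← d0']
      refine eq_thd (by rwa [d0']) (hE.e_zero_ne_last hdP').symm dl'⟩
    rw [hd _ _ _ (hfit u hu) f1, hd _ _ _ (hfit u' hu') f2]
    exact hF.share _ _ _ _ _ f1 f2 hdd huu
  obtain ⟨i, hi, β, β', hβ⟩ := IsWordSystem.dictated (f := fun u => F (D u) u) hn hka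
    ⟨fun u hu => hF.inj _ _ (hfit u hu), fun u u' hu hu' s huu => by
      by_cases h1 : u (n - 1) = a <;> by_cases h2 : u' (n - 1) = a
      · have f1 : Fits st W₀ n e k a (D u) u' := ⟨(hfit u hu).proper, hu', (hfit u hu).zero,
          (hfit u hu).one, (hfit u hu).last.trans (h1.trans h2.symm)⟩
        rw [hF.share_word (hfit u hu) f1 huu, hd _ _ _ f1 (hfit u' hu')]
      · exact hmixed u u' s hu hu' h1 h2 huu
      · exact (hmixed u' u s hu' hu h2 h1 huu.symm).symm
      · have f1 : Fits st W₀ n e k a (D u) u' := ⟨(hfit u hu).proper, hu', (hfit u hu).zero,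
          (hfit u hu).one, (hfit u hu).last.trans
            ((hu.last_eq_thd hn h1).trans (hu'.last_eq_thd hn h2).symm)⟩
        rw [hF.share_word (hfit u hu) f1 huu, hd _ _ _ f1 (hfit u' hu')]⟩
  refine ⟨i, hi, β, β', fun d u hf => ?_⟩
  rw [hd _ _ _ hf (hfit u hf.word)]
  exact hβ u hf.word

variable [Finite V]

/-- A path of sharing steps from one type to the other contains a step that changes the type, and
such a step shares the class of `e 0`. -/
theorem EarEdges.exists_share_of_types (hG : NoK23Minor G) (hT : G.CliqueFree 3)
    (hs : IsCubicStar G st) (hE : EarEdges st W W₀ n q e h) (hW : ConnIn G W₀) (hka : k ≠ a) :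
    ∃ d d', Proper st W₀ d ∧ Proper st W₀ d' ∧ d (e 0) = k ∧ d (e 1) = a ∧
      d (e (n - 1)) = a ∧ d' (e 0) = k ∧ d' (e 1) = a ∧ d' (e (n - 1)) ≠ a ∧
      Share (edgesOf st W₀) k d d' := by
  obtain ⟨⟨c, hc, tc⟩, c', hc', tc'⟩ := hE.exists_type
    (hG.bothTypes hT hs hW hE.mem_zero hE.mem_last (hE.adj hs))
  have hnorm : ∀ c, Proper st W₀ c → ∃ σ : Equiv.Perm (Fin 3), σ (c (e 0)) = k ∧ σ (c (e 1)) = a :=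
    fun c hc => exists_perm_of_ne (hE.e_zero_ne_one hc) hka
  obtain ⟨σ, σ0, σ1⟩ := hnorm c hc
  obtain ⟨τ, τ0, τ1⟩ := hnorm c' hc'
  have hN := hE.normalized ((hc.perm σ) _ hE.mem_zero) (hc'.perm τ)
    (σ0.trans τ0.symm) (σ1.trans τ1.symm)
  have hp := hG.sharingConnected hT hs hW hE.mem_zero hE.e_one_mem
    (fun v hv hv' => hE.star_one v hv hv') (σ ∘ c) (τ ∘ c') (hc.perm σ) (hc'.perm τ) trivial trivial
    hN.2
  have t1 : (σ ∘ c) (e (n - 1)) = a := (congrArg σ tc).symm.trans σ1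
  have t2 : (τ ∘ c') (e (n - 1)) ≠ a := by
    rw [← τ1]; exact τ.injective.ne tc'.symm
  have z : (σ ∘ c) (e 0) = k := σ0
  have o : (σ ∘ c) (e 1) = a := σ1
  have hd := hc.perm σ
  clear hN
  generalize σ ∘ c = d at *
  generalize τ ∘ c' = d' at *
  clear hc' tc' τ0 τ1
  by_contra hno
  refine t2 ?_
  clear t2
  induction hp with
  | refl => exact t1
  | @tail b b' hp hstep ih =>
    have hdb := (sharing_end hp ⟨hd, trivial⟩).2
    have hdb' := (sharing_end (hp.tail hstep) ⟨hd, trivial⟩).2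
    obtain ⟨⟨hb, -⟩, ⟨hb', -⟩, -, s, -, hsh⟩ := hstep
    have hl := ih
    have z1 := (hdb hE.e_zero_mem).symm.trans z
    have o1 := (hdb hE.e_one_mem).symm.trans o
    have z2 := (hdb' hE.e_zero_mem).symm.trans z
    have o2 := (hdb' hE.e_one_mem).symm.trans o
    by_contra hl'
    obtain ⟨hk, -⟩ := hE.eq_of_share_of_type hb' hsh (o1.trans hl.symm)
      (by rw [o2]; exact Ne.symm hl')
    rw [z1] at hk
    subst hk
    exact hno ⟨b, b', hb, hb', z1, o1, hl, z2, o2, hl', hsh⟩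

/-- Over an ear the system is dictated by a vertex. -/
theorem EarEdges.hasDictators (hG : NoK23Minor G) (hT : G.CliqueFree 3)
    (hs : IsCubicStar G st) (hE : EarEdges st W W₀ n q e h) (hW : ConnIn G W₀)
    (hR : HasDictators st W₀) : HasDictators st W := by
  have hn := hE.four_le
  have hty := hG.bothTypes hT hs hW hE.mem_zero hE.mem_last (hE.adj hs)
  obtain ⟨c₀, hc₀⟩ := hG.exists_proper hT hs hW hE.mem_zero
  have hi₀ := hc₀ _ hE.mem_zero
  refine .of_isDictated hs (hE.subset hE.mem_zero) hi₀ fun f hf => ?_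
  obtain ⟨k, hk⟩ : ∃ k, c₀ (e 0) = k := ⟨_, rfl⟩
  obtain ⟨a, ha⟩ : ∃ a, c₀ (e 1) = a := ⟨_, rfl⟩
  have hka : k ≠ a := by rw [← hk, ← ha]; exact hE.e_zero_ne_one hc₀
  have hglue : ∀ d u, Fits st W₀ n e k a d u →
      Normalized st W (q 0) c₀ (glue st W₀ d (cycleColoring n e h u)) := by
    intro d u hfit
    refine ⟨hE.proper_glue hfit.proper hfit.word.isWord hfit.same, fun x hx => ?_⟩
    rw [glue_eqOn_left (mem_edgesOf hE.mem_zero hx)]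
    exact (hE.normalized hi₀ hfit.proper (hk.trans hfit.zero.symm)
      (ha.trans hfit.one.symm)).2 hx
  have hF : IsEarSystem st W₀ n e k a fun d u => f (glue st W₀ d (cycleColoring n e h u)) :=
    ⟨fun d u hfit => hf.inj _ (hglue d u hfit), fun d u d' u' s h1 h2 hsd hsu =>
      hf.share _ _ (hglue d u h1) (hglue d' u' h2) s (hE.share_glue h1.proper h1.word.isWord
        h1.same h2.proper h2.word.isWord h2.same hsd hsu)⟩
  have hfit : ∀ c, Normalized st W (q 0) c₀ c → Fits st W₀ n e k a c (fun j => c (e j)) ∧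
      f c = f (glue st W₀ c (cycleColoring n e h fun j => c (e j))) := by
    intro c hc
    have hw := hE.isWord (hE.proper_cycle hc.1)
    have z := (hc.2 hE.e_zero_mem).symm.trans hk
    have o := (hc.2 hE.e_one_mem).symm.trans ha
    have hfit : Fits st W₀ n e k a c fun j => c (e j) :=
      ⟨hE.proper_left hc.1, ⟨hw, z, o⟩, z, o, rfl⟩
    exact ⟨hfit, hf.congr hc (hglue _ _ hfit) (hE.eqOn_glue hc.1)⟩
  -- For the equal type every normalized colouring fits every word with last letter `a`, so the two
  -- arguments are independent. Colourings move by steps that avoid the class of `e 1`, and words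
  -- can avoid any prescribed letter other than `a`.
  have hsplit : (∀ d d' w, Fits st W₀ n e k a d w → Fits st W₀ n e k a d' w → w (n - 1) = a →
      f (glue st W₀ d (cycleColoring n e h w)) = f (glue st W₀ d' (cycleColoring n e h w))) ∨
      ∀ d w w', Fits st W₀ n e k a d w → Fits st W₀ n e k a d w' → w (n - 1) = a →
      f (glue st W₀ d (cycleColoring n e h w)) = f (glue st W₀ d (cycleColoring n e h w')) := by
    have hXY : ∀ (x : {d // Proper st W₀ d ∧ d (e 0) = k ∧ d (e 1) = a ∧ d (e (n - 1)) = a})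
        (y : {w // WordIn n k a w ∧ w (n - 1) = a}), Fits st W₀ n e k a x.1 y.1 := fun x y =>
      ⟨x.2.1, y.2.1, x.2.2.1, x.2.2.2.1, x.2.2.2.2.trans y.2.2.symm⟩
    rcases dichotomy
      (X := {d // Proper st W₀ d ∧ d (e 0) = k ∧ d (e 1) = a ∧ d (e (n - 1)) = a})
      (Y := {w // WordIn n k a w ∧ w (n - 1) = a}) (T := {s | s ≠ a})
      (f := fun x y => f (glue st W₀ x.1 (cycleColoring n e h y.1)))
      (RX := fun s x x' => Share (edgesOf st W₀) s x.1 x'.1)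
      (RY := fun s y y' => WShare n s y.1 y'.1)
      (fun x y => hF.inj _ _ (hXY x y))
      (fun s x x' y hR => hF.share_left (hXY x y) (hXY x' y) hR)
      (fun s x y y' hR => hF.share_word (hXY x y) (hXY x y') hR)
      (by
        rintro ⟨x, hx, x0, x1, xl⟩ ⟨x', hx', x0', x1', xl'⟩
        have hN := hE.normalized (hx _ hE.mem_zero) hx' (x0.trans x0'.symm) (x1.trans x1'.symm)
        have hp := hG.sharingConnected_type_one hT hs hE hW x x' hx hx' (x1.trans xl.symm)
          (x1'.trans xl'.symm) hN.2
        clear hN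
        induction hp with
        | refl => exact .refl
        | @tail b b' hp hstep ih =>
          have hdb := (sharing_end hp ⟨hx, x1.trans xl.symm⟩).2
          have z1 := (hdb hE.e_zero_mem).symm.trans x0
          have o1 := (hdb hE.e_one_mem).symm.trans x1
          obtain ⟨⟨hb, tb⟩, -, -, s, hs', hsh⟩ := hstep
          refine (ih hb z1 o1 (tb.symm.trans o1)).tail ⟨s, ?_, hsh⟩
          have := hs' (e 1) rfl
          rw [x1] at this
          exact this.symm)
      (by
        rintro t ht ⟨y, hy, yl⟩ ⟨y', hy', yl'⟩
        have hp := hy.isWord.connected hn hy'.isWord ⟨hy.zero.trans hy'.zero.symm,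
          hy.one.trans hy'.one.symm, yl.trans yl'.symm⟩ (ε := t) (by rw [hy.one]; exact Ne.symm ht)
          (by rw [yl]; exact Ne.symm ht)
        induction hp with
        | refl => exact .refl
        | @tail b b' hp hstep ih =>
          obtain ⟨hb, hb', hbb, s, hst, hsh⟩ := hstep
          exact (ih ⟨hb, hbb.1.trans hy'.zero, hbb.2.1.trans hy'.one⟩
            (hbb.2.2.trans yl')).tail ⟨s, hst, hsh⟩) with hd | hd
    · left
      intro d d' w h1 h2 hl
      exact hd ⟨d, h1.proper, h1.zero, h1.one, h1.last.trans hl⟩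
        ⟨d', h2.proper, h2.zero, h2.one, h2.last.trans hl⟩ ⟨w, h1.word, hl⟩
    · right
      intro d w w' h1 h2 hl
      exact hd ⟨d, h1.proper, h1.zero, h1.one, h1.last.trans hl⟩ ⟨w, h1.word, hl⟩
        ⟨w', h2.word, h2.last.symm.trans (h1.last.trans hl)⟩
  rcases hsplit with hA | hA
  · obtain ⟨i, hi, β, β', hβ⟩ := hF.dictated_right hE hka hty
      (hE.exists_share_of_types hG hT hs hW hka)
      fun d d' w h1 h2 => hF.eq_of_colorings hE hs hR (hE.exists_type hty).1 hA h1 h2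
    classical
    refine ⟨q i, by rw [hE.union]; exact Or.inr ⟨i, hi, rfl⟩,
      fun x => if x = e i then β else if x = e (i + 1) then β' else thd β β', fun c hc x hx => ?_⟩
    obtain ⟨hfc, hfe⟩ := hfit c hc
    obtain ⟨h1, h2⟩ := hβ c _ hfc
    rw [← hfe] at h1 h2
    have hci := hc.1 (q i) (by rw [hE.union]; exact Or.inr ⟨i, hi, rfl⟩)
    have hne := hE.ne_of_injOn hi hci
    have hee := hE.e_ne_succ hi
    rw [hE.star i hi] at hx
    rcases hx with rfl | rfl | rfl
    · simpa using h1
    · simpa [hee.symm] using h2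
    · beta_reduce
      rw [if_neg (hE.e_ne_h i hi i hi).symm, if_neg (hE.e_succ_ne_h hi hi).symm, hE.third hi hci,
        ← h1, ← h2]
      exact eq_thd ((hf.inj _ hc).ne hne) ((hf.inj _ hc).ne (thd_ne_left hne))
        ((hf.inj _ hc).ne (thd_ne_right hne))
  · obtain ⟨w, hw, β, hβ⟩ := hF.dictated_left hE hs hR hi₀ hk ha
      fun d w w' h1 h2 => hF.eq_of_words hG hT hs hE hW hA h1 h2
    refine ⟨w, hE.subset hw, β, fun c hc x hx => ?_⟩
    obtain ⟨hfc, hfe⟩ := hfit c hc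
    rw [hfe]
    exact hβ c _ hfc x hx

/-- In a cubic graph without a `K₂,₃` minor and without triangles all systems are dictated by a
vertex. -/
theorem NoK23Minor.hasDictators (hG : NoK23Minor G) (hT : G.CliqueFree 3)
    (hs : IsCubicStar G st) (hW : ConnIn G W) {r : V} (hr : r ∈ W) : HasDictators st W := by
  refine hG.induction hT (P := fun W _ _ => HasDictators st W) ?_ ?_ ?_ ?_ W hW r hr r hr (Or.inl rfl)
  · exact fun r => hasDictators_singleton hs r
  · exact fun r v hrv => ⟨hasDictators_pair hs hrv, hasDictators_pair hs hrv⟩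
  · intro W Wa Wb u r r' h hr hr' hrr iha ihb
    obtain ⟨a, ha⟩ := hG.exists_proper hT hs h.conn_left h.mem_left
    obtain ⟨b, hb⟩ := hG.exists_proper hT hs h.conn_right h.mem_right
    obtain ⟨σ, hσ⟩ := h.exists_extension hs ha hb
    exact h.hasDictators hG hT hs (h.proper_glue hs ha (hb.perm σ) hσ) (iha r hr r' hr' hrr)
      (ihb u h.mem_right u h.mem_right (Or.inl rfl))
  · intro W W₀ m q r r' h hr hr' hrr ih
    obtain ⟨e, k, hE⟩ := h.exists_earEdges hs
    exact hE.hasDictators hG hT hs h.conn (ih r hr r' hr' hrr)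

end EarDictators

/-! ### Reflexivity of line graphs -/

section Reflexivity

variable {V E : Type*} {G : SimpleGraph V} {st : V → Set E} {X : SimpleGraph E}

/-- The graph `X` is the line graph of the graph with the given stars. -/
structure IsStarGraph (st : V → Set E) (X : SimpleGraph E) : Prop where
  adj_iff : ∀ e f, X.Adj e f ↔ e ≠ f ∧ ∃ v, e ∈ st v ∧ f ∈ st v
  exists_mem : ∀ e, ∃ v, e ∈ st v

namespace IsStarGraph

variable (hX : IsStarGraph st X)
include hX

theorem proper (c : X.Coloring (Fin 3)) : Proper st Set.univ c := by
  intro v _ e he f hf hef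
  by_contra hne
  exact c.valid ((hX.adj_iff e f).2 ⟨hne, v, he, hf⟩) hef

theorem exists_coloring {c : E → Fin 3} (hc : Proper st Set.univ c) :
    ∃ c' : X.Coloring (Fin 3), ∀ e, c' e = c e :=
  ⟨SimpleGraph.Coloring.mk c fun {e f} h => by
    obtain ⟨hne, v, he, hf⟩ := (hX.adj_iff e f).1 h
    exact hc.ne trivial he hf hne, fun _ => rfl⟩

/-- Every colour class contains exactly one edge at every vertex. -/
theorem existsUnique_mem (hs : IsCubicStar G st) (C : ColorClass 3 X) (v : V) :
    ∃! e, e ∈ st v ∧ e ∈ C.1 := by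
  obtain ⟨C, c, i, rfl⟩ := C
  have hc := hX.proper c v trivial
  obtain ⟨e, he, hei⟩ := hs.exists_color hc i
  exact ⟨e, ⟨he, hei⟩, fun f hf => hc hf.1 he (Eq.trans hf.2 hei.symm)⟩

/-- A class is coloured by the colour in `c₀` of the unique edge at `v` that it contains. Different
classes of one colouring contain different edges at `v`. -/
theorem exists_coloring_complex (hs : IsCubicStar G st) (v : V) :
    ∃ γ : (coloringComplex 3 X).Coloring (Fin 3), ∀ e ∈ st v, ∃ i,
      canonicalClass 3 X e = γ.colorClass i := by
  obtain ⟨x, hx⟩ := hs.nonempty v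
  obtain ⟨y, y', hxy, -, -, hst⟩ := hs.exists_enum hx
  obtain ⟨c₀, hc₀, -⟩ := hs.exists_coloring hx (y := y) (by simp [hst]) hxy (a := 0) (b := 1)
    (by decide)
  choose g hg hguniq using fun C => hX.existsUnique_mem hs C v
  refine ⟨SimpleGraph.Coloring.mk (fun C => c₀ (g C)) fun {C C'} h h' => ?_, fun e he =>
    ⟨c₀ e, ?_⟩⟩
  · obtain ⟨hne, c, i, j, hi, hj⟩ := h
    have hgg := hc₀ (hg C).1 (hg C').1 h'
    have h1 := (hg C).2
    have h2 := (hg C').2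
    rw [hi] at h1
    rw [hj, ← hgg] at h2
    have hij : i = j := Eq.trans (Eq.symm h1) h2
    exact hne (Subtype.ext (by rw [hi, hj, hij]))
  · ext C
    constructor
    · intro h
      exact congrArg c₀ (hguniq C e ⟨he, h⟩).symm
    · intro h
      have : g C = e := hc₀ (hg C).1 he h
      rw [← this]
      exact (hg C).2

/-- The colour classes of the colouring complex consist of the colour classes that contain an
edge at a fixed vertex. -/
theorem exists_eq_canonicalClass (hs : IsCubicStar G st) [Nonempty V]
    (hD : HasDictators st Set.univ) (hc₀ : ∃ c, Proper st Set.univ c)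
    (γ : (coloringComplex 3 X).Coloring (Fin 3)) :
    ∃ w, ∀ i, ∃ e ∈ st w, γ.colorClass i = canonicalClass 3 X e := by
  classical
  obtain ⟨c, hc⟩ := hc₀
  have : Nonempty (X.Coloring (Fin 3)) := ⟨(hX.exists_coloring hc).choose⟩
  choose! t ht using fun c (hc : Proper st Set.univ c) => hX.exists_coloring hc
  -- The values of `γ` on the classes of `c` form a system. They are distinct because the classes of
  -- one colouring are pairwise adjacent in the complex, and distinct as every class meets every
  -- star.
  let f : (E → Fin 3) → Fin 3 → Fin 3 := fun c s => γ ⟨(t c).colorClass s, t c, s, rfl⟩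
  have hinj : ∀ c, Proper st Set.univ c → (f c).Injective := by
    intro c hc s s' hss
    by_contra hne
    refine γ.valid (v := ⟨(t c).colorClass s, t c, s, rfl⟩)
      (w := ⟨(t c).colorClass s', t c, s', rfl⟩) ⟨fun h => hne ?_, t c, s, s', rfl, rfl⟩ hss
    obtain ⟨e, -, he⟩ := hs.exists_color (hX.proper (t c) (Classical.arbitrary V) trivial) s
    have h1 : e ∈ (t c).colorClass s := he
    have h2 : (t c).colorClass s = (t c).colorClass s' := congrArg Subtype.val h
    rw [h2] at h1
    exact he.symm.trans h1
  obtain ⟨w, -, β, hβ⟩ := hD f ⟨hinj, fun c c' hc hc' s s' h => by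
    refine congrArg γ (Subtype.ext (Set.ext fun x => ?_))
    obtain ⟨v, hv⟩ := hX.exists_mem x
    have := h x ⟨v, trivial, hv⟩
    rw [← ht c hc, ← ht c' hc'] at this
    exact this⟩
  have hγ : ∀ C : ColorClass 3 X, ∀ x ∈ st w, x ∈ C.1 → γ C = β x := by
    rintro ⟨_, c, i, rfl⟩ x hx hxi
    rw [← hβ c (hX.proper c) x hx]
    refine congrArg γ (Subtype.ext (Set.ext fun y => ?_))
    change c y = i ↔ t c y = c x
    rw [ht c (hX.proper c), show c x = i from hxi]
  have hβi : ∀ x ∈ st w, ∀ y ∈ st w, β x = β y → x = y := by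
    intro x hx y hy h
    rw [← hβ c hc x hx, ← hβ c hc y hy] at h
    exact hc w trivial hx hy (hinj c hc h)
  refine ⟨w, fun i => ?_⟩
  obtain ⟨s, hsi⟩ := exists_eq_of_injective (hinj c hc) i
  obtain ⟨e, he, rfl⟩ := hs.exists_color (hc w trivial) s
  rw [hβ c hc e he] at hsi
  refine ⟨e, he, Set.ext fun C => ?_⟩
  obtain ⟨x, ⟨hx, hxC⟩, -⟩ := hX.existsUnique_mem hs C w
  constructor
  · intro h
    have h : γ C = i := h
    rw [hγ C x hx hxC, ← hsi] at h
    rw [← hβi x hx e he h]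
    exact hxC
  · intro h
    exact (hγ C e he h).trans hsi

theorem isReflexive (hs : IsCubicStar G st) [Nonempty V] (hD : HasDictators st Set.univ)
    (hc₀ : ∃ c, Proper st Set.univ c)
    (hsep : ∀ e f, e ≠ f → ∃ c, Proper st Set.univ c ∧ c e ≠ c f) : IsReflexive X := by
  obtain ⟨c, hc⟩ := hc₀
  obtain ⟨c', -⟩ := hX.exists_coloring hc
  refine ⟨⟨c'⟩, ?_⟩
  have hinj : Function.Injective (canonicalClass 3 X) := by
    intro e f hef
    by_contra hne
    obtain ⟨b, hb, hbe⟩ := hsep e f hne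
    obtain ⟨b', hb'⟩ := hX.exists_coloring hb
    let C : ColorClass 3 X := ⟨b'.colorClass (b' e), b', b' e, rfl⟩
    have h1 : C ∈ canonicalClass 3 X e := rfl
    rw [hef] at h1
    have h1 : b' f = b' e := h1
    rw [hb', hb'] at h1
    exact hbe h1.symm
  have hmem : ∀ e, ∃ (γ : (coloringComplex 3 X).Coloring (Fin 3)) (i : Fin 3),
      canonicalClass 3 X e = γ.colorClass i := by
    intro e
    obtain ⟨v, hv⟩ := hX.exists_mem e
    obtain ⟨γ, hγ⟩ := hX.exists_coloring_complex hs v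
    exact ⟨γ, hγ e hv⟩
  let φ : E → ColorClass 3 (coloringComplex 3 X) := fun e => ⟨canonicalClass 3 X e, hmem e⟩
  have hφ : Function.Bijective φ := by
    refine ⟨fun e f h => hinj (congrArg Subtype.val h), ?_⟩
    rintro ⟨K, γ, i, rfl⟩
    obtain ⟨w, hw⟩ := hX.exists_eq_canonicalClass hs hD ⟨c, hc⟩ γ
    obtain ⟨e, -, he⟩ := hw i
    exact ⟨e, Subtype.ext he.symm⟩
  refine ⟨⟨Equiv.ofBijective φ hφ, fun {e f} => ⟨?_, fun h => ?_⟩⟩, fun _ => rfl⟩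
  · rintro ⟨hne, γ, i, j, hi, hj⟩
    obtain ⟨w, hw⟩ := hX.exists_eq_canonicalClass hs hD ⟨c, hc⟩ γ
    obtain ⟨x, hx, hxi⟩ := hw i
    obtain ⟨y, hy, hyj⟩ := hw j
    obtain rfl : e = x := hinj (Eq.trans hi hxi)
    obtain rfl : f = y := hinj (Eq.trans hj hyj)
    exact (hX.adj_iff e f).2 ⟨fun h => hne (congrArg φ h), w, hx, hy⟩
  · obtain ⟨hne, v, he, hf⟩ := (hX.adj_iff e f).1 h
    obtain ⟨γ, hγ⟩ := hX.exists_coloring_complex hs v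
    obtain ⟨i, hi⟩ := hγ e he
    obtain ⟨j, hj⟩ := hγ f hf
    exact ⟨fun h => hne (hφ.1 h), γ, i, j, hi, hj⟩

/-- In every colouring the side `x` of the triangle and the third edge `x'` at the opposite vertex
both have the colour different from those of the two other sides. So `x` and `x'` lie in the same
classes, contrary to injectivity. -/
theorem cliqueFree (hs : IsCubicStar G st) (h : IsReflexive X) : G.CliqueFree 3 := by
  classical
  intro S hS
  obtain ⟨u, v, w, huv, huw, hvw, -⟩ := SimpleGraph.is3Clique_iff.1 hS
  obtain ⟨-, φ, hφ⟩ := h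
  obtain ⟨x, hxu, hxv⟩ := (hs.adj_iff u v huv.ne).2 huv
  obtain ⟨y, hyu, hyw⟩ := (hs.adj_iff u w huw.ne).2 huw
  obtain ⟨z, hzv, hzw⟩ := (hs.adj_iff v w hvw.ne).2 hvw
  have hxw : x ∉ st w := fun hxw => by
    rcases hs.two x u v w hxu hxv hxw with h' | h' | h'
    · exact huv.ne h'
    · exact hvw.ne h'
    · exact huw.ne h'
  have hyz : y ≠ z := by
    rintro rfl
    rcases hs.two y u v w hyu hzv hyw with h' | h' | h'
    · exact huv.ne h'
    · exact hvw.ne h'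
    · exact huw.ne h'
  obtain ⟨x', hx', hx'y, hx'z, -⟩ := hs.exists_third hyw hzw hyz
  have hxy : x ≠ y := fun h => hxw (h ▸ hyw)
  have hxz : x ≠ z := fun h => hxw (h ▸ hzw)
  have hcol : ∀ c : X.Coloring (Fin 3), c x = c x' := by
    intro c
    have hc := hX.proper c
    have h1 := hc.ne trivial hyw hzw hyz
    exact (eq_thd h1 (hc.ne trivial hxu hyu hxy) (hc.ne trivial hxv hzv hxz)).trans
      (eq_thd h1 (hc.ne trivial hx' hyw hx'y) (hc.ne trivial hx' hzw hx'z)).symm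
  have hcc : canonicalClass 3 X x = canonicalClass 3 X x' := by
    ext ⟨_, c, i, rfl⟩
    change c x = i ↔ c x' = i
    rw [hcol]
  rw [← hφ, ← hφ] at hcc
  have : x = x' := φ.injective (Subtype.ext hcc)
  exact hxw (this ▸ hx')

end IsStarGraph

end Reflexivity

/-! ### Stars of graphs with half-edges -/

namespace HalfEdgeGraph

variable {V H : Type*} (G : HalfEdgeGraph V H)

/-- The edges and half-edges that are incident with a vertex. -/
def star (v : V) : Set G.Edge := {e | v ∈ G.ends e}

variable {G}

theorem eq_of_mem_star {v w : V} (hne : v ≠ w) {e : G.Edge} (hv : e ∈ G.star v)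
    (hw : e ∈ G.star w) : ∃ h : G.graph.Adj v w, e = Sum.inl ⟨s(v, w), h⟩ := by
  rcases e with ⟨e, he⟩ | a
  · obtain rfl : e = s(v, w) := (Sym2.mem_and_mem_iff hne).1 ⟨hv, hw⟩
    exact ⟨he, rfl⟩
  · exact absurd (Eq.trans (Set.mem_singleton_iff.1 hv) (Set.mem_singleton_iff.1 hw).symm) hne

theorem IsCubic.isCubicStar (h : G.IsCubic) : IsCubicStar G.graph G.star where
  card := h
  adj_iff v w hne := by
    constructor
    · rintro ⟨e, hv, hw⟩
      exact (eq_of_mem_star hne hv hw).1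
    · exact fun h => ⟨Sum.inl ⟨s(v, w), h⟩, Sym2.mem_mk_left v w, Sym2.mem_mk_right v w⟩
  unique v w hne e f hev hew hfv hfw := by
    obtain ⟨_, rfl⟩ := eq_of_mem_star hne hev hew
    obtain ⟨_, rfl⟩ := eq_of_mem_star hne hfv hfw
    rfl
  two e u v w hu hv hw := by
    by_cases huv : u = v
    · exact Or.inl huv
    obtain ⟨_, rfl⟩ := eq_of_mem_star huv hu hv
    rcases Sym2.mem_iff.1 hw with h | h
    · exact Or.inr (Or.inr h.symm)
    · exact Or.inr (Or.inl h.symm)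

theorem isStarGraph : IsStarGraph G.star G.lineGraph where
  adj_iff _ _ := Iff.rfl
  exists_mem e := by
    rcases e with ⟨e, he⟩ | a
    · induction e with
      | _ v w => exact ⟨v, Sym2.mem_mk_left v w⟩
    · exact ⟨G.attach a, rfl⟩

end HalfEdgeGraph

theorem SimpleGraph.Connected.connIn_univ {V : Type*} {G : SimpleGraph V} (h : G.Connected) :
    ConnIn G Set.univ := by
  intro a _ b _
  obtain ⟨p⟩ := h.preconnected a b
  induction p with
  | nil => exact .refl
  | cons hadj _ ih => exact .head ⟨hadj, trivial, trivial⟩ (ih trivial trivial)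

theorem theorem3p1 {V H : Type*} [Finite V] (G : HalfEdgeGraph V H)
    (hconn : G.graph.Connected) (hcubic : G.IsCubic) (houter : IsOuterplanar G.graph) :
    G.IsEdgeReflexive ↔ G.graph.CliqueFree 3 := by
  have hs := hcubic.isCubicStar
  have hX := HalfEdgeGraph.isStarGraph (G := G)
  refine ⟨hX.cliqueFree hs, fun hT => ?_⟩
  have hG := houter.noK23Minor
  have hW := hconn.connIn_univ
  have := hconn.nonempty
  have hr := Set.mem_univ (Classical.arbitrary V)
  refine hX.isReflexive hs (hG.hasDictators hT hs hW hr) (hG.exists_proper hT hs hW hr) ?_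
  intro e f hef
  obtain ⟨v, hv⟩ := hX.exists_mem e
  obtain ⟨w, hw⟩ := hX.exists_mem f
  exact hG.exists_separate hT hs hW ⟨v, trivial, hv⟩ ⟨w, trivial, hw⟩ hef
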